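/- Let $M$ be a compact Hausdorff smooth manifold without boundary, of dimension $n$, and let $E\to M$ be a Courant algebroid: a smooth real vector bundle of finite rank with a fibrewise nondegenerate symmetric bilinear form $\langle\cdot,\cdot\rangle$, a bundle map $\rho\colon E\to TM$ and an $\mathbb R$-bilinear bracket on $\Gamma(E)$ such that, for all $u,v,w\in\Gamma(E)$ and $f\in C^\infty(M)$, $[u,[v,w]]=[[u,v],w]+[v,[u,w]]$, $[u,fv]=f[u,v]+(\rho(u)f)v$, $\rho(u)\langle v,w\rangle=\langle[u,v],w\rangle+\langle v,[u,w]\rangle$ and $[u,v]+[v,u]=\mathcal D\langle u,v\rangle$, where $\mathcal Df\in\Gamma(E)$ is defined by $\langle\mathcal Df,u\rangle=\rho(u)f$. Let $(e_\alpha)$ denote a local frame of $E$ and $(e^\alpha)$ the dual frame, $\langle e^\alpha,e_\beta\rangle=\delta^\alpha_\beta$; repeated indices are summed, and indices are raised and lowered with $\langle\cdot,\cdot\rangle$. A generalized pseudometric is a smooth bundle endomorphism $\mathcal G$ of $E$ that is self-adjoint for $\langle\cdot,\cdot\rangle$ and satisfies $\mathcal G^2=\mathrm{Id}$, such that neither of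 its eigenbundles $V_\pm=\ker(\mathcal G\mp\mathrm{Id})$ has rank $1$. (Generalized metrics, for which moreover $\langle\cdot,\cdot\rangle|_{V_+}>0$ and $\rho|_{V_+}\colon V_+\to TM$ is an isomorphism, are a special case.) For a positive smooth half-density $\sigma$ on $M$ put $\operatorname{div}_\sigma u=2\sigma^{-1}L_{\rho(u)}\sigma$. A Courant algebroid connection is a map $D\colon\Gamma(E)\times\Gamma(E)\to\Gamma(E)$, $(u,v)\mapsto D_uv$, that is $C^\infty(M)$-linear in $u$ and $\mathbb R$-linear in $v$, with $D_u(fv)=fD_uv+(\rho(u)f)v$ and $\rho(u)\langle v,w\rangle=\langle D_uv,w\rangle+\langle v,D_uw\rangle$. Write $D\in LC(\mathcal G,\operatorname{div}_\sigma)$ if $D_u(\mathcal Gv)=\mathcal G D_uv$ for all $u,v$, if $D$ is torsion-free, that is $\langle D_uv-D_vu-[u,v],w\rangle+\langle D_wu,v\rangle=0$ for all $u,v,w$, and if $\operatorname{Tr}(e\mapsto D_eu)=\operatorname{div}_\sigma u$ for all $u$. For such $D$ put $$\mathrm{Rm}(w,z,x,y)=\tfrac12\bigl(\langle w,[D,D]_{x,y}z\rangle+\langle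 y,[D,D]_{z,w}x\rangle-\langle D_{e_\alpha}x,y\rangle\langle D_{e^\alpha}z,w\rangle\bigr),$$ where $[D,D]_{x,y}z=D_xD_yz-D_{D_xy}z-D_yD_xz+D_{D_yx}z$; this is a tensor. Define endomorphisms of $E$ by $\langle v,\mathrm{fRc}(u)\rangle=\mathrm{Rm}(e^\alpha,v,e_\alpha,u)$ and $\mathrm{Rc}_{\mathcal G,\sigma}=\mathrm{fRc}-\mathcal G\,\mathrm{fRc}\,\mathcal G$, and the generalized scalar curvature by $\mathcal R_{\mathcal G,\sigma}=\operatorname{Tr}(\mathcal G\,\mathrm{fRc})$. Connections in $LC(\mathcal G,\operatorname{div}_\sigma)$ exist, and $\mathrm{Rc}_{\mathcal G,\sigma}$ and $\mathcal R_{\mathcal G,\sigma}$ do not depend on the choice of $D$ among them. Let $\Delta_{\mathcal G,\sigma}f=\operatorname{div}_\sigma(\mathcal G\mathcal Df)$ for $f\in C^\infty(M)$, and for a bilinear form $B$ on a fibre of $E$ let $|B|^2_{\mathcal G}=\mathcal G^{\alpha\gamma}\mathcal G^{\beta\delta}B_{\alpha\beta}B_{\gamma\delta}$ be its squared norm for the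 (possibly indefinite) fibrewise inner product $\langle\mathcal G\cdot,\cdot\rangle$. Let $J\subset\mathbb R$ be an interval and let $(\mathcal G_t,\sigma_t)_{t\in J}$ be a family of generalized pseudometrics and positive half-densities, smooth on $J\times M$, that solves generalized Ricci flow $$\partial_t\mathcal G=-2\,\mathrm{Rc}_{\mathcal G,\sigma},\qquad\partial_t\sigma=-\tfrac12\mathcal R_{\mathcal G,\sigma}\,\sigma$$ (derivatives at endpoints belonging to $J$ are one-sided). Then for every $t\in J$ the function $\mathcal R=\mathcal R_{\mathcal G_t,\sigma_t}$ is smooth on $M$, and at every point of $M$ $$\partial_t\mathcal R=\Delta_{\mathcal G,\sigma}\mathcal R+|\mathrm{Rc}_{\mathcal G,\sigma}|^2_{\mathcal G}.$$ -/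

import Mathlib

open Bundle Set
open scoped Manifold ContDiff

noncomputable section

namespace CourantFlow

/-- The space `Γ(E)` of smooth sections of `E → M`. -/
abbrev Sec (n : ℕ) {M : Type*} [TopologicalSpace M] [ChartedSpace (EuclideanSpace ℝ (Fin n)) M]
    (F : Type*) [NormedAddCommGroup F] [NormedSpace ℝ F]
    (E : M → Type*) [TopologicalSpace (TotalSpace F E)] [∀ p, TopologicalSpace (E p)]
    [FiberBundle F E] :=
  Cₛ^∞⟮𝓡 n; F, E⟯

section Functions

variable {n : ℕ} {M : Type*} [TopologicalSpace M] [ChartedSpace (EuclideanSpace ℝ (Fin n)) M]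

/-- The derivative `X f` of a function `f` on `M` along a tangent vector `X` at `p`. -/
def dirDeriv (f : M → ℝ) (p : M) (X : TangentSpace (𝓡 n) p) : ℝ :=
  mfderiv (𝓡 n) 𝓘(ℝ, ℝ) f p X

end Functions

section Sections

variable {n : ℕ} {M : Type*} [TopologicalSpace M] [ChartedSpace (EuclideanSpace ℝ (Fin n)) M]
  {F : Type*} [NormedAddCommGroup F] [NormedSpace ℝ F]
  {E : M → Type*} [TopologicalSpace (TotalSpace F E)]
  [∀ p, AddCommGroup (E p)] [∀ p, Module ℝ (E p)] [∀ p, TopologicalSpace (E p)]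
  [FiberBundle F E] [VectorBundle ℝ F E]

/-- The product `f u` of a smooth function and a smooth section. -/
def fsmul (f : C^∞⟮𝓡 n, M; ℝ⟯) (u : Sec n F E) : Sec n F E :=
  ⟨fun p => f p • u p, f.contMDiff.smul_section u.contMDiff⟩

/-- Every vector of a fibre is the value of a global smooth section. -/
theorem exists_section [IsManifold (𝓡 n) ∞ M] [ContMDiffVectorBundle ∞ F E (𝓡 n)]
    [SigmaCompactSpace M] [T2Space M] (p : M) (e : E p) : ∃ u : Sec n F E, u p = e := by
  classical
  let t := trivializationAt F E p
  have hp : p ∈ t.baseSet := FiberBundle.mem_baseSet_trivializationAt F E p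
  have hconv : ∀ q, Convex ℝ {v : E q | ∀ h : q = p, h ▸ v = e} := by
    intro q
    by_cases h : q = p
    · subst h
      have : {v : E q | ∀ h : q = q, h ▸ v = e} = {e} := by
        ext v; simp
      rw [this]
      exact convex_singleton e
    · have : {v : E q | ∀ h : q = p, h ▸ v = e} = univ := by
        ext v; simp [h]
      rw [this]
      exact convex_univ
  obtain ⟨s, hs⟩ := exists_contMDiffSection_forall_mem_convex_of_local (𝓡 n) (n := ⊤)
    (F_fiber := F) E (fun q => {v | ∀ h : q = p, h ▸ v = e}) hconv (fun x₀ => by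
      by_cases hx : x₀ = p
      · subst hx
        refine ⟨t.baseSet, t.open_baseSet.mem_nhds hp, fun q => t.symm q (t ⟨x₀, e⟩).2, ?_, ?_⟩
        · have := t.contMDiffOn_symm (n := ∞) (IB := 𝓡 n)
          refine (this.comp (s := t.baseSet) (f := fun q => (q, (t ⟨x₀, e⟩).2))
            (contMDiffOn_id.prodMk contMDiffOn_const) ?_).congr ?_
          · intro q hq
            simpa [Trivialization.mem_target] using hq
          · intro q hq
            simp only [Function.comp]
            rw [← t.mk_symm hq]
        · intro y hy h
          subst h
          exact t.symm_apply_apply_mk hy e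
      · refine ⟨{p}ᶜ, isOpen_compl_singleton.mem_nhds hx, fun _ => 0, ?_, ?_⟩
        · exact (contMDiff_zeroSection ℝ E).contMDiffOn
        · intro y hy h
          exact absurd h hy)
  exact ⟨s, hs p rfl⟩

/-- A chosen global smooth section through a vector of a fibre; it only serves to evaluate
tensorial expressions on vectors, and these do not depend on the choice. -/
def ext [IsManifold (𝓡 n) ∞ M] [ContMDiffVectorBundle ∞ F E (𝓡 n)]
    [SigmaCompactSpace M] [T2Space M] {p : M} (e : E p) : Sec n F E :=
  (exists_section (n := n) (F := F) p e).choose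

variable (F) in
/-- A basis of the fibre at `p` (the dimension of the fibres is that of the model fibre `F`). -/
def frame [FiniteDimensional ℝ F] (E : M → Type*) [TopologicalSpace (TotalSpace F E)]
    [∀ p, AddCommGroup (E p)] [∀ p, Module ℝ (E p)] [∀ p, TopologicalSpace (E p)]
    [FiberBundle F E] [VectorBundle ℝ F E] (p : M) :
    Module.Basis (Fin (Module.finrank ℝ F)) ℝ (E p) :=
  (Module.finBasis ℝ F).map (VectorBundle.continuousLinearEquivAt ℝ F E p).symm.toLinearEquiv

end Sections

/-- A Courant algebroid structure on the smooth vector bundle `E → M`: a bracket on sections, a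
fibrewise nondegenerate symmetric pairing, and an anchor `E → TM`. In `bracket_symm` the operator
`𝒟 f`, for which `⟨𝒟 f, w⟩ = ρ(w) f`, is paired with an arbitrary section `w`. -/
structure CourantAlgebroid (n : ℕ) {M : Type*} [TopologicalSpace M]
    [ChartedSpace (EuclideanSpace ℝ (Fin n)) M] [IsManifold (𝓡 n) ∞ M]
    (F : Type*) [NormedAddCommGroup F] [NormedSpace ℝ F]
    (E : M → Type*) [TopologicalSpace (TotalSpace F E)]
    [∀ p, AddCommGroup (E p)] [∀ p, Module ℝ (E p)] [∀ p, TopologicalSpace (E p)]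
    [FiberBundle F E] [VectorBundle ℝ F E] where
  bracket : Sec n F E →ₗ[ℝ] Sec n F E →ₗ[ℝ] Sec n F E
  pairing : ∀ p, LinearMap.BilinForm ℝ (E p)
  anchor : ∀ p, E p →ₗ[ℝ] TangentSpace (𝓡 n) p
  pairing_smooth : ∀ u v : Sec n F E,
    ContMDiff (𝓡 n) 𝓘(ℝ, ℝ) ∞ (fun p => pairing p (u p) (v p))
  pairing_symm : ∀ p, (pairing p).IsSymm
  pairing_nondegenerate : ∀ p, (pairing p).Nondegenerate
  anchor_smooth : ∀ u : Sec n F E,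
    ContMDiff (𝓡 n) (𝓡 n).tangent ∞
      (fun p => (⟨p, anchor p (u p)⟩ : TangentBundle (𝓡 n) M))
  jacobi : ∀ u v w : Sec n F E,
    bracket u (bracket v w) = bracket (bracket u v) w + bracket v (bracket u w)
  leibniz : ∀ (u v : Sec n F E) (f : C^∞⟮𝓡 n, M; ℝ⟯) (p : M),
    bracket u (fsmul f v) p = f p • bracket u v p + dirDeriv f p (anchor p (u p)) • v p
  invariance : ∀ (u v w : Sec n F E) (p : M),
    dirDeriv (fun q => pairing q (v q) (w q)) p (anchor p (u p)) =
      pairing p (bracket u v p) (w p) + pairing p (v p) (bracket u w p)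
  bracket_symm : ∀ (u v w : Sec n F E) (p : M),
    pairing p (bracket u v p + bracket v u p) (w p) =
      dirDeriv (fun q => pairing q (u q) (v q)) p (anchor p (w p))

/-- Everywhere positive smooth half-densities on `M`. At each point a half-density is a function
of `n` tangent vectors which is multiplied by `|det A|^{1/2}` when the linear map `A` is applied to
the vectors; smoothness is smoothness of its values on the coordinate frames of charts. -/
structure HalfDensity (n : ℕ) (M : Type*) [TopologicalSpace M]
    [ChartedSpace (EuclideanSpace ℝ (Fin n)) M] [IsManifold (𝓡 n) ∞ M] where
  toFun : ∀ p : M, (Fin n → TangentSpace (𝓡 n) p) → ℝ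
  map_det : ∀ (p : M) (A : TangentSpace (𝓡 n) p →ₗ[ℝ] TangentSpace (𝓡 n) p)
    (v : Fin n → TangentSpace (𝓡 n) p),
    toFun p (fun i => A (v i)) = Real.sqrt |LinearMap.det A| * toFun p v
  pos : ∀ (p : M) (v : Fin n → TangentSpace (𝓡 n) p), LinearIndependent ℝ v → 0 < toFun p v
  smooth : ∀ p₀ : M, ContMDiffOn (𝓡 n) 𝓘(ℝ, ℝ) ∞
    (fun q => toFun q (fun i =>
      (trivializationAt (EuclideanSpace ℝ (Fin n)) (TangentSpace (𝓡 n)) p₀).symmL ℝ q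
        (EuclideanSpace.single i 1)))
    (chartAt (EuclideanSpace ℝ (Fin n)) p₀).source

namespace HalfDensity

variable {n : ℕ} {M : Type*} [TopologicalSpace M] [ChartedSpace (EuclideanSpace ℝ (Fin n)) M]
  [IsManifold (𝓡 n) ∞ M]

/-- The coefficient of `σ` at `q` in the chart at `p₀`: its value on the coordinate frame. -/
def coeff (σ : HalfDensity n M) (p₀ q : M) : ℝ :=
  σ.toFun q (fun i =>
    (trivializationAt (EuclideanSpace ℝ (Fin n)) (TangentSpace (𝓡 n)) p₀).symmL ℝ q
      (EuclideanSpace.single i 1))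

/-- The components of a vector field in the chart at `p₀`, as a function of the coordinates. -/
def vecInChart (X : ∀ p : M, TangentSpace (𝓡 n) p) (p₀ : M) (y : EuclideanSpace ℝ (Fin n)) :
    EuclideanSpace ℝ (Fin n) :=
  (trivializationAt (EuclideanSpace ℝ (Fin n)) (TangentSpace (𝓡 n)) p₀).continuousLinearMapAt ℝ
    ((extChartAt (𝓡 n) p₀).symm y) (X ((extChartAt (𝓡 n) p₀).symm y))

/-- The Lie derivative `L_X σ` at `p`, as a coefficient in the chart at `p`:
`X^i ∂_i s + ½ (∂_i X^i) s`, where `s` is the coefficient of `σ`. -/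
def lieCoeff (σ : HalfDensity n M) (X : ∀ p : M, TangentSpace (𝓡 n) p) (p : M) : ℝ :=
  fderiv ℝ (fun y => σ.coeff p ((extChartAt (𝓡 n) p).symm y)) (extChartAt (𝓡 n) p p)
      (vecInChart X p (extChartAt (𝓡 n) p p)) +
    1 / 2 * LinearMap.trace ℝ _
      (fderiv ℝ (vecInChart X p) (extChartAt (𝓡 n) p p)).toLinearMap * σ.coeff p p

/-- The divergence `2 σ⁻¹ L_X σ` of a vector field `X`. -/
def vdiv (σ : HalfDensity n M) (X : ∀ p : M, TangentSpace (𝓡 n) p) (p : M) : ℝ :=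
  2 * σ.lieCoeff X p / σ.coeff p p

end HalfDensity

section Geometry

variable {n : ℕ} {M : Type*} [TopologicalSpace M] [ChartedSpace (EuclideanSpace ℝ (Fin n)) M]
  [IsManifold (𝓡 n) ∞ M]
  {F : Type*} [NormedAddCommGroup F] [NormedSpace ℝ F]
  {E : M → Type*} [TopologicalSpace (TotalSpace F E)]
  [∀ p, AddCommGroup (E p)] [∀ p, Module ℝ (E p)] [∀ p, TopologicalSpace (E p)]
  [FiberBundle F E] [VectorBundle ℝ F E]

/-- A generalized pseudometric: a smooth self-adjoint endomorphism `G` of `E` with `G² = 1`, whose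
eigenbundles `V₊` and `V₋` do not have rank one. -/
structure GenPseudometric (C : CourantAlgebroid n F E) where
  toFun : ∀ p, E p →ₗ[ℝ] E p
  smooth : ∀ u : Sec n F E, ContMDiff (𝓡 n) ((𝓡 n).prod 𝓘(ℝ, F)) ∞
    (fun p => (⟨p, toFun p (u p)⟩ : TotalSpace F E))
  selfAdjoint : ∀ (p : M) (e e' : E p),
    C.pairing p (toFun p e) e' = C.pairing p e (toFun p e')
  involutive : ∀ (p : M) (e : E p), toFun p (toFun p e) = e
  rank_pos : ∀ p, Module.finrank ℝ (LinearMap.ker (toFun p - LinearMap.id)) ≠ 1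
  rank_neg : ∀ p, Module.finrank ℝ (LinearMap.ker (toFun p + LinearMap.id)) ≠ 1

/-- The section `G u`. -/
def GenPseudometric.onSec {C : CourantAlgebroid n F E} (G : GenPseudometric C) (u : Sec n F E) :
    Sec n F E :=
  ⟨fun p => G.toFun p (u p), G.smooth u⟩

/-- A Courant algebroid connection, as a map `Γ(E) → Γ(E* ⊗ E)`: `toFun p e v` is `D_e v` for a
vector `e` in the fibre at `p` and a section `v`. -/
structure Connection (C : CourantAlgebroid n F E) where
  toFun : ∀ p, E p →ₗ[ℝ] Sec n F E →ₗ[ℝ] E p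
  smooth : ∀ u v : Sec n F E, ContMDiff (𝓡 n) ((𝓡 n).prod 𝓘(ℝ, F)) ∞
    (fun p => (⟨p, toFun p (u p) v⟩ : TotalSpace F E))
  leibniz : ∀ (p : M) (e : E p) (f : C^∞⟮𝓡 n, M; ℝ⟯) (v : Sec n F E),
    toFun p e (fsmul f v) = f p • toFun p e v + dirDeriv f p (C.anchor p e) • v p
  metric : ∀ (p : M) (e : E p) (v w : Sec n F E),
    dirDeriv (fun q => C.pairing q (v q) (w q)) p (C.anchor p e) =
      C.pairing p (toFun p e v) (w p) + C.pairing p (v p) (toFun p e w)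

namespace Connection

variable {C : CourantAlgebroid n F E} (D : Connection C)

/-- The section `D_u v`. -/
def cov (u v : Sec n F E) : Sec n F E :=
  ⟨fun p => D.toFun p (u p) v, D.smooth u v⟩

/-- The torsion `D_u v - D_v u - [u, v] + ⟨D u, v⟩`, paired with `w`. -/
def torsion (u v w : Sec n F E) (p : M) : ℝ :=
  C.pairing p (D.cov u v p - D.cov v u p - C.bracket u v p) (w p) +
    C.pairing p (D.cov w u p) (v p)

/-- The divergence `div_D u`, the trace of `e ↦ D_e u`. -/
def divergence (u : Sec n F E) (p : M) : ℝ :=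
  LinearMap.trace ℝ (E p) ((D.toFun p).flip u)

/-- The second covariant derivative `x^α y^β D_α D_β z = D_x D_y z - D_{D_x y} z`. -/
def second (x y z : Sec n F E) : Sec n F E :=
  D.cov x (D.cov y z) - D.cov (D.cov x y) z

/-- The commutator `x^α y^β [D_α, D_β] z`. -/
def commutator (x y z : Sec n F E) : Sec n F E :=
  D.second x y z - D.second y x z

end Connection

/-- The divergence `div_σ u = 2 σ⁻¹ L_{ρ(u)} σ` of a section `u` of `E`. -/
def divSigma (C : CourantAlgebroid n F E) (σ : HalfDensity n M) (u : ∀ p, E p) (p : M) : ℝ :=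
  σ.vdiv (fun q => C.anchor q (u q)) p

/-- `D ∈ LC(G, div_σ)`: `D` preserves `G`, has no torsion, and its divergence is `div_σ`. -/
structure IsLeviCivita (C : CourantAlgebroid n F E) (G : GenPseudometric C) (σ : HalfDensity n M)
    (D : Connection C) : Prop where
  compatible : ∀ u v : Sec n F E, D.cov u (G.onSec v) = G.onSec (D.cov u v)
  torsion_free : ∀ (u v w : Sec n F E) (p : M), D.torsion u v w p = 0
  divergence_eq : ∀ (u : Sec n F E) (p : M), D.divergence u p = divSigma C σ u p

variable [FiniteDimensional ℝ F]

/-- The basis `e^α` of the fibre that is dual, for the pairing, to the basis `e_α`. -/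
def coframe (C : CourantAlgebroid n F E) (p : M) :
    Module.Basis (Fin (Module.finrank ℝ F)) ℝ (E p) :=
  (C.pairing p).dualBasis (C.pairing_nondegenerate p) (frame F E p)

/-- The section `𝒟 f` with `⟨𝒟 f, e⟩ = ρ(e) f`. -/
def gradE (C : CourantAlgebroid n F E) (f : M → ℝ) (p : M) : E p :=
  ∑ α, dirDeriv f p (C.anchor p (frame F E p α)) • coframe C p α

/-- The Laplace operator on functions, `Δ_{G,σ} f = div_σ (G 𝒟 f)`. -/
def laplacian (C : CourantAlgebroid n F E) (G : GenPseudometric C) (σ : HalfDensity n M)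
    (f : M → ℝ) (p : M) : ℝ :=
  divSigma C σ (fun q => G.toFun q (gradE C f q)) p

namespace Connection

variable {C : CourantAlgebroid n F E} (D : Connection C)

/-- The Riemann tensor
`Rm(w,z,x,y) = ½ w^δ y^β (x^α [D_α,D_β] z_δ + z^α [D_α,D_δ] x_β - (D_α x_β)(D^α z_δ))`. -/
def riemann (w z x y : Sec n F E) (p : M) : ℝ :=
  1 / 2 * (C.pairing p (w p) (D.commutator x y z p) + C.pairing p (y p) (D.commutator z w x p) -
    ∑ α, C.pairing p (D.toFun p (frame F E p α) x) (y p) *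
      C.pairing p (D.toFun p (coframe C p α) z) (w p))

variable [ContMDiffVectorBundle ∞ F E (𝓡 n)] [SigmaCompactSpace M] [T2Space M]

/-- The Riemann tensor on vectors of the fibre at `p`. -/
def riemannAt (p : M) (w z x y : E p) : ℝ :=
  D.riemann (ext w) (ext z) (ext x) (ext y) p

/-- The full Ricci tensor as a bilinear form, `⟨v, fRc(u)⟩ = Rm(e^α, v, e_α, u)`. -/
def fullRicci (p : M) (u v : E p) : ℝ :=
  ∑ α, D.riemannAt p (coframe C p α) v (frame F E p α) u

/-- The Ricci tensor `Rc = fRc - G fRc G` as a bilinear form, `⟨v, Rc(u)⟩`. -/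
def ricci (G : GenPseudometric C) (p : M) (u v : E p) : ℝ :=
  D.fullRicci p u v - D.fullRicci p (G.toFun p u) (G.toFun p v)

/-- The scalar curvature, the trace of `G fRc`. -/
def scalar (G : GenPseudometric C) (p : M) : ℝ :=
  ∑ α, D.fullRicci p (frame F E p α) (G.toFun p (coframe C p α))

end Connection

variable [ContMDiffVectorBundle ∞ F E (𝓡 n)] [SigmaCompactSpace M] [T2Space M]

open Classical in
/-- The Ricci tensor `⟨v, Rc_{G,σ}(u)⟩`: that of any connection in `LC(G, div_σ)`. Such a connection
always exists, and the result does not depend on which one is taken. -/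
def ricci (C : CourantAlgebroid n F E) (G : GenPseudometric C) (σ : HalfDensity n M)
    (p : M) (u v : E p) : ℝ :=
  if h : ∃ D : Connection C, IsLeviCivita C G σ D then h.choose.ricci G p u v else 0

open Classical in
/-- The scalar curvature `R_{G,σ}`: that of any connection in `LC(G, div_σ)`. -/
def scalar (C : CourantAlgebroid n F E) (G : GenPseudometric C) (σ : HalfDensity n M)
    (p : M) : ℝ :=
  if h : ∃ D : Connection C, IsLeviCivita C G σ D then h.choose.scalar G p else 0

/-- The squared norm `|B|²_G = G^{αγ} G^{βδ} B_{αβ} B_{γδ}` of a bilinear form on the fibre at `p`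
for the fibrewise inner product `⟨G ·, ·⟩`. -/
def normSq (C : CourantAlgebroid n F E) (G : GenPseudometric C) (p : M) (B : E p → E p → ℝ) : ℝ :=
  ∑ α, ∑ β, B (frame F E p α) (frame F E p β) *
    B (G.toFun p (coframe C p α)) (G.toFun p (coframe C p β))

/-- A smooth solution `(G_t, σ_t)`, `t ∈ J`, of generalized Ricci flow
`∂_t G = -2 Rc_{G,σ}`, `∂_t σ = -½ R_{G,σ} σ`. Derivatives at an endpoint of `J` that belongs to
`J` are one-sided. -/
structure IsRicciFlow (C : CourantAlgebroid n F E) (J : Set ℝ) (G : ℝ → GenPseudometric C)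
    (σ : ℝ → HalfDensity n M) : Prop where
  smooth_G : ∀ u v : Sec n F E, ContMDiffOn (𝓘(ℝ, ℝ).prod (𝓡 n)) 𝓘(ℝ, ℝ) ∞
    (fun x : ℝ × M => C.pairing x.2 ((G x.1).toFun x.2 (u x.2)) (v x.2)) (J ×ˢ univ)
  smooth_σ : ∀ p₀ : M, ContMDiffOn (𝓘(ℝ, ℝ).prod (𝓡 n)) 𝓘(ℝ, ℝ) ∞
    (fun x : ℝ × M => (σ x.1).coeff p₀ x.2)
    (J ×ˢ (chartAt (EuclideanSpace ℝ (Fin n)) p₀).source)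
  flow_G : ∀ t ∈ J, ∀ (p : M) (u v : E p),
    HasDerivWithinAt (fun s => C.pairing p v ((G s).toFun p u))
      (-2 * ricci C (G t) (σ t) p u v) J t
  flow_σ : ∀ t ∈ J, ∀ (p : M) (v : Fin n → TangentSpace (𝓡 n) p),
    HasDerivWithinAt (fun s => (σ s).toFun p v)
      (-(1 / 2) * scalar C (G t) (σ t) p * (σ t).toFun p v) J t

end Geometry

end CourantFlow

end

open Bundle Set
open scoped Manifold ContDiff

/-! The evolution equation is a first variation of the scalar curvature at a fixed time `t`,
followed by the contracted Bianchi identity. Compactness gives finitely many global sections `e i`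
and duals `e' i` with `u = ∑ ⟨u, e' i⟩ e i`. They are usually not independent, yet contracting over
them behaves like contracting over a frame. All curvature computations can therefore be done over
the abstract algebra of `CourantModule`. Geometry enters through the divergence of a half-density
and through differentiation in time.

Fix `D ∈ LC(G_t, div_t)`. The explicit tensor `lcTensor` gives `K_s` with `D + K_s ∈ LC(G_s,
div_s)`, differentiable at `s = t` and zero there; it divides by `rank V_± - 1`, hence the condition
on ranks. Since the scalar curvature is the same for all Levi-Civita connections (`scal_unique`),
`R_s` is that of `D + K_s`, whatever connections were chosen at the other times. The expansion
`scal_add` is exact. Besides `⟨fRc, G_s⟩`, the double divergence of `G_s` and the trace `kappa` of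
`K_s`, it contains only products of two factors that vanish at `t`. The trace `lam` is the only
other way in which `K_s` enters linearly, and compatibility with `G_s` determines it (`lam_eq`). The
trace `kappa` is `2 dφ_s` with `φ_s = log (σ_s / σ_t)`. With `h = ∂_t G` this gives `R' = ⟨fRc, h⟩ -
div div h - 4 Δφ'`.

The same linear formula proves the Bianchi identity. The Lie derivative of `D` along a section `u`
is a variation of the same kind, with `h = L_u G` and trace `d(div u)`, so `ρ(u) R = ⟨fRc, L_u G⟩ -
div div L_u G - 2 Δ(div u)` (`anchor_scal_eq`). For `u ∈ V_+` the endomorphism `L_u G` is built from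
the derivatives of `u` along `V_-`. The formula `fRic_mixed` for the mixed part of `fRc` then
reduces the right side to `-2 (div Rc)(u)`. Exchanging `G` with `-G` covers `V_-`, and together
`ρ(Gu) R = -2 (div Rc)(u)` (`bianchi`). Two facts about the divergence are needed: it is a cocycle
for the bracket, and gradients are divergence free (`IsFlat`).

For `h = -2 Rc` and `φ' = -R/2` the Bianchi identity gives `div div h = ΔR`, so that `R' = -2 ⟨fRc,
Rc⟩ - ΔR + 2 ΔR`. Finally `-2 ⟨fRc, Rc⟩ = |Rc|²_G`, because `Rc` anticommutes with `G`
(`hasD_scal`). -/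

namespace CourantFlow

noncomputable section

/-! ### Linear forms and contractions over a module with dual generating families. -/

section Linear

variable {A Γ : Type*} [CommRing A] [AddCommGroup Γ] [Module A Γ]

/-- `A`-linearity of a scalar valued function on `Γ`. -/
structure IsLin (f : Γ → A) : Prop where
  add : ∀ x y, f (x + y) = f x + f y
  smul : ∀ (a : A) x, f (a • x) = a * f x

/-- `A`-bilinearity of a scalar valued function of two arguments. -/
structure IsBilin (B : Γ → Γ → A) : Prop where
  left : ∀ y, IsLin (fun x => B x y)
  right : ∀ x, IsLin (B x)

theorem IsLin.map_sum {f : Γ → A} (hf : IsLin f) {κ : Type*} (s : Finset κ) (g : κ → Γ) :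
    f (∑ k ∈ s, g k) = ∑ k ∈ s, f (g k) :=
  _root_.map_sum (AddMonoidHom.mk' f hf.add) g s

theorem IsLin.map_zero {f : Γ → A} (hf : IsLin f) : f 0 = 0 :=
  _root_.map_zero (AddMonoidHom.mk' f hf.add)

theorem IsLin.map_neg {f : Γ → A} (hf : IsLin f) (x : Γ) : f (-x) = - f x :=
  _root_.map_neg (AddMonoidHom.mk' f hf.add) x

theorem IsLin.map_sub {f : Γ → A} (hf : IsLin f) (x y : Γ) : f (x - y) = f x - f y :=
  _root_.map_sub (AddMonoidHom.mk' f hf.add) x y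

end Linear

/-- The algebraic counterpart of a Courant algebroid: a module `Γ` over a commutative real algebra
`A`, with a finite generating family `e` and a family `e'` dual to it for the pairing. -/
structure CourantModule (A Γ ι : Type*) [CommRing A] [Algebra ℝ A] [AddCommGroup Γ] [Module ℝ Γ]
    [Module A Γ] [IsScalarTower ℝ A Γ] [Fintype ι] where
  pair : Γ →ₗ[A] Γ →ₗ[A] A
  anchor : Γ →ₗ[A] Derivation ℝ A A
  bracket : Γ →ₗ[ℝ] Γ →ₗ[ℝ] Γ
  e : ι → Γ
  e' : ι → Γ
  pair_comm : ∀ u v, pair u v = pair v u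
  expand : ∀ u, ∑ i, pair u (e' i) • e i = u
  jacobi : ∀ u v w, bracket u (bracket v w) = bracket (bracket u v) w + bracket v (bracket u w)
  leibniz : ∀ u v (f : A), bracket u (f • v) = f • bracket u v + anchor u f • v
  invariance : ∀ u v w, anchor u (pair v w) = pair (bracket u v) w + pair v (bracket u w)
  bracket_symm : ∀ u v w, pair (bracket u v + bracket v u) w = anchor w (pair u v)
  anchor_bracket : ∀ u v (f : A),
    anchor (bracket u v) f = anchor u (anchor v f) - anchor v (anchor u f)

variable {A Γ ι : Type*} [CommRing A] [Algebra ℝ A] [AddCommGroup Γ] [Module ℝ Γ]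
    [Module A Γ] [IsScalarTower ℝ A Γ] [Fintype ι]

theorem IsLin.map_real_smul {f : Γ → A} (hf : IsLin f) (c : ℝ) (x : Γ) : f (c • x) = c • f x := by
  rw [← algebraMap_smul A c x, hf.smul, ← Algebra.smul_def]

namespace CourantModule

variable (Q : CourantModule A Γ ι)

theorem pair_ext {x y : Γ} (h : ∀ w, Q.pair x w = Q.pair y w) : x = y := by
  rw [← Q.expand x, ← Q.expand y]
  simp [h]

theorem pair_bilin : IsBilin (fun x y => Q.pair x y) :=
  ⟨fun _ => ⟨by simp, by simp⟩, fun _ => ⟨by simp, by simp⟩⟩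

theorem expand' (u : Γ) : ∑ i, Q.pair u (Q.e i) • Q.e' i = u := by
  refine Q.pair_ext fun w => ?_
  conv_rhs => rw [← Q.expand w]
  simp only [map_sum, map_smul, LinearMap.sum_apply, LinearMap.smul_apply, smul_eq_mul]
  refine Finset.sum_congr rfl fun i _ => ?_
  rw [Q.pair_comm w (Q.e' i)]; ring

theorem sum_pair_mul {f : Γ → A} (hf : IsLin f) (u : Γ) :
    ∑ i, Q.pair u (Q.e' i) * f (Q.e i) = f u := by
  conv_rhs => rw [← Q.expand u]
  rw [hf.map_sum]
  simp [hf.smul]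

theorem sum_pair_mul' {f : Γ → A} (hf : IsLin f) (u : Γ) :
    ∑ i, Q.pair u (Q.e i) * f (Q.e' i) = f u := by
  conv_rhs => rw [← Q.expand' u]
  rw [hf.map_sum]
  simp [hf.smul]

theorem sum_pair_mul_pair (u v : Γ) : ∑ i, Q.pair u (Q.e i) * Q.pair (Q.e' i) v = Q.pair u v :=
  Q.sum_pair_mul' (Q.pair_bilin.left v) u

/-- The contraction `B(e_i, e'_i)` of a bilinear form. -/
def tr (B : Γ → Γ → A) : A := ∑ i, B (Q.e i) (Q.e' i)

theorem tr_add (B B' : Γ → Γ → A) : Q.tr (fun x y => B x y + B' x y) = Q.tr B + Q.tr B' :=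
  Finset.sum_add_distrib

theorem tr_sub (B B' : Γ → Γ → A) : Q.tr (fun x y => B x y - B' x y) = Q.tr B - Q.tr B' :=
  Finset.sum_sub_distrib _ _

theorem tr_neg (B : Γ → Γ → A) : Q.tr (fun x y => - B x y) = - Q.tr B :=
  Finset.sum_neg_distrib _

theorem tr_smul (c : ℝ) (B : Γ → Γ → A) : Q.tr (fun x y => c • B x y) = c • Q.tr B :=
  Finset.smul_sum.symm

theorem tr_mul (c : A) (B : Γ → Γ → A) : Q.tr (fun x y => c * B x y) = c * Q.tr B :=
  (Finset.mul_sum _ _ _).symm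

theorem tr_zero : Q.tr (fun _ _ => 0) = 0 := by simp [tr]

theorem tr_congr {B B' : Γ → Γ → A} (h : ∀ x y, B x y = B' x y) : Q.tr B = Q.tr B' := by
  simp [tr, h]

theorem tr_comm (B : Γ → Γ → Γ → Γ → A) :
    Q.tr (fun x y => Q.tr (fun z w => B x y z w)) =
      Q.tr (fun z w => Q.tr (fun x y => B x y z w)) :=
  Finset.sum_comm

/-- Expanding the argument `e' i` on either side gives the same double sum, weighted by the
symmetric matrix `⟨e' i, e' j⟩`. No independence of the generators is needed. -/
theorem tr_swap {B : Γ → Γ → A} (hB : IsBilin B) : Q.tr (fun x y => B y x) = Q.tr B := by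
  have h1 : ∀ i, B (Q.e' i) (Q.e i) =
      ∑ j, Q.pair (Q.e' i) (Q.e' j) * B (Q.e j) (Q.e i) := fun i =>
    (Q.sum_pair_mul (hB.left _) _).symm
  have h2 : ∀ j, B (Q.e j) (Q.e' j) =
      ∑ i, Q.pair (Q.e' j) (Q.e' i) * B (Q.e j) (Q.e i) := fun j =>
    (Q.sum_pair_mul (hB.right _) _).symm
  simp only [tr, h1, h2]
  rw [Finset.sum_comm]
  refine Finset.sum_congr rfl fun i _ => Finset.sum_congr rfl fun j _ => ?_
  rw [Q.pair_comm]

/-- Moving an operator to its adjoint under a contraction. -/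
theorem tr_adjoint {B : Γ → Γ → A} (hB : IsBilin B) {S T : Γ → Γ}
    (h : ∀ x y, Q.pair (S x) y = Q.pair x (T y)) :
    Q.tr (fun x y => B (S x) y) = Q.tr (fun x y => B x (T y)) := by
  have h1 : ∀ i, B (S (Q.e i)) (Q.e' i) =
      ∑ j, Q.pair (S (Q.e i)) (Q.e' j) * B (Q.e j) (Q.e' i) := fun i =>
    (Q.sum_pair_mul (hB.left _) _).symm
  have h2 : ∀ j, B (Q.e j) (T (Q.e' j)) =
      ∑ i, Q.pair (T (Q.e' j)) (Q.e i) * B (Q.e j) (Q.e' i) := fun j =>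
    (Q.sum_pair_mul' (hB.right _) _).symm
  simp only [tr, h1, h2]
  rw [Finset.sum_comm]
  refine Finset.sum_congr rfl fun i _ => Finset.sum_congr rfl fun j _ => ?_
  rw [h, Q.pair_comm]

/-- Contraction with the pairing against a fixed element. -/
theorem tr_pair_mul {f : Γ → A} (hf : IsLin f) (u : Γ) :
    Q.tr (fun x y => Q.pair u x * f y) = f u := Q.sum_pair_mul' hf u

theorem tr_pair_mul' {f : Γ → A} (hf : IsLin f) (u : Γ) :
    Q.tr (fun x y => Q.pair u y * f x) = f u := Q.sum_pair_mul hf u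

/-- The dual frames are parallel for every metric derivation. -/
theorem tr_derivation {B : Γ → Γ → A} (hB : IsBilin B) {T : Γ → Γ} {δ : A → A}
    (hadd : ∀ x y, T (x + y) = T x + T y) (hsmul : ∀ (a : A) x, T (a • x) = a • T x + δ a • x)
    (hpair : ∀ x y, δ (Q.pair x y) = Q.pair (T x) y + Q.pair x (T y)) :
    Q.tr (fun x y => B (T x) y + B x (T y)) = 0 := by
  -- Differentiating the expansion `y = ∑ ⟨y, e' i⟩ e i` with `T` gives the expansion of `T y` plus
  -- this sum, which must therefore vanish.
  have key : ∀ y, ∑ i, (Q.pair y (T (Q.e' i)) • Q.e i + Q.pair y (Q.e' i) • T (Q.e i)) = 0 := by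
    intro y
    have h1 : T y = ∑ i, (Q.pair y (Q.e' i) • T (Q.e i) +
        (Q.pair (T y) (Q.e' i) + Q.pair y (T (Q.e' i))) • Q.e i) := by
      conv_lhs => rw [← Q.expand y]
      have : T (∑ i, Q.pair y (Q.e' i) • Q.e i) = ∑ i, T (Q.pair y (Q.e' i) • Q.e i) :=
        map_sum (AddMonoidHom.mk' T hadd) _ _
      rw [this]
      refine Finset.sum_congr rfl fun i _ => ?_
      rw [hsmul, hpair]
    have h2 := Q.expand (T y)
    simp only [add_smul, Finset.sum_add_distrib] at h1 ⊢
    rw [h2] at h1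
    rw [add_comm] at h1
    have h3 := h1
    rw [add_assoc, left_eq_add] at h3
    exact h3
  have h1 : ∀ i, B (T (Q.e i)) (Q.e' i) + B (Q.e i) (T (Q.e' i)) =
      ∑ j, B (Q.pair (Q.e j) (T (Q.e' i)) • Q.e i + Q.pair (Q.e j) (Q.e' i) • T (Q.e i))
        (Q.e' j) := by
    intro i
    rw [← Q.sum_pair_mul' (hB.right (T (Q.e i))) (Q.e' i),
      ← Q.sum_pair_mul' (hB.right (Q.e i)) (T (Q.e' i)), ← Finset.sum_add_distrib]
    refine Finset.sum_congr rfl fun j _ => ?_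
    rw [(hB.left _).add, (hB.left _).smul, (hB.left _).smul, Q.pair_comm (Q.e j),
      Q.pair_comm (Q.e j)]
    ring
  simp only [tr, h1]
  rw [Finset.sum_comm]
  refine Finset.sum_eq_zero fun j _ => ?_
  rw [← (hB.left (Q.e' j)).map_sum, key, (hB.left _).map_zero]

/-- A metric connection on `Γ`. -/
structure Conn where
  cov : Γ →ₗ[A] Γ →ₗ[ℝ] Γ
  leibniz : ∀ u v (f : A), cov u (f • v) = f • cov u v + Q.anchor u f • v
  metric : ∀ u v w, Q.anchor u (Q.pair v w) = Q.pair (cov u v) w + Q.pair v (cov u w)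

/-- The torsion of a connection. -/
def torsion (D : Q.Conn) (u v w : Γ) : A :=
  Q.pair (D.cov u v - D.cov v u - Q.bracket u v) w + Q.pair (D.cov w u) v

/-- The divergence of a connection. -/
def div (D : Q.Conn) (u : Γ) : A := Q.tr (fun x y => Q.pair (D.cov x u) y)

/-- The covariant derivative of a covector. -/
def dcov (D : Q.Conn) (f : Γ → A) (x y : Γ) : A := Q.anchor x (f y) - f (D.cov x y)

variable {Q} (D : Q.Conn)

/-! ### Curvature of a torsion-free metric connection. -/

namespace Conn

/-- The second covariant derivative. -/
def second (x y z : Γ) : Γ := D.cov x (D.cov y z) - D.cov (D.cov x y) z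

/-- The commutator of second covariant derivatives. -/
def comm (x y z : Γ) : Γ := D.second x y z - D.second y x z

/-- The Riemann tensor. -/
def riem (w z x y : Γ) : A :=
  (1 / 2 : ℝ) • (Q.pair w (D.comm x y z) + Q.pair y (D.comm z w x) -
    Q.tr (fun a b => Q.pair (D.cov a x) y * Q.pair (D.cov b z) w))

/-- The full Ricci tensor. -/
def fRic (u v : Γ) : A := Q.tr (fun a b => D.riem b v a u)

/-- The Ricci tensor of a pseudometric. -/
def ric (G : Γ →ₗ[A] Γ) (u v : Γ) : A := D.fRic u v - D.fRic (G u) (G v)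

/-- The scalar curvature of a pseudometric. -/
def scal (G : Γ →ₗ[A] Γ) : A := Q.tr (fun x y => D.fRic x (G y))

theorem tr_cov {B : Γ → Γ → A} (hB : IsBilin B) (u : Γ) :
    Q.tr (fun x y => B (D.cov u x) y + B x (D.cov u y)) = 0 :=
  Q.tr_derivation hB (T := D.cov u) (δ := Q.anchor u) (by simp)
    (fun a x => D.leibniz u x a) (fun x y => D.metric u x y)

theorem dcov_bilin {f : Γ → A} (hf : IsLin f) : IsBilin (Q.dcov D f) := by
  refine ⟨fun y => ⟨fun x x' => ?_, fun a x => ?_⟩, fun x => ⟨fun y y' => ?_, fun a y => ?_⟩⟩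
  · simp [dcov, hf.add]; ring
  · simp [dcov, hf.smul]; ring
  · simp [dcov, hf.add]; ring
  · simp [dcov, D.leibniz, hf.add, hf.smul]; ring

theorem dcov_pair (u x y : Γ) : Q.dcov D (fun z => Q.pair u z) x y = Q.pair (D.cov x u) y := by
  simp [dcov, D.metric]

theorem div_smul (f : A) (u : Γ) : Q.div D (f • u) = f * Q.div D u + Q.anchor u f := by
  simp only [div, D.leibniz, map_add, map_smul, LinearMap.add_apply, LinearMap.smul_apply,
    smul_eq_mul, Q.tr_add, Q.tr_mul]
  congr 1
  rw [← Q.tr_pair_mul (f := fun x => Q.anchor x f) ⟨by simp, by simp⟩ u]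
  refine (Q.tr_swap (B := fun x y => Q.anchor y f * Q.pair u x)
    ⟨fun y => ⟨by intros; simp; ring, by intros; simp; ring⟩,
      fun y => ⟨by intros; simp; ring, by intros; simp; ring⟩⟩).trans ?_
  exact Q.tr_congr fun x y => mul_comm _ _

theorem div_add (u v : Γ) : Q.div D (u + v) = Q.div D u + Q.div D v := by
  simp [div, Q.tr_add]

theorem div_sum {κ : Type*} (s : Finset κ) (g : κ → Γ) :
    Q.div D (∑ k ∈ s, g k) = ∑ k ∈ s, Q.div D (g k) :=
  _root_.map_sum (AddMonoidHom.mk' (Q.div D) D.div_add) g s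

theorem div_sub (u v : Γ) : Q.div D (u - v) = Q.div D u - Q.div D v :=
  _root_.map_sub (AddMonoidHom.mk' (Q.div D) D.div_add) u v

theorem second_lin_left (y z w : Γ) : IsLin (fun x => Q.pair (D.second x y z) w) :=
  ⟨by intros; simp [second]; ring, by intros; simp [second]; ring⟩

theorem second_lin_mid (x z w : Γ) : IsLin (fun y => Q.pair (D.second x y z) w) :=
  ⟨by intros; simp [second]; ring, by intros; simp [second, D.leibniz]; ring⟩

theorem comm_lin_left (y z w : Γ) : IsLin (fun x => Q.pair (D.comm x y z) w) :=
  ⟨by intros; simp [comm, (D.second_lin_left _ _ _).add, (D.second_lin_mid _ _ _).add]; ring,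
   by intros; simp [comm, (D.second_lin_left _ _ _).smul, (D.second_lin_mid _ _ _).smul]; ring⟩

theorem comm_anti (x y z : Γ) : D.comm x y z = - D.comm y x z := by
  simp [comm]

theorem comm_lin_mid (x z w : Γ) : IsLin (fun y => Q.pair (D.comm x y z) w) := by
  have h := D.comm_lin_left x z w
  constructor
  · intro y y'; have := h.add y y'
    rw [D.comm_anti x, D.comm_anti x, D.comm_anti x]; simp_all; ring
  · intro a y; have := h.smul a y
    rw [D.comm_anti x, D.comm_anti x]; simp_all

/-- Vanishing of the torsion. -/
def TorsionFree : Prop := ∀ u v w, Q.torsion D u v w = 0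

variable {D}

theorem TorsionFree.pair_bracket (hD : D.TorsionFree) (u v w : Γ) :
    Q.pair (Q.bracket u v) w =
      Q.pair (D.cov u v) w - Q.pair (D.cov v u) w + Q.pair (D.cov w u) v := by
  have := hD u v w
  simp only [torsion, map_sub, LinearMap.sub_apply] at this
  linear_combination -this

/-- Vanishing torsion does not make `[x, y]` equal to `D_x y - D_y x`: the difference pairs with `a`
to `⟨D_a x, y⟩`. Second covariant derivatives of functions therefore fail to commute by a
first-order term, and this is the source of the trace in `riem`. -/
theorem TorsionFree.comm_anchor (hD : D.TorsionFree) (x y : Γ) (f : A) :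
    Q.anchor x (Q.anchor y f) - Q.anchor y (Q.anchor x f)
      - Q.anchor (D.cov x y) f + Q.anchor (D.cov y x) f
      = Q.tr (fun a b => Q.pair (D.cov a x) y * Q.anchor b f) := by
  rw [← Q.anchor_bracket]
  have h1 := Q.tr_pair_mul (f := fun x => Q.anchor x f) ⟨by simp, by simp⟩
    (Q.bracket x y - D.cov x y + D.cov y x)
  have h2 : ∀ a, Q.pair (Q.bracket x y - D.cov x y + D.cov y x) a = Q.pair (D.cov a x) y := by
    intro a
    simp [hD.pair_bracket]; ring
  simp only [h2] at h1
  rw [h1]; simp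

theorem TorsionFree.comm_metric (hD : D.TorsionFree) (x y z w : Γ) :
    Q.pair (D.comm x y z) w + Q.pair z (D.comm x y w) =
      Q.tr (fun a b => Q.pair (D.cov a x) y * Q.anchor b (Q.pair z w)) := by
  rw [← hD.comm_anchor]
  simp only [comm, second, D.metric, map_add, map_sub, LinearMap.sub_apply]
  ring

/-- By `comm_metric` the commutator fails to be skew by a derivative of `⟨z, w⟩`. The metric
property splits that derivative into two traces, and `riem w z` and `riem z w` each subtract one of
them. -/
theorem TorsionFree.riem_antisymm_left (hD : D.TorsionFree) (w z x y : Γ) :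
    D.riem w z x y = - D.riem z w x y := by
  rw [eq_neg_iff_add_eq_zero]
  have h1 := hD.comm_metric x y z w
  simp only [riem, ← smul_add]
  rw [D.comm_anti w z x]
  have h2 : Q.tr (fun a b => Q.pair (D.cov a x) y * Q.anchor b (Q.pair z w)) =
      Q.tr (fun a b => Q.pair (D.cov a x) y * Q.pair (D.cov b z) w) +
      Q.tr (fun a b => Q.pair (D.cov a x) y * Q.pair (D.cov b w) z) := by
    rw [← Q.tr_add]
    refine Q.tr_congr fun a b => ?_
    rw [D.metric, Q.pair_comm z]; ring
  rw [h2] at h1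
  rw [Q.pair_comm w]
  simp only [map_neg]
  have : ∀ t : A, t = 0 → (1 / 2 : ℝ) • t = 0 := by rintro t rfl; simp
  apply this
  linear_combination h1

variable (D)

theorem riem_tr_bilin (x z y w : Γ) :
    IsBilin (fun a b => Q.pair (D.cov a x) y * Q.pair (D.cov b z) w) :=
  ⟨fun y => ⟨by intros; simp; ring, by intros; simp; ring⟩,
      fun y => ⟨by intros; simp; ring, by intros; simp; ring⟩⟩

theorem riem_pair_symm (w z x y : Γ) : D.riem w z x y = D.riem y x z w := by
  simp only [riem]
  rw [← Q.tr_swap (D.riem_tr_bilin x z y w)]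
  congr 1
  rw [add_comm]
  congr 1
  exact Q.tr_congr fun a b => mul_comm _ _

/-- The argument `w` occurs only in slots where `comm` is tensorial. Its last slot is not tensorial.
-/
theorem riem_lin_fst (z x y : Γ) : IsLin (fun w => D.riem w z x y) := by
  constructor
  · intro w w'
    have h := (D.comm_lin_mid z x y).add w w'
    simp only [riem, Q.pair_comm y, map_add, LinearMap.add_apply, mul_add, Q.tr_add] at h ⊢
    rw [h, ← smul_add]; congr 1; ring
  · intro a w
    have h := (D.comm_lin_mid z x y).smul a w
    simp only [riem, Q.pair_comm y, map_smul, LinearMap.smul_apply, smul_eq_mul, mul_left_comm _ a,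
      Q.tr_mul] at h ⊢
    rw [h, mul_smul_comm]; congr 1; ring

theorem riem_lin_fth (w z x : Γ) : IsLin (fun y => D.riem w z x y) := by
  have h := D.riem_lin_fst x z w
  simpa only [D.riem_pair_symm _ x z w] using h

variable {D}

/-- Linearity in `z` is hidden in the definition, where `z` is differentiated twice; antisymmetry
transports it from the first slot. -/
theorem TorsionFree.riem_lin_snd (hD : D.TorsionFree) (w x y : Γ) :
    IsLin (fun z => D.riem w z x y) := by
  have h := D.riem_lin_fst w x y
  constructor
  · intro z z'; have := h.add z z'
    rw [hD.riem_antisymm_left, this, hD.riem_antisymm_left w z, hD.riem_antisymm_left w z']; ring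
  · intro a z; have := h.smul a z
    rw [hD.riem_antisymm_left, this, hD.riem_antisymm_left w z]; ring

theorem TorsionFree.riem_lin_trd (hD : D.TorsionFree) (w z y : Γ) :
    IsLin (fun x => D.riem w z x y) := by
  have h := hD.riem_lin_snd y z w
  simpa only [D.riem_pair_symm y _ z w] using h

theorem TorsionFree.riem_antisymm_right (hD : D.TorsionFree) (w z x y : Γ) :
    D.riem w z x y = - D.riem w z y x := by
  rw [D.riem_pair_symm, hD.riem_antisymm_left, D.riem_pair_symm]

theorem TorsionFree.riem_swap (hD : D.TorsionFree) (w z x y : Γ) :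
    D.riem w z x y = D.riem x y w z := by
  rw [D.riem_pair_symm, hD.riem_antisymm_left, hD.riem_antisymm_right, neg_neg]

theorem TorsionFree.riem_bilin_fst_trd (hD : D.TorsionFree) (z y : Γ) :
    IsBilin (fun a b => D.riem b z a y) :=
  ⟨fun _ => hD.riem_lin_trd _ _ _, fun _ => D.riem_lin_fst _ _ _⟩

theorem TorsionFree.fRic_symm (hD : D.TorsionFree) (u v : Γ) : D.fRic u v = D.fRic v u := by
  unfold fRic
  rw [← Q.tr_swap (hD.riem_bilin_fst_trd u v)]
  exact Q.tr_congr fun a b => hD.riem_swap _ _ _ _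

variable (D) in
theorem fRic_lin_left (v : Γ) : IsLin (fun u => D.fRic u v) := by
  constructor
  · intro u u'
    simp only [fRic, (D.riem_lin_fth _ _ _).add, Q.tr_add]
  · intro a u
    simp only [fRic, (D.riem_lin_fth _ _ _).smul, Q.tr_mul]

theorem TorsionFree.fRic_bilin (hD : D.TorsionFree) : IsBilin D.fRic := by
  refine ⟨D.fRic_lin_left, fun u => ?_⟩
  have := D.fRic_lin_left u
  simpa only [hD.fRic_symm _ u] using this

theorem TorsionFree.ric_symm (hD : D.TorsionFree) (G : Γ →ₗ[A] Γ) (u v : Γ) :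
    D.ric G u v = D.ric G v u := by
  rw [ric, ric, hD.fRic_symm u, hD.fRic_symm (G u)]

theorem TorsionFree.ric_bilin (hD : D.TorsionFree) (G : Γ →ₗ[A] Γ) : IsBilin (D.ric G) := by
  have h := hD.fRic_bilin
  refine ⟨fun y => ⟨fun x x' => ?_, fun a x => ?_⟩, fun x => ⟨fun y y' => ?_, fun a y => ?_⟩⟩ <;>
  simp only [ric, map_add, map_smul, (h.left _).add, (h.right _).add, (h.left _).smul,
    (h.right _).smul] <;> ring

end Conn

end CourantModule

end

end CourantFlow

/-! ### Variation of the curvature when the connection changes by a tensor. -/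

namespace CourantFlow

noncomputable section

variable {A Γ ι : Type*} [CommRing A] [Algebra ℝ A] [AddCommGroup Γ] [Module ℝ Γ]
    [Module A Γ] [IsScalarTower ℝ A Γ] [Fintype ι]

namespace CourantModule

variable {Q : CourantModule A Γ ι}

/-- The conditions on the difference of two torsion-free metric connections. -/
structure IsVariation (Q : CourantModule A Γ ι) (K : Γ →ₗ[A] Γ →ₗ[A] Γ) : Prop where
  skew : ∀ x y z, Q.pair (K x y) z = - Q.pair (K x z) y
  cyclic : ∀ x y z, Q.pair (K x y) z + Q.pair (K y z) x + Q.pair (K z x) y = 0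

variable (Q) in
/-- The trace `K(e_i, v, e'_i)`. -/
def kappa (K : Γ →ₗ[A] Γ →ₗ[A] Γ) (v : Γ) : A := Q.tr (fun x y => Q.pair (K x v) y)

variable (Q) in
/-- The trace `K(e_i, G e'_i, z)`. -/
def lam (K : Γ →ₗ[A] Γ →ₗ[A] Γ) (G : Γ →ₗ[A] Γ) (z : Γ) : A :=
  Q.tr (fun x y => Q.pair (K x (G y)) z)

theorem kappa_lin (K : Γ →ₗ[A] Γ →ₗ[A] Γ) : IsLin (Q.kappa K) :=
  ⟨by simp [kappa, tr_add], by simp [kappa, tr_mul]⟩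

namespace Conn

variable (D : Q.Conn) (K : Γ →ₗ[A] Γ →ₗ[A] Γ)

/-- The covariant derivative of an endomorphism. -/
def dEnd (h : Γ →ₗ[A] Γ) (x y : Γ) : Γ := D.cov x (h y) - h (D.cov x y)

/-- The covariant derivative of the tensor `⟨K_y z, w⟩`. -/
def dK (x y z w : Γ) : A :=
  Q.anchor x (Q.pair (K y z) w) - Q.pair (K (D.cov x y) z) w - Q.pair (K y (D.cov x z)) w
    - Q.pair (K y z) (D.cov x w)

/-- The linearization of the second covariant derivative in the direction `K`. -/
def dSecond (x y z : Γ) : Γ :=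
  K x (D.cov y z) + D.cov x (K y z) - K (D.cov x y) z - D.cov (K x y) z

/-- The linearization of the Riemann tensor in the direction `K`. -/
def dRiem (w z x y : Γ) : A :=
  (1 / 2 : ℝ) • (Q.pair w (D.dSecond K x y z - D.dSecond K y x z) +
    Q.pair y (D.dSecond K z w x - D.dSecond K w z x) -
    Q.tr (fun a b => Q.pair (K a x) y * Q.pair (D.cov b z) w +
      Q.pair (D.cov a x) y * Q.pair (K b z) w))

theorem dEnd_add_left (h : Γ →ₗ[A] Γ) (x x' y : Γ) :
    D.dEnd h (x + x') y = D.dEnd h x y + D.dEnd h x' y := by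
  simp [dEnd]; abel

theorem dEnd_smul_left (h : Γ →ₗ[A] Γ) (a : A) (x y : Γ) :
    D.dEnd h (a • x) y = a • D.dEnd h x y := by
  simp [dEnd, smul_sub]

theorem dEnd_add_right (h : Γ →ₗ[A] Γ) (x y y' : Γ) :
    D.dEnd h x (y + y') = D.dEnd h x y + D.dEnd h x y' := by
  simp [dEnd]; abel

theorem dEnd_smul_right (h : Γ →ₗ[A] Γ) (a : A) (x y : Γ) :
    D.dEnd h x (a • y) = a • D.dEnd h x y := by
  simp [dEnd, D.leibniz, smul_sub]

theorem dK_lin₁ (y z w : Γ) : IsLin (fun x => D.dK K x y z w) :=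
  ⟨by intros; simp [dK]; ring, by intros; simp [dK]; ring⟩

theorem dK_lin₂ (x z w : Γ) : IsLin (fun y => D.dK K x y z w) :=
  ⟨by intros; simp [dK]; ring, by intros; simp [dK, D.leibniz]; ring⟩

theorem dK_lin₃ (x y w : Γ) : IsLin (fun z => D.dK K x y z w) :=
  ⟨by intros; simp [dK]; ring, by intros; simp [dK, D.leibniz]; ring⟩

theorem dK_lin₄ (x y z : Γ) : IsLin (fun w => D.dK K x y z w) :=
  ⟨by intros; simp [dK]; ring, by intros; simp [dK, D.leibniz]; ring⟩

variable {K}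

theorem dK_skew (hK : Q.IsVariation K) (x y z w : Γ) : D.dK K x y z w = - D.dK K x y w z := by
  simp only [dK]
  rw [hK.skew y z w, hK.skew (D.cov x y) z w, hK.skew y (D.cov x z) w, hK.skew y z (D.cov x w)]
  simp; ring

end Conn

variable {K : Γ →ₗ[A] Γ →ₗ[A] Γ}

/-- Cyclicity and skewness give `⟨K_a x, y⟩ = -⟨K_x y - K_y x, a⟩`, so the contraction evaluates `f`
on a vector. -/
theorem IsVariation.tr_mul (hK : Q.IsVariation K) (x y : Γ) {f : Γ → A} (hf : IsLin f) :
    Q.tr (fun a b => Q.pair (K a x) y * f b) = - f (K x y - K y x) := by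
  rw [← hf.map_neg, ← Q.tr_pair_mul hf]
  refine Q.tr_congr fun a b => ?_
  congr 1
  have h1 := hK.cyclic x y a
  have h2 := hK.skew y a x
  simp only [map_neg, map_sub, LinearMap.neg_apply, LinearMap.sub_apply]
  linear_combination h1 - h2

/-- By `IsVariation.tr_mul` the two linearized traces absorb the terms `D_{K_x y - K_y x} z` and
`D_{K_z w - K_w z} x` of the commutators. Only derivatives of `K` remain. -/
theorem dRiem_eq (D : Q.Conn) (hK : Q.IsVariation K) (w z x y : Γ) :
    D.dRiem K w z x y = (1 / 2 : ℝ) • (D.dK K x y z w - D.dK K y x z w + D.dK K z w x y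
      - D.dK K w z x y) := by
  unfold Conn.dRiem
  congr 1
  rw [Q.tr_add]
  have h1 := hK.tr_mul x y (f := fun b => Q.pair (D.cov b z) w) ⟨by simp, by simp⟩
  have h2 := hK.tr_mul z w (f := fun b => Q.pair (D.cov b x) y) ⟨by simp, by simp⟩
  have h3 : Q.tr (fun a b => Q.pair (D.cov a x) y * Q.pair (K b z) w) =
      Q.tr (fun a b => Q.pair (K a z) w * Q.pair (D.cov b x) y) :=
    Q.tr_swap (B := fun a b => Q.pair (K a z) w * Q.pair (D.cov b x) y)
      ⟨fun y => ⟨by intros; simp; ring, by intros; simp; ring⟩,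
      fun y => ⟨by intros; simp; ring, by intros; simp; ring⟩⟩ ▸
      Q.tr_congr fun a b => mul_comm _ _
  rw [h3, h1, h2]
  simp only [Conn.dSecond, Conn.dK, D.metric, Q.pair_comm w, Q.pair_comm y, map_sub, map_add,
    LinearMap.sub_apply, LinearMap.add_apply]
  ring

namespace Conn

/-- The connection `D + K`. -/
def add (D : Q.Conn) (hK : Q.IsVariation K) : Q.Conn where
  cov := LinearMap.mk₂' A ℝ (fun x y => D.cov x y + K x y) (by intros; simp; abel)
    (by intros; simp) (by intros; simp; abel)
    (by intro c x y; rw [← algebraMap_smul A c y]; simp [algebraMap_smul])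
  leibniz := by intros; simp [D.leibniz]; abel
  metric := by
    intro u v w
    have := hK.skew u v w
    simp only [LinearMap.mk₂'_apply, D.metric, map_add, LinearMap.add_apply]
    rw [Q.pair_comm v (K u w)]
    linear_combination -this

@[simp] theorem add_cov (D : Q.Conn) (hK : Q.IsVariation K) (x y : Γ) :
    (D.add hK).cov x y = D.cov x y + K x y := rfl

theorem TorsionFree.add {D : Q.Conn} (hD : D.TorsionFree) (hK : Q.IsVariation K) :
    (D.add hK).TorsionFree := by
  intro u v w
  have h := hD u v w
  have h1 := hK.cyclic u v w
  have h2 := hK.skew v w u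
  simp only [torsion, add_cov, map_sub, map_add, LinearMap.sub_apply, LinearMap.add_apply] at h ⊢
  linear_combination h + h1 - h2

theorem div_add_var (D : Q.Conn) (hK : Q.IsVariation K) (u : Γ) :
    Q.div (D.add hK) u = Q.div D u + Q.kappa K u := by
  simp [div, kappa, Q.tr_add]

variable (Q) in
/-- The quadratic part of the variation of twice the Riemann tensor. -/
def quad (K : Γ →ₗ[A] Γ →ₗ[A] Γ) (w z x y : Γ) : A :=
  Q.pair w (K x (K y z) - K y (K x z)) + Q.pair y (K z (K w x) - K w (K z x)) +
    Q.tr (fun a b => Q.pair (K a x) y * Q.pair (K b z) w)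

/-- The Riemann tensor is quadratic in the connection, so the expansion is exact. The terms `K_{K_x
y - K_y x}` of the two commutators give the trace twice with a plus sign and the explicit trace in
`riem` gives it once with a minus sign, which leaves it once with a plus sign in `quad`. -/
theorem riem_add (D : Q.Conn) (hK : Q.IsVariation K) (w z x y : Γ) :
    (D.add hK).riem w z x y = D.riem w z x y + D.dRiem K w z x y +
      (1 / 2 : ℝ) • quad Q K w z x y := by
  unfold riem dRiem quad
  rw [← smul_add, ← smul_add]
  congr 1
  have h1 := hK.tr_mul x y (f := fun b => Q.pair (K b z) w) ⟨by simp, by simp⟩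
  have h2 := hK.tr_mul z w (f := fun b => Q.pair (K b x) y) ⟨by simp, by simp⟩
  have h3 : Q.tr (fun a b => Q.pair (K a x) y * Q.pair (K b z) w) =
      Q.tr (fun a b => Q.pair (K a z) w * Q.pair (K b x) y) :=
    Q.tr_swap (B := fun a b => Q.pair (K a z) w * Q.pair (K b x) y)
      ⟨fun y => ⟨by intros; simp; ring, by intros; simp; ring⟩,
      fun y => ⟨by intros; simp; ring, by intros; simp; ring⟩⟩ ▸
      Q.tr_congr fun a b => mul_comm _ _
  simp only [add_cov, comm, second, dSecond, map_add, map_sub, LinearMap.add_apply,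
    LinearMap.sub_apply, add_mul, mul_add, Q.tr_add, Q.pair_comm w, Q.pair_comm y] at h1 h2 h3 ⊢
  linear_combination - h1 - h2 - h3

variable (D : Q.Conn)

/-- Contraction commutes with `D`; since `G` need not be parallel, its derivative is the defect. -/
theorem tr_dK_lam (G : Γ →ₗ[A] Γ) (a b : Γ) :
    Q.tr (fun x y => D.dK K a x (G y) b) =
      Q.dcov D (Q.lam K G) a b - Q.tr (fun x y => Q.pair (K x (D.dEnd G a y)) b) := by
  have h := D.tr_cov (B := fun x y => Q.pair (K x (G y)) b)
    ⟨fun _ => ⟨by simp, by simp⟩, fun _ => ⟨by simp, by simp⟩⟩ a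
  rw [Q.tr_add] at h
  simp only [dK, dcov, lam, dEnd, map_sub, LinearMap.sub_apply, Q.tr_sub]
  rw [show Q.tr (fun x y => Q.anchor a (Q.pair (K x (G y)) b)) =
    Q.anchor a (Q.tr (fun x y => Q.pair (K x (G y)) b)) by simp [tr]]
  linear_combination -h

theorem tr_dK_kappa (x v : Γ) :
    Q.tr (fun a b => D.dK K x a v b) = Q.dcov D (Q.kappa K) x v := by
  have h := D.tr_cov (B := fun a b => Q.pair (K a v) b)
    ⟨fun _ => ⟨by simp, by simp⟩, fun _ => ⟨by simp, by simp⟩⟩ x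
  rw [Q.tr_add] at h
  simp only [dK, dcov, kappa, Q.tr_sub]
  rw [show Q.tr (fun a b => Q.anchor x (Q.pair (K a v) b)) =
    Q.anchor x (Q.tr (fun a b => Q.pair (K a v) b)) by simp [tr]]
  linear_combination -h

/-- The contraction of the linearized Riemann tensor that enters the scalar curvature. -/
theorem tr_dRiem (hK : Q.IsVariation K) {G : Γ →ₗ[A] Γ}
    (hG : ∀ x y, Q.pair (G x) y = Q.pair x (G y)) :
    Q.tr (fun x y => Q.tr (fun a b => D.dRiem K b (G y) a x)) =
      Q.tr (Q.dcov D (Q.lam K G))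
        - Q.tr (fun a b => Q.tr (fun x y => Q.pair (K x (D.dEnd G a y)) b))
        - Q.tr (fun x y => Q.dcov D (Q.kappa K) x (G y)) := by
  -- After contraction the four terms agree in pairs, by skewness of `K` and self-adjointness of
  -- `G`; this cancels the factor `1/2`.
  simp only [dRiem_eq D hK, Q.tr_smul, Q.tr_add, Q.tr_sub]
  have e1 : Q.tr (fun x y => Q.tr (fun a b => D.dK K a x (G y) b)) =
      Q.tr (Q.dcov D (Q.lam K G))
        - Q.tr (fun a b => Q.tr (fun x y => Q.pair (K x (D.dEnd G a y)) b)) := by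
    rw [Q.tr_comm (fun x y a b => D.dK K a x (G y) b)]
    simp only [tr_dK_lam, Q.tr_sub]
  have hdk := D.dcov_bilin (kappa_lin (Q := Q) K)
  have e2 : Q.tr (fun x y => Q.tr (fun a b => D.dK K x a (G y) b)) =
      Q.tr (fun x y => Q.dcov D (Q.kappa K) x (G y)) := by
    simp only [tr_dK_kappa]
  have e3 : Q.tr (fun x y => Q.tr (fun a b => D.dK K (G y) b a x)) =
      - Q.tr (fun x y => Q.dcov D (Q.kappa K) x (G y)) := by
    have : ∀ x y, Q.tr (fun a b => D.dK K (G y) b a x) = - Q.dcov D (Q.kappa K) (G y) x := by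
      intro x y
      rw [← tr_dK_kappa, ← Q.tr_neg,
        Q.tr_swap (B := fun b a => D.dK K (G y) b a x)
          ⟨fun _ => D.dK_lin₂ _ _ _ _, fun _ => D.dK_lin₃ _ _ _ _⟩]
      exact Q.tr_congr fun a b => D.dK_skew hK _ _ _ _
    simp only [this, Q.tr_neg]
    rw [Q.tr_swap (B := fun x y => Q.dcov D (Q.kappa K) (G x) y)
      ⟨fun y => ⟨by simp [(hdk.left _).add], by simp [(hdk.left _).smul]⟩, fun y => hdk.right _⟩,
      Q.tr_adjoint hdk hG]
  have e4 : Q.tr (fun x y => Q.tr (fun a b => D.dK K b (G y) a x)) =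
      - Q.tr (fun x y => Q.tr (fun a b => D.dK K a x (G y) b)) := by
    rw [Q.tr_comm (fun x y a b => D.dK K b (G y) a x), Q.tr_comm (fun x y a b => D.dK K a x (G y) b)]
    have : ∀ a b, Q.tr (fun x y => D.dK K b (G y) a x) =
        - Q.tr (fun x y => D.dK K b x (G y) a) := by
      intro a b
      have hb : IsBilin (fun x y => D.dK K b x y a) :=
        ⟨fun _ => D.dK_lin₂ _ _ _ _, fun _ => D.dK_lin₃ _ _ _ _⟩
      rw [← Q.tr_adjoint hb hG, ← Q.tr_swap (B := fun x y => D.dK K b (G x) y a)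
        ⟨fun y => ⟨by simp [(hb.left _).add], by simp [(hb.left _).smul]⟩, fun y => hb.right _⟩,
        ← Q.tr_neg]
      exact Q.tr_congr fun x y => D.dK_skew hK _ _ _ _
    simp only [this, Q.tr_neg]
    rw [Q.tr_swap (B := fun a b => Q.tr (fun x y => D.dK K a x (G y) b))]
    refine ⟨fun y => ⟨fun x x' => ?_, fun c x => ?_⟩, fun x => ⟨fun y y' => ?_, fun c y => ?_⟩⟩
    · simp only [(D.dK_lin₁ K _ _ _).add, Q.tr_add]
    · simp only [(D.dK_lin₁ K _ _ _).smul, Q.tr_mul]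
    · simp only [(D.dK_lin₄ K _ _ _).add, Q.tr_add]
    · simp only [(D.dK_lin₄ K _ _ _).smul, Q.tr_mul]
  rw [e4, e3, e2, e1]
  have h2 : ∀ t : A, (1 / 2 : ℝ) • (t + t) = t := fun t => by
    rw [← two_smul ℝ t, smul_smul]; norm_num
  refine Eq.trans ?_ (h2 _)
  congr 1
  ring

/-- The divergence of an endomorphism, as a covector. -/
def omega (h : Γ →ₗ[A] Γ) (z : Γ) : A := Q.tr (fun x y => Q.pair (D.dEnd h x y) z)

/-- Contracting the compatibility relation expresses `lam` through the divergence of `h` and the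
trace of `K`. The linear part of the variation of the scalar curvature therefore sees `K` only
through prescribed data. The case `h = G` serves an actual change of connection, and `h = L_u G`
serves the Lie derivative. -/
theorem lam_eq (hK : Q.IsVariation K) {G h : Γ →ₗ[A] Γ}
    (hG : ∀ x y, Q.pair (G x) y = Q.pair x (G y))
    (hh : ∀ x y, D.dEnd h x y = G (K x y) - K x (G y)) (z : Γ) :
    Q.lam K G z = - D.omega h z - Q.kappa K (G z) := by
  simp only [omega, hh, map_sub, LinearMap.sub_apply, Q.tr_sub, lam, kappa, hG]
  simp only [hK.skew _ _ (G z), Q.tr_neg]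
  ring

theorem dcov_comp_end {f : Γ → A} (hf : IsLin f) {G : Γ →ₗ[A] Γ} (x y : Γ) :
    Q.dcov D (fun z => f (G z)) x y = Q.dcov D f x (G y) + f (D.dEnd G x y) := by
  simp [dcov, dEnd, hf.map_sub]

theorem tr_dcov_lam (hK : Q.IsVariation K) {G h : Γ →ₗ[A] Γ}
    (hG : ∀ x y, Q.pair (G x) y = Q.pair x (G y))
    (hh : ∀ x y, D.dEnd h x y = G (K x y) - K x (G y)) :
    Q.tr (Q.dcov D (Q.lam K G)) = - Q.tr (Q.dcov D (D.omega h))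
      - Q.tr (fun x y => Q.dcov D (Q.kappa K) x (G y))
      - Q.tr (fun x y => Q.kappa K (D.dEnd G x y)) := by
  have h1 : ∀ x y, Q.dcov D (Q.lam K G) x y = - Q.dcov D (D.omega h) x y
      - (Q.dcov D (Q.kappa K) x (G y) + Q.kappa K (D.dEnd G x y)) := by
    intro x y
    rw [← D.dcov_comp_end (kappa_lin K)]
    simp only [dcov, D.lam_eq hK hG hh, map_sub, map_neg]
    ring
  rw [Q.tr_congr h1]
  simp only [Q.tr_sub, Q.tr_neg, Q.tr_add]
  ring

/-- The scalar curvature of `D + K` for a pseudometric `G` preserved by `D + K`. -/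
theorem scal_add (hK : Q.IsVariation K) {G : Γ →ₗ[A] Γ}
    (hG : ∀ x y, Q.pair (G x) y = Q.pair x (G y))
    (hh : ∀ x y, D.dEnd G x y = G (K x y) - K x (G y)) :
    (D.add hK).scal G = Q.tr (fun x y => D.fRic x (G y))
      - Q.tr (Q.dcov D (D.omega G))
      - 2 * Q.tr (fun x y => Q.dcov D (Q.kappa K) x (G y))
      - Q.tr (fun x y => Q.kappa K (D.dEnd G x y))
      - Q.tr (fun a b => Q.tr (fun x y => Q.pair (K x (D.dEnd G a y)) b))
      + (1 / 2 : ℝ) • Q.tr (fun x y => Q.tr (fun a b => quad Q K b (G y) a x)) := by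
  simp only [scal, fRic, D.riem_add hK, Q.tr_add, Q.tr_smul, D.tr_dRiem hK hG,
    D.tr_dcov_lam hK hG hh]
  ring

end Conn

end CourantModule

end

end CourantFlow

/-! ### Independence of the scalar curvature of the chosen Levi-Civita connection. -/

namespace CourantFlow

noncomputable section

variable {A Γ ι : Type*} [CommRing A] [Algebra ℝ A] [AddCommGroup Γ] [Module ℝ Γ]
    [Module A Γ] [IsScalarTower ℝ A Γ] [Fintype ι]

namespace CourantModule

variable {Q : CourantModule A Γ ι} {K : Γ →ₗ[A] Γ →ₗ[A] Γ} {G : Γ →ₗ[A] Γ}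

theorem eq_of_two_mul_eq {s t : A} (h : 2 * s = 2 * t) : s = t := by
  have h1 : (2 : ℝ) • s = (2 : ℝ) • t := by
    rw [Algebra.smul_def, Algebra.smul_def, map_ofNat]; exact h
  simpa [smul_smul] using congrArg (fun x => (1 / 2 : ℝ) • x) h1

/-- The algebraic conditions on a pseudometric. -/
structure IsInvolution (Q : CourantModule A Γ ι) (G : Γ →ₗ[A] Γ) : Prop where
  selfAdjoint : ∀ x y, Q.pair (G x) y = Q.pair x (G y)
  involutive : ∀ x, G (G x) = x

/-- A variation that commutes with a pseudometric has no components of mixed type. -/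
theorem IsVariation.map_left (hK : Q.IsVariation K) (hG : Q.IsInvolution G)
    (hc : ∀ x y, K x (G y) = G (K x y)) (x y : Γ) : K (G x) y = G (K x y) := by
  have key : ∀ x y, K (G x) (G y) = K x y := by
    intro x y
    refine Q.pair_ext fun z => ?_
    -- Since `K` commutes with `G` in its second argument, these four cyclic identities share most
    -- of their terms. The combination `h2 + h4 - h3 - h1` is twice the desired difference.
    have h1 := hK.cyclic x y z
    have h2 := hK.cyclic (G x) (G y) z
    have h3 := hK.cyclic x (G y) (G z)
    have h4 := hK.cyclic (G x) y (G z)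
    simp only [hc, hG.selfAdjoint, hG.involutive] at h1 h2 h3 h4 ⊢
    apply eq_of_two_mul_eq
    linear_combination h2 + h4 - h3 - h1
  rw [← hc, ← key x (G y), hG.involutive]

theorem tr_lam_kappa (hK : Q.IsVariation K) (hG : Q.IsInvolution G)
    (hc : ∀ x y, K x (G y) = G (K x y)) (z : Γ) :
    Q.tr (fun x y => Q.pair (K x (G y)) z) = - Q.kappa K (G z) := by
  simp only [hc, hG.selfAdjoint, kappa, hK.skew _ _ (G z), Q.tr_neg]

/-- Two of the five contractions contain a trace of `K` and vanish. By `map_left`, which lets `G`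
pass to any slot, two others equal `-Y` and enter with a minus sign. The last is `-Z`, and the
cyclic identity gives `Z = 2 * Y`. -/
theorem tr_quad_eq_zero (hK : Q.IsVariation K) (hG : Q.IsInvolution G)
    (hc : ∀ x y, K x (G y) = G (K x y)) (hk : ∀ v, Q.kappa K v = 0) :
    Q.tr (fun x y => Q.tr (fun a b => Conn.quad Q K b (G y) a x)) = 0 := by
  have hl := hK.map_left hG hc
  have hs : ∀ x y z, Q.pair x (K y z) = - Q.pair (K y x) z := fun x y z => by
    rw [Q.pair_comm, hK.skew]
  set Y : A := Q.tr (fun c d => Q.tr (fun a b => Q.pair (K c b) (G (K a d)))) with hY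
  have hb : ∀ c d, IsBilin (fun a b => Q.pair (K c b) (G (K a d))) := fun c d =>
    ⟨fun _ => ⟨by intros; simp, by intros; simp⟩, fun _ => ⟨by intros; simp, by intros; simp⟩⟩
  have hb' : IsBilin (fun c d => Q.tr (fun a b => Q.pair (K c b) (G (K a d)))) :=
    ⟨fun _ => ⟨by intros; simp [Q.tr_add], by intros; simp [Q.tr_mul]⟩,
      fun _ => ⟨by intros; simp [Q.tr_add], by intros; simp [Q.tr_mul]⟩⟩
  have t1 : Q.tr (fun x y => Q.tr (fun a b => Q.pair b (K a (K x (G y))))) = 0 := by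
    rw [Q.tr_comm (fun x y a b => Q.pair b (K a (K x (G y))))]
    have h2 : ∀ a b, Q.tr (fun x y => Q.pair b (K a (K x (G y)))) = 0 := fun a b => by
      rw [Q.tr_congr fun x y => hs b a (K x (G y)), Q.tr_neg,
        Q.tr_congr fun x y => Q.pair_comm (K a b) (K x (G y)), tr_lam_kappa hK hG hc, hk]
      simp
    simp only [h2, Q.tr_zero]
  have t2 : Q.tr (fun x y => Q.tr (fun a b => Q.pair b (K x (K a (G y))))) = - Y := by
    rw [hY, ← Q.tr_neg]
    refine Q.tr_congr fun x y => ?_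
    rw [← Q.tr_neg]
    exact Q.tr_congr fun a b => by rw [hs, hc]
  have t3 : Q.tr (fun x y => Q.tr (fun a b => Q.pair x (K (G y) (K b a)))) = 0 := by
    have : ∀ v, Q.tr (fun a b => Q.pair v (K b a)) = 0 := fun v => by
      rw [← neg_eq_zero, ← Q.tr_neg, ← hk v, kappa,
        ← Q.tr_swap (B := fun x y => Q.pair (K x v) y)
          ⟨fun _ => ⟨by simp, by simp⟩, fun _ => ⟨by simp, by simp⟩⟩]
      exact Q.tr_congr fun a b => by rw [hs, neg_neg]
    have h2 : ∀ x y, Q.tr (fun a b => Q.pair x (K (G y) (K b a))) = 0 := fun x y => by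
      rw [Q.tr_congr fun a b => hs x (G y) (K b a), Q.tr_neg, this, neg_zero]
    simp only [h2, Q.tr_zero]
  have t4 : Q.tr (fun x y => Q.tr (fun a b => Q.pair x (K b (K (G y) a)))) = - Y := by
    rw [hY, ← Q.tr_swap hb', ← Q.tr_neg]
    refine Q.tr_congr fun x y => ?_
    rw [← Q.tr_swap (hb y x), ← Q.tr_neg]
    refine Q.tr_congr fun a b => ?_
    rw [hs, hl, Q.pair_comm, ← hG.selfAdjoint]
  set Z : A := Q.tr (fun c d => Q.tr (fun a b => Q.pair (K c a) (G (K d b)))) with hZ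
  have t5 : Q.tr (fun x y => Q.tr (fun a b => Q.tr (fun c d => Q.pair (K c a) x *
      Q.pair (K d (G y)) b))) = - Z := by
    rw [hZ, Q.tr_comm (fun x y a b => Q.tr (fun c d => Q.pair (K c a) x * Q.pair (K d (G y)) b)),
      Q.tr_comm (fun c d a b => Q.pair (K c a) (G (K d b))), ← Q.tr_neg]
    refine Q.tr_congr fun a b => ?_
    rw [Q.tr_comm (fun x y c d => Q.pair (K c a) x * Q.pair (K d (G y)) b), ← Q.tr_neg]
    refine Q.tr_congr fun c d => ?_
    rw [Q.tr_pair_mul (f := fun y => Q.pair (K d (G y)) b) ⟨by simp, by simp⟩, hK.skew,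
      ← hG.selfAdjoint, Q.pair_comm]
  have hcyc : ∀ c a z, Q.pair (K c a) z = Q.pair (K a c) z - Q.pair (K z c) a := fun c a z => by
    have h1 := hK.cyclic c a z
    have h2 := hK.skew a z c
    linear_combination h1 - h2
  have hZY : Z = 2 * Y := by
    have h1 : ∀ a b c d, Q.pair (K c a) (G (K d b)) = Q.pair (K a c) (G (K d b)) +
        Q.tr (fun z z' => - (Q.pair (K z c) a * Q.pair (K d b) (G z'))) := by
      intro a b c d
      rw [hcyc, Q.tr_neg, ← Q.tr_pair_mul (f := fun y => Q.pair (K y c) a) ⟨by simp, by simp⟩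
        (G (K d b)), ← sub_eq_add_neg]
      congr 1
      have := Q.tr_swap (B := fun x y => Q.pair (K x c) a * Q.pair (K d b) (G y))
        ⟨fun _ => ⟨by intros; simp; ring, by intros; simp; ring⟩,
          fun _ => ⟨by intros; simp; ring, by intros; simp; ring⟩⟩
      rw [← this]
      exact Q.tr_congr fun x y => by rw [hG.selfAdjoint]; ring
    have h2 : Q.tr (fun c d => Q.tr (fun a b => Q.pair (K a c) (G (K d b)))) = Y := by
      rw [hY, ← Q.tr_swap hb']
      refine Q.tr_congr fun c d => Q.tr_congr fun a b => ?_
      rw [Q.pair_comm, hG.selfAdjoint]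
    have h3 : Q.tr (fun c d => Q.tr (fun a b => Q.tr (fun z z' =>
        - (Q.pair (K z c) a * Q.pair (K d b) (G z'))))) = Y := by
      have h4 : ∀ c d z z', Q.tr (fun a b => - (Q.pair (K z c) a * Q.pair (K d b) (G z'))) =
          Q.pair (K z c) (G (K d z')) := by
        intro c d z z'
        rw [Q.tr_neg, Q.tr_pair_mul (f := fun b => Q.pair (K d b) (G z')) ⟨by simp, by simp⟩,
          hK.skew, neg_neg, hc, Q.pair_comm]
      rw [Q.tr_congr fun c d => Q.tr_comm (fun a b z z' =>
        - (Q.pair (K z c) a * Q.pair (K d b) (G z')))]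
      simp only [h4]
      rw [Q.tr_comm (fun c d z z' => Q.pair (K z c) (G (K d z'))), hY]
      exact Q.tr_congr fun z z' => (Q.tr_swap (hb z z'))
    rw [hZ, Q.tr_congr fun c d => Q.tr_congr fun a b => h1 a b c d]
    simp only [Q.tr_add]
    rw [h2, h3]; ring
  simp only [Conn.quad, map_sub, Q.tr_add, Q.tr_sub, t1, t2, t3, t4, t5, hZY]
  ring

/-- A connection preserving a pseudometric. -/
def Conn.Preserves (D : Q.Conn) (G : Γ →ₗ[A] Γ) : Prop := ∀ x y, D.cov x (G y) = G (D.cov x y)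

theorem Conn.Preserves.dEnd {D : Q.Conn} (h : D.Preserves G) (x y : Γ) : D.dEnd G x y = 0 := by
  simp [Conn.dEnd, h x y]

variable (D D' : Q.Conn)

/-- The difference of two connections. -/
def Conn.diff : Γ →ₗ[A] Γ →ₗ[A] Γ :=
  LinearMap.mk₂ A (fun x y => D'.cov x y - D.cov x y) (by intros; simp; abel)
    (by intros; simp [smul_sub]) (by intros; simp; abel)
    (by intros; simp [D.leibniz, D'.leibniz, smul_sub])

variable {D D'}

theorem Conn.TorsionFree.diff (hD : D.TorsionFree) (hD' : D'.TorsionFree) :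
    Q.IsVariation (D.diff D') := by
  have hsk : ∀ x y z, Q.pair (D.diff D' x y) z = - Q.pair (D.diff D' x z) y := by
    intro x y z
    have h1 := D.metric x y z
    have h2 := D'.metric x y z
    simp only [Conn.diff, LinearMap.mk₂_apply, map_sub, LinearMap.sub_apply]
    rw [Q.pair_comm (D'.cov x z), Q.pair_comm (D.cov x z)]
    linear_combination h1 - h2
  refine ⟨hsk, fun x y z => ?_⟩
  have h1 := hD x y z
  have h2 := hD' x y z
  rw [hsk y z x]
  simp only [torsion, Conn.diff, LinearMap.mk₂_apply, map_sub, LinearMap.sub_apply] at h1 h2 ⊢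
  linear_combination h2 - h1

theorem Conn.add_diff (hD : D.TorsionFree) (hD' : D'.TorsionFree) : D.add (hD.diff hD') = D' := by
  obtain ⟨c', _, _⟩ := D'
  simp only [Conn.add, Conn.mk.injEq]
  ext x y
  simp [Conn.diff]

/-- The scalar curvature does not depend on the choice of the connection. -/
theorem Conn.scal_unique (hD : D.TorsionFree) (hD' : D'.TorsionFree) (hG : Q.IsInvolution G)
    (h : D.Preserves G) (h' : D'.Preserves G) (hdiv : ∀ u, Q.div D u = Q.div D' u) :
    D'.scal G = D.scal G := by
  have hK := hD.diff hD'
  have hc : ∀ x y, D.diff D' x (G y) = G (D.diff D' x y) := fun x y => by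
    simp [Conn.diff, h x y, h' x y]
  have hk : ∀ v, Q.kappa (D.diff D') v = 0 := fun v => by
    have := D.div_add_var hK v
    rw [Conn.add_diff hD hD', ← hdiv] at this
    simpa using this
  -- Both connections preserve `G` and have the same divergence, so every term of the expansion
  -- vanishes except the scalar curvature of `D`.
  rw [← Conn.add_diff hD hD', D.scal_add hK hG.selfAdjoint (fun x y => by rw [h.dEnd, hc, sub_self]),
    tr_quad_eq_zero hK hG hc hk]
  have h0 : ∀ z, D.omega G z = 0 := fun z => by simp [Conn.omega, h.dEnd, Q.tr_zero]
  have h1 : Q.tr (Q.dcov D (D.omega G)) = 0 := by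
    rw [Q.tr_congr (B' := fun _ _ => 0) (fun x y => by simp [dcov, h0]), Q.tr_zero]
  simp [h.dEnd, h1, dcov, hk, Q.tr_zero, Conn.scal]

end CourantModule

end

end CourantFlow

/-! ### Lie derivatives and infinitesimal naturality of the scalar curvature. -/

namespace CourantFlow

noncomputable section

variable {A Γ ι : Type*} [CommRing A] [Algebra ℝ A] [AddCommGroup Γ] [Module ℝ Γ]
    [Module A Γ] [IsScalarTower ℝ A Γ] [Fintype ι]

namespace CourantModule

variable {Q : CourantModule A Γ ι} {G : Γ →ₗ[A] Γ}

theorem anchor_tr (u : Γ) (B : Γ → Γ → A) :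
    Q.anchor u (Q.tr B) = Q.tr (fun x y => Q.anchor u (B x y)) := by simp [tr]

theorem tr_bracket {B : Γ → Γ → A} (hB : IsBilin B) (u : Γ) :
    Q.tr (fun x y => B (Q.bracket u x) y + B x (Q.bracket u y)) = 0 :=
  Q.tr_derivation hB (T := Q.bracket u) (δ := Q.anchor u) (by simp)
    (fun a x => Q.leibniz u x a) (fun x y => Q.invariance u x y)

theorem anchor_anchor (u x : Γ) (f : A) :
    Q.anchor u (Q.anchor x f) = Q.anchor (Q.bracket u x) f + Q.anchor x (Q.anchor u f) := by
  rw [Q.anchor_bracket]; ring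

variable (Q) in
/-- The Lie derivative of an endomorphism. -/
def lieEnd (u : Γ) (G : Γ →ₗ[A] Γ) : Γ →ₗ[A] Γ where
  toFun x := Q.bracket u (G x) - G (Q.bracket u x)
  map_add' := by intros; simp; abel
  map_smul' := by intros; simp [Q.leibniz, smul_sub]

namespace Conn

variable (D : Q.Conn)

/-- The Lie derivative of a connection. -/
def lie (u : Γ) : Γ →ₗ[A] Γ →ₗ[A] Γ :=
  LinearMap.mk₂ A (fun x y => Q.bracket u (D.cov x y) - D.cov (Q.bracket u x) y
      - D.cov x (Q.bracket u y))
    (by intros; simp; abel)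
    (by intros; simp [Q.leibniz, smul_sub])
    (by intros; simp; abel)
    (by
      intro f x y
      simp only [D.leibniz, Q.leibniz, map_add, Q.anchor_anchor u x f, smul_sub, add_smul]
      abel)

theorem lie_apply (u x y : Γ) : D.lie u x y =
    Q.bracket u (D.cov x y) - D.cov (Q.bracket u x) y - D.cov x (Q.bracket u y) := rfl

variable {D}

/-- These are the Lie derivatives of the metric condition and of vanishing torsion. The first uses
that the anchor respects brackets, the second the Jacobi identity, and both the invariance of the
pairing. -/
theorem TorsionFree.lie (hD : D.TorsionFree) (u : Γ) : Q.IsVariation (D.lie u) := by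
  have hsk : ∀ x y z, Q.pair (D.lie u x y) z = - Q.pair (D.lie u x z) y := by
    intro x y z
    have h1 := Q.anchor_anchor u x (Q.pair y z)
    simp only [D.metric x, D.metric (Q.bracket u x), Q.invariance u, map_add] at h1
    simp only [lie_apply, map_sub, LinearMap.sub_apply]
    rw [Q.pair_comm (Q.bracket u (D.cov x z)), Q.pair_comm (D.cov x (Q.bracket u z)),
      Q.pair_comm (D.cov (Q.bracket u x) z)]
    linear_combination h1
  refine ⟨hsk, fun x y z => ?_⟩
  rw [hsk y z x]
  have h0 := congrArg (Q.anchor u) (hD.pair_bracket x y z)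
  have h1 := hD.pair_bracket (Q.bracket u x) y z
  have h2 := hD.pair_bracket x (Q.bracket u y) z
  have h3 := hD.pair_bracket x y (Q.bracket u z)
  simp only [Q.invariance u, map_add, map_sub, Q.jacobi u x y, LinearMap.add_apply] at h0
  simp only [lie_apply, map_sub, LinearMap.sub_apply]
  linear_combination h1 + h2 + h3 - h0

variable (D)

theorem bracket_second (u x y z : Γ) :
    Q.bracket u (D.second x y z) = D.second (Q.bracket u x) y z + D.second x (Q.bracket u y) z +
      D.second x y (Q.bracket u z) + D.dSecond (D.lie u) x y z := by
  simp only [second, dSecond, lie_apply, map_sub, LinearMap.sub_apply]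
  abel

theorem bracket_comm (u x y z : Γ) :
    Q.bracket u (D.comm x y z) = D.comm (Q.bracket u x) y z + D.comm x (Q.bracket u y) z +
      D.comm x y (Q.bracket u z) + (D.dSecond (D.lie u) x y z - D.dSecond (D.lie u) y x z) := by
  simp only [comm, map_sub, bracket_second]
  abel

theorem anchor_pair_cov (u a x y : Γ) :
    Q.anchor u (Q.pair (D.cov a x) y) = Q.pair (D.lie u a x) y + Q.pair (D.cov (Q.bracket u a) x) y
      + Q.pair (D.cov a (Q.bracket u x)) y + Q.pair (D.cov a x) (Q.bracket u y) := by
  simp only [Q.invariance, lie_apply, map_sub, LinearMap.sub_apply]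
  ring

/-- The Lie derivative of the Riemann tensor. -/
theorem anchor_riem (u w z x y : Γ) :
    Q.anchor u (D.riem w z x y) = D.riem (Q.bracket u w) z x y + D.riem w (Q.bracket u z) x y +
      D.riem w z (Q.bracket u x) y + D.riem w z x (Q.bracket u y) + D.dRiem (D.lie u) w z x y := by
  have h := Q.tr_bracket (D.riem_tr_bilin x z y w) u
  unfold riem dRiem
  rw [Derivation.map_smul]
  simp only [← smul_add]
  congr 1
  simp only [map_add, map_sub, anchor_tr, Q.invariance, bracket_comm]
  simp only [Derivation.leibniz, anchor_pair_cov, smul_eq_mul, mul_add, Q.tr_add] at h ⊢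
  rw [show Q.tr (fun a b => Q.pair (D.cov b z) w * Q.pair (D.lie u a x) y) =
    Q.tr (fun a b => Q.pair (D.lie u a x) y * Q.pair (D.cov b z) w) from
      Q.tr_congr fun _ _ => mul_comm _ _]
  rw [show Q.tr (fun a b => Q.pair (D.cov b z) w * Q.pair (D.cov (Q.bracket u a) x) y) =
    Q.tr (fun a b => Q.pair (D.cov (Q.bracket u a) x) y * Q.pair (D.cov b z) w) from
      Q.tr_congr fun _ _ => mul_comm _ _]
  rw [show Q.tr (fun a b => Q.pair (D.cov b z) w * Q.pair (D.cov a (Q.bracket u x)) y) =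
    Q.tr (fun a b => Q.pair (D.cov a (Q.bracket u x)) y * Q.pair (D.cov b z) w) from
      Q.tr_congr fun _ _ => mul_comm _ _]
  rw [show Q.tr (fun a b => Q.pair (D.cov b z) w * Q.pair (D.cov a x) (Q.bracket u y)) =
    Q.tr (fun a b => Q.pair (D.cov a x) (Q.bracket u y) * Q.pair (D.cov b z) w) from
      Q.tr_congr fun _ _ => mul_comm _ _]
  linear_combination -h

theorem anchor_fRic (hD : D.TorsionFree) (u x y : Γ) :
    Q.anchor u (D.fRic x y) = D.fRic (Q.bracket u x) y + D.fRic x (Q.bracket u y) +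
      Q.tr (fun a b => D.dRiem (D.lie u) b y a x) := by
  have h := Q.tr_bracket (hD.riem_bilin_fst_trd y x) u
  unfold fRic
  simp only [anchor_tr, anchor_riem, Q.tr_add] at h ⊢
  linear_combination h

theorem anchor_scal (hD : D.TorsionFree) (u : Γ) :
    Q.anchor u (D.scal G) = Q.tr (fun x y => D.fRic x (Q.lieEnd u G y)) +
      Q.tr (fun x y => Q.tr (fun a b => D.dRiem (D.lie u) b (G y) a x)) := by
  have hb := hD.fRic_bilin
  have h := Q.tr_bracket (B := fun x y => D.fRic x (G y))
    ⟨fun _ => hb.left _, fun _ => ⟨by simp [(hb.right _).add], by simp [(hb.right _).smul]⟩⟩ u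
  unfold scal
  simp only [anchor_tr, D.anchor_fRic hD, Q.tr_add] at h ⊢
  have h2 : Q.tr (fun x y => D.fRic x (Q.bracket u (G y))) =
      Q.tr (fun x y => D.fRic x (Q.lieEnd u G y)) +
      Q.tr (fun x y => D.fRic x (G (Q.bracket u y))) := by
    rw [← Q.tr_add]
    refine Q.tr_congr fun x y => ?_
    rw [← (hb.right x).add]
    simp [lieEnd]
  rw [h2]
  linear_combination h

/-- The divergence of `D` comes from a density: it is a cocycle, and gradients have no
divergence. -/
structure IsFlat (D : Q.Conn) : Prop where
  bracket : ∀ u v, Q.div D (Q.bracket u v) = Q.anchor u (Q.div D v) - Q.anchor v (Q.div D u)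
  grad : ∀ f : A, Q.tr (Q.dcov D (fun v => Q.anchor v f)) = 0

variable {D}

/-- The trace of `L_u D` is the Lie derivative of the divergence, because contractions are invariant
under the bracket. The cocycle identity then leaves only the derivative of `div u`. -/
theorem IsFlat.kappa_lie (hF : D.IsFlat) (u v : Γ) :
    Q.kappa (D.lie u) v = Q.anchor v (Q.div D u) := by
  have h1 : Q.kappa (D.lie u) v = Q.anchor u (Q.div D v) - Q.div D (Q.bracket u v) := by
    have h := Q.tr_bracket (B := fun x y => Q.pair (D.cov x v) y)
      ⟨fun _ => ⟨by simp, by simp⟩, fun _ => ⟨by simp, by simp⟩⟩ u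
    simp only [kappa, div, anchor_tr, anchor_pair_cov, Q.tr_add] at h ⊢
    linear_combination -h
  rw [h1, hF.bracket]; ring

/-- The Laplace operator. -/
def lap (D : Q.Conn) (G : Γ →ₗ[A] Γ) (f : A) : A :=
  Q.tr (fun x y => Q.dcov D (fun v => Q.anchor v f) x (G y))

/-- This is the Lie derivative of `D G = 0`, in the form required by `tr_dcov_lam` with `h = L_u G`.
-/
theorem dEnd_lieEnd (h : D.Preserves G) (u x y : Γ) :
    D.dEnd (Q.lieEnd u G) x y = G (D.lie u x y) - D.lie u x (G y) := by
  simp only [dEnd, lieEnd, lie_apply, LinearMap.coe_mk, AddHom.coe_mk, map_sub, h _ _]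
  abel

/-- Infinitesimal naturality of the scalar curvature. -/
theorem anchor_scal_eq (hD : D.TorsionFree) (hF : D.IsFlat) (hG : Q.IsInvolution G)
    (h : D.Preserves G) (u : Γ) :
    Q.anchor u (D.scal G) = Q.tr (fun x y => D.fRic x (Q.lieEnd u G y))
      - Q.tr (Q.dcov D (D.omega (Q.lieEnd u G))) - 2 * D.lap G (Q.div D u) := by
  have hK := hD.lie u
  rw [D.anchor_scal hD, D.tr_dRiem hK hG.selfAdjoint,
    D.tr_dcov_lam hK hG.selfAdjoint (D.dEnd_lieEnd h u)]
  have : Q.tr (fun x y => Q.dcov D (Q.kappa (D.lie u)) x (G y)) = D.lap G (Q.div D u) := by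
    refine Q.tr_congr fun x y => ?_
    simp only [dcov, hF.kappa_lie]
  simp only [this, h.dEnd, map_zero, LinearMap.zero_apply, (kappa_lin (D.lie u)).map_zero,
    Q.tr_zero]
  ring

end Conn

end CourantModule

end

end CourantFlow

/-! ### Mixed components of the Ricci tensor and the contracted Bianchi identity. -/

namespace CourantFlow

noncomputable section

variable {A Γ ι : Type*} [CommRing A] [Algebra ℝ A] [AddCommGroup Γ] [Module ℝ Γ]
    [Module A Γ] [IsScalarTower ℝ A Γ] [Fintype ι]

namespace CourantModule

variable {Q : CourantModule A Γ ι} {G : Γ →ₗ[A] Γ}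

theorem half_smul_two_mul (t : A) : (1 / 2 : ℝ) • (2 * t) = t := by
  rw [two_mul, ← two_smul ℝ t, smul_smul]; norm_num

theorem two_mul_half_smul (t : A) : 2 * (1 / 2 : ℝ) • t = t := by
  rw [mul_smul_comm, half_smul_two_mul]

/-- The projection to the negative eigenspace of an involution. -/
def projNeg (G : Γ →ₗ[A] Γ) : Γ →ₗ[A] Γ := (1 / 2 : ℝ) • (LinearMap.id - G)

theorem projNeg_apply (x : Γ) : projNeg G x = (1 / 2 : ℝ) • (x - G x) := rfl

theorem projNeg_add_projNeg_neg (x : Γ) : projNeg G x + projNeg (-G) x = x := by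
  simp only [projNeg_apply, LinearMap.neg_apply, ← smul_add]
  rw [sub_neg_eq_add, sub_add_add_cancel, ← two_smul ℝ x, smul_smul]; norm_num

theorem map_real_smul (G : Γ →ₗ[A] Γ) (c : ℝ) (x : Γ) : G (c • x) = c • G x := by
  rw [← algebraMap_smul A c x, map_smul, algebraMap_smul]

theorem pair_real_smul_left (c : ℝ) (x y : Γ) : Q.pair (c • x) y = c • Q.pair x y :=
  (Q.pair_bilin.left y).map_real_smul c x

theorem pair_real_smul_right (c : ℝ) (x y : Γ) : Q.pair x (c • y) = c • Q.pair x y :=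
  (Q.pair_bilin.right x).map_real_smul c y

namespace IsInvolution

theorem neg (hG : Q.IsInvolution G) : Q.IsInvolution (-G) :=
  ⟨fun x y => by simp [hG.selfAdjoint], fun x => by simp [hG.involutive]⟩

theorem map_projNeg (hG : Q.IsInvolution G) (x : Γ) : G (projNeg G x) = - projNeg G x := by
  rw [projNeg_apply, map_real_smul, map_sub, hG.involutive, ← smul_neg, neg_sub]

theorem map_projNeg_neg (hG : Q.IsInvolution G) (x : Γ) : G (projNeg (-G) x) = projNeg (-G) x := by
  have := hG.neg.map_projNeg x
  simpa using this

theorem projNeg_selfAdjoint (hG : Q.IsInvolution G) (x y : Γ) :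
    Q.pair (projNeg G x) y = Q.pair x (projNeg G y) := by
  simp only [projNeg_apply, pair_real_smul_left, pair_real_smul_right, map_sub,
    LinearMap.sub_apply, hG.selfAdjoint]

/-- Opposite eigenspaces are orthogonal. -/
theorem pair_eq_zero (hG : Q.IsInvolution G) {x y : Γ} (hx : G x = -x) (hy : G y = y) :
    Q.pair x y = 0 := by
  have := hG.selfAdjoint x y
  rw [hx, hy] at this
  apply eq_of_two_mul_eq
  simp only [map_neg, LinearMap.neg_apply] at this
  linear_combination -this

theorem pair_eq_zero' (hG : Q.IsInvolution G) {x y : Γ} (hx : G x = x) (hy : G y = -y) :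
    Q.pair x y = 0 := by
  rw [Q.pair_comm, hG.pair_eq_zero hy hx]

end IsInvolution

namespace Conn

variable {D : Q.Conn}

theorem Preserves.neg (h : D.Preserves G) : D.Preserves (-G) := fun x y => by
  simp [h x y]

theorem Preserves.cov_pos (h : D.Preserves G) {x : Γ} (hx : G x = x) (y : Γ) :
    G (D.cov y x) = D.cov y x := by rw [← h, hx]

theorem Preserves.cov_neg (h : D.Preserves G) {x : Γ} (hx : G x = -x) (y : Γ) :
    G (D.cov y x) = - D.cov y x := by rw [← h, hx, map_neg]

theorem Preserves.comm_neg (h : D.Preserves G) {x : Γ} (hx : G x = -x) (y z : Γ) :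
    G (D.comm y z x) = - D.comm y z x := by
  simp only [comm, second, map_sub, h.cov_neg hx, h.cov_neg (h.cov_neg hx _)]
  abel

theorem Preserves.projNeg (h : D.Preserves G) : D.Preserves (projNeg G) := fun x y => by
  simp only [projNeg_apply, map_smul, map_sub, h x y]

/-- The torsion correction pairs `D_w a ∈ V_-` with `b ∈ V_+`, so it vanishes and the bracket takes
its usual form. -/
theorem bracket_mixed (hD : D.TorsionFree) (hG : Q.IsInvolution G) (h : D.Preserves G) {a b : Γ}
    (ha : G a = -a) (hb : G b = b) : Q.bracket a b = D.cov a b - D.cov b a := by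
  refine Q.pair_ext fun w => ?_
  rw [hD.pair_bracket, hG.pair_eq_zero (h.cov_neg ha w) hb]
  simp

/-- The other two terms pair vectors of opposite eigenbundles, since `D` preserves the eigenbundles.
-/
theorem riem_mixed (hG : Q.IsInvolution G) (h : D.Preserves G) (w z : Γ) {x y : Γ}
    (hx : G x = -x) (hy : G y = y) : D.riem w z x y = (1 / 2 : ℝ) • Q.pair w (D.comm x y z) := by
  unfold riem
  rw [hG.pair_eq_zero' hy (h.comm_neg hx _ _)]
  simp [hG.pair_eq_zero (h.cov_neg hx _) hy, Q.tr_zero]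

/-- The term that differentiates `D_a v` along `u` becomes the derivative of `div v`, because the
dual families are parallel under contraction. -/
theorem tr_pair_comm (u v : Γ) : Q.tr (fun a b => Q.pair b (D.comm a u v)) =
    Q.div D (D.cov u v) - Q.anchor u (Q.div D v)
      - Q.tr (fun a b => Q.pair (D.cov (D.cov a u) v) b) := by
  have h1 := D.tr_cov (B := fun a b => Q.pair (D.cov a v) b)
    ⟨fun _ => ⟨by simp, by simp⟩, fun _ => ⟨by simp, by simp⟩⟩ u
  have h2 : ∀ a b, Q.pair b (D.comm a u v) = Q.pair (D.cov a (D.cov u v)) b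
      - Q.pair (D.cov (D.cov a u) v) b - (Q.pair (D.cov u (D.cov a v)) b
      - Q.pair (D.cov (D.cov u a) v) b) := fun a b => by
    rw [Q.pair_comm]
    simp only [comm, second, map_sub, LinearMap.sub_apply]
  rw [Q.tr_congr h2]
  simp only [div, anchor_tr, D.metric u, Q.tr_add, Q.tr_sub] at h1 ⊢
  linear_combination h1

theorem tr_riem_projNeg (hG : Q.IsInvolution G) (h : D.Preserves G)
    {u v : Γ} (hu : G u = u) (hv : G v = -v) :
    Q.tr (fun a b => D.riem b v (CourantModule.projNeg G a) u) =
      (1 / 2 : ℝ) • Q.tr (fun a b => Q.pair b (D.comm a u v)) := by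
  simp only [D.riem_mixed hG h _ _ (hG.map_projNeg _) hu, Q.tr_smul]
  congr 1
  have hb : IsBilin (fun a b => Q.pair b (D.comm a u v)) :=
    ⟨fun w => by simpa only [Q.pair_comm w] using D.comm_lin_left u v w,
      fun _ => ⟨by simp, by simp⟩⟩
  have h1 : ∀ a b, Q.pair b (D.comm a u v) = Q.pair b (D.comm (CourantModule.projNeg G a) u v) +
      Q.pair b (D.comm (CourantModule.projNeg (-G) a) u v) := fun a b => by
    rw [← (hb.left b).add, projNeg_add_projNeg_neg]
  rw [Q.tr_congr h1, Q.tr_add, Q.tr_adjoint hb hG.neg.projNeg_selfAdjoint]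
  simp only [hG.pair_eq_zero' (hG.map_projNeg_neg _) (h.comm_neg hv _ _), Q.tr_zero, add_zero]

variable (D) in
-- Both sides are traces of the product of the endomorphisms `a ↦ D_a u` and `a ↦ D_a v`, in the two
-- possible orders.
theorem tr_cov_cov_symm (u v : Γ) : Q.tr (fun a b => Q.pair (D.cov (D.cov a u) v) b) =
    Q.tr (fun a b => Q.pair (D.cov (D.cov a v) u) b) := by
  have h : ∀ u v a b, Q.pair (D.cov (D.cov a u) v) b =
      Q.tr (fun c d => Q.pair (D.cov a u) d * Q.pair (D.cov c v) b) := fun u v a b =>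
    (Q.tr_pair_mul' (f := fun x => Q.pair (D.cov x v) b) ⟨by simp, by simp⟩ _).symm
  simp only [h]
  rw [Q.tr_comm (fun a b c d => Q.pair (D.cov a u) d * Q.pair (D.cov c v) b)]
  exact Q.tr_congr fun a b => Q.tr_congr fun c d => mul_comm _ _

/-- The mixed components of the full Ricci tensor. -/
theorem fRic_mixed (hD : D.TorsionFree) (hF : D.IsFlat) (hG : Q.IsInvolution G)
    (h : D.Preserves G) {u v : Γ} (hu : G u = u) (hv : G v = -v) :
    D.fRic u v = Q.div D (D.cov v u) - Q.anchor v (Q.div D u)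
      - Q.tr (fun a b => Q.pair (D.cov (D.cov a u) v) b) := by
  have hb := hD.riem_bilin_fst_trd v u
  -- The contracted index is split into its `V_-` and `V_+` parts. The second part is the first one
  -- for `-G`, with `u` and `v` exchanged.
  have h1 : D.fRic u v = Q.tr (fun a b => D.riem b v (CourantModule.projNeg G a) u) +
      Q.tr (fun a b => D.riem b v (CourantModule.projNeg (-G) a) u) := by
    rw [← Q.tr_add]
    refine Q.tr_congr fun a b => ?_
    rw [← (hb.left b).add, projNeg_add_projNeg_neg]
  have h2 : Q.tr (fun a b => D.riem b v (CourantModule.projNeg (-G) a) u) =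
      Q.tr (fun a b => D.riem b u (CourantModule.projNeg (-G) a) v) := by
    have hb' := hD.riem_bilin_fst_trd u v
    rw [← Q.tr_swap (B := fun a b => D.riem b u (CourantModule.projNeg (-G) a) v)
      ⟨fun y => ⟨by simp [(hb'.left _).add], by simp [(hb'.left _).smul]⟩, fun _ => hb'.right _⟩,
      Q.tr_adjoint hb hG.neg.projNeg_selfAdjoint]
    exact Q.tr_congr fun a b => hD.riem_swap _ _ _ _
  -- The cocycle identity for `[v, u] = D_v u - D_u v` shows that the two halves are equal, so their
  -- average has the stated form.
  have h3 := hF.bracket v u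
  rw [bracket_mixed hD hG h hv hu, D.div_sub] at h3
  rw [h1, h2, tr_riem_projNeg hG h hu hv,
    tr_riem_projNeg hG.neg h.neg (by simp [hv]) (by simp [hu]), tr_pair_comm, tr_pair_comm,
    D.tr_cov_cov_symm v u, ← smul_add]
  conv_rhs => rw [← half_smul_two_mul (Q.div D (D.cov v u) - Q.anchor v (Q.div D u)
      - Q.tr (fun a b => Q.pair (D.cov (D.cov a u) v) b))]
  congr 1
  linear_combination -h3

/-- Consequently the Ricci tensor pairs `V_+` with `V_-` only. -/
theorem ric_map (hG : Q.IsInvolution G) (u v : Γ) : D.ric G (G u) (G v) = - D.ric G u v := by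
  simp [ric, hG.involutive]

theorem ric_projNeg (hD : D.TorsionFree) (hG : Q.IsInvolution G) {u : Γ} (hu : G u = u) (v : Γ) :
    D.ric G u (CourantModule.projNeg G v) = D.ric G u v := by
  have h1 := D.ric_map hG u v
  rw [hu] at h1
  rw [projNeg_apply, ((hD.ric_bilin G).right u).map_real_smul, ((hD.ric_bilin G).right u).map_sub,
    h1, sub_neg_eq_add, ← two_mul, half_smul_two_mul]

theorem ric_mixed (hD : D.TorsionFree) {u v : Γ} (hu : G u = u) (hv : G v = -v) :
    D.ric G u v = 2 * D.fRic u v := by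
  rw [ric, hu, hv, (hD.fRic_bilin.right u).map_neg]; ring

/-- The divergence of the Ricci tensor. -/
def divRic (D : Q.Conn) (G : Γ →ₗ[A] Γ) (u : Γ) : A :=
  Q.tr (fun x y => Q.anchor x (D.ric G u y) - D.ric G (D.cov x u) y - D.ric G u (D.cov x y))

/-- For `u ∈ V_+` every `D_x u` lies in `V_+`, so `G` acts trivially on it. What survives is a
symmetrized derivative of `u` along `V_-`. -/
theorem lieEnd_apply_pos (hD : D.TorsionFree) (hG : Q.IsInvolution G) (h : D.Preserves G)
    {u : Γ} (hu : G u = u) (v z : Γ) :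
    Q.pair (Q.lieEnd u G v) z = 2 * Q.pair (D.cov (CourantModule.projNeg G v) u) z +
      2 * Q.pair (D.cov (CourantModule.projNeg G z) u) v := by
  have hU : ∀ x y, Q.pair (D.cov x u) (G y) = Q.pair (D.cov x u) y := fun x y => by
    rw [← hG.selfAdjoint, h.cov_pos hu]
  have h1 : ∀ x y, 2 * Q.pair (D.cov (CourantModule.projNeg G x) u) y =
      Q.pair (D.cov x u) y - Q.pair (D.cov (G x) u) y := fun x y => by
    rw [← ((⟨by simp, by simp⟩ : IsLin (fun x => Q.pair (D.cov x u) y)).map_sub),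
      projNeg_apply,
      (⟨by simp, by simp⟩ : IsLin (fun x => Q.pair (D.cov x u) y)).map_real_smul,
      two_mul_half_smul]
  rw [h1, h1]
  simp only [lieEnd, LinearMap.coe_mk, AddHom.coe_mk, map_sub, LinearMap.sub_apply, hG.selfAdjoint,
    hD.pair_bracket, hU]
  rw [h u v, hG.selfAdjoint]
  ring

/-- By `lieEnd_apply_pos`, `L_u G` pairs `V_-` with `V_+` and meets only the mixed part of `fRic`,
which is half of `ric`. -/
theorem tr_lieEnd (hD : D.TorsionFree) (hG : Q.IsInvolution G) (h : D.Preserves G)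
    {u : Γ} (hu : G u = u) :
    Q.tr (fun x y => D.fRic x (Q.lieEnd u G y)) =
      2 * Q.tr (fun x y => D.ric G (D.cov x u) y) := by
  have hb := hD.fRic_bilin
  have hP := hG.projNeg_selfAdjoint
  have hbc : IsBilin (fun x y => D.fRic (D.cov x u) y) :=
    ⟨fun y => ⟨by simp [(hb.left _).add], by simp [(hb.left _).smul]⟩, fun _ => hb.right _⟩
  set T := Q.tr (fun x y => D.fRic (D.cov x u) (CourantModule.projNeg G y)) with hT
  have hT' : T = Q.tr (fun x y => D.fRic (D.cov (CourantModule.projNeg G x) u) y) :=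
    (Q.tr_adjoint hbc hP).symm
  have h1 : ∀ x y, D.fRic x (Q.lieEnd u G y) =
      2 * D.fRic x (D.cov (CourantModule.projNeg G y) u) +
      2 * Q.tr (fun z z' => Q.pair (D.cov (CourantModule.projNeg G z) u) y * D.fRic x z') := by
    intro x y
    rw [← Q.tr_pair_mul (hb.right x) (Q.lieEnd u G y),
      ← Q.tr_pair_mul (hb.right x) (D.cov (CourantModule.projNeg G y) u)]
    simp only [lieEnd_apply_pos hD hG h hu, add_mul, mul_assoc, Q.tr_add, Q.tr_mul]
  rw [Q.tr_congr h1]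
  simp only [Q.tr_add, Q.tr_mul]
  have h2 : Q.tr (fun x y => D.fRic x (D.cov (CourantModule.projNeg G y) u)) = T := by
    have hb2 : IsBilin (fun x y => D.fRic (D.cov (CourantModule.projNeg G x) u) y) :=
      ⟨fun y => ⟨by simp [(hb.left _).add], by simp [(hb.left _).smul]⟩, fun _ => hb.right _⟩
    rw [hT', ← Q.tr_swap hb2]
    exact Q.tr_congr fun x y => hD.fRic_symm _ _
  have h3 : Q.tr (fun x y => Q.tr (fun z z' =>
      Q.pair (D.cov (CourantModule.projNeg G z) u) y * D.fRic x z')) = T := by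
    rw [Q.tr_comm (fun x y z z' => Q.pair (D.cov (CourantModule.projNeg G z) u) y * D.fRic x z'),
      hT']
    exact Q.tr_congr fun z z' => Q.tr_pair_mul' (hb.left z') _
  have h4 : Q.tr (fun x y => D.ric G (D.cov x u) y) = 2 * T := by
    rw [hT, ← Q.tr_mul]
    refine Q.tr_congr fun x y => ?_
    rw [← ric_mixed hD (h.cov_pos hu x) (hG.map_projNeg y), ric_projNeg hD hG (h.cov_pos hu x)]
  rw [h2, h3, h4]
  ring

variable (D) in
theorem div_eq_tr_dcov (V : Γ) : Q.tr (Q.dcov D (fun z => Q.pair V z)) = Q.div D V :=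
  Q.tr_congr fun x y => D.dcov_pair V x y

variable (D) in
/-- The divergence of a sum of decomposable endomorphisms. -/
theorem omega_of_sum {κ : Type*} [Fintype κ] (T : Γ →ₗ[A] Γ) (a b : κ → Γ)
    (hT : ∀ y, T y = ∑ k, Q.pair y (a k) • b k) (z : Γ) :
    D.omega T z = Q.pair (∑ k, (Q.div D (a k) • b k + D.cov (a k) (b k))) z := by
  have h1 : ∀ x y, D.dEnd T x y =
      ∑ k, (Q.pair y (D.cov x (a k)) • b k + Q.pair y (a k) • D.cov x (b k)) := by
    intro x y
    simp only [dEnd, hT, map_sum, D.leibniz, ← Finset.sum_sub_distrib, D.metric]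
    refine Finset.sum_congr rfl fun k _ => ?_
    rw [add_smul]; abel
  simp only [omega, h1, tr, map_sum, LinearMap.sum_apply]
  rw [Finset.sum_comm]
  refine Finset.sum_congr rfl fun k _ => ?_
  simp only [map_add, map_smul, LinearMap.add_apply, LinearMap.smul_apply, smul_eq_mul,
    Finset.sum_add_distrib]
  congr 1
  · rw [div, tr, Finset.sum_mul]
    exact Finset.sum_congr rfl fun i _ => by rw [Q.pair_comm]
  · have := Q.sum_pair_mul (f := fun x => Q.pair (D.cov x (b k)) z) ⟨by simp, by simp⟩ (a k)
    rw [← this]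
    exact Finset.sum_congr rfl fun i _ => by rw [Q.pair_comm]

/-- The twofold divergence of a mixed tensor does not depend on the order of contractions. -/
theorem div_div_mixed (hD : D.TorsionFree) (hF : D.IsFlat) (hG : Q.IsInvolution G)
    (h : D.Preserves G) {a b : Γ} (ha : G a = -a) (hb : G b = b) :
    Q.div D (Q.div D a • b + D.cov a b) = Q.div D (Q.div D b • a + D.cov b a) := by
  have h3 := hF.bracket a b
  rw [bracket_mixed hD hG h ha hb, D.div_sub] at h3
  rw [D.div_add, D.div_add, D.div_smul, D.div_smul]
  linear_combination h3

/-- In `anchor_scal_eq` the double divergence of `L_u G` is `4 div V` for a vector `V` that is half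
the Ricci tensor at `u` plus a projected gradient of `div u`. The contraction of `Rc` with `Du` and
the Laplacian of `div u` then cancel, and `-2 div Rc` remains. -/
theorem bianchi_pos (hD : D.TorsionFree) (hF : D.IsFlat) (hG : Q.IsInvolution G)
    (h : D.Preserves G) {u : Γ} (hu : G u = u) :
    Q.anchor u (D.scal G) = -2 * D.divRic G u := by
  have hP := hG.projNeg_selfAdjoint
  set P := CourantModule.projNeg G with hPdef
  set a : ι → Γ := fun k => P (Q.e k)
  set b : ι → Γ := fun k => D.cov (Q.e' k) u
  have ha : ∀ k, G (a k) = - a k := fun k => hG.map_projNeg _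
  have hb : ∀ k, G (b k) = b k := fun k => h.cov_pos hu _
  -- The endomorphism `L_u G` is written as a finite sum of decomposable ones, `2 (a k ⊗ b k + b k ⊗
  -- a k)`, for `omega_of_sum`.
  have hlie : ∀ y, Q.lieEnd u G y = ∑ k : ι ⊕ ι, Q.pair y (Sum.elim a b k) •
      Sum.elim (fun k => (2 : A) • b k) (fun k => (2 : A) • a k) k := by
    intro y
    refine Q.pair_ext fun z => ?_
    rw [lieEnd_apply_pos hD hG h hu, Fintype.sum_sum_type]
    simp only [Sum.elim_inl, Sum.elim_inr, map_add, map_sum, LinearMap.add_apply,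
      LinearMap.sum_apply, map_smul, LinearMap.smul_apply, smul_eq_mul]
    congr 1
    · rw [← Q.sum_pair_mul' (f := fun x => Q.pair (D.cov x u) z) ⟨by simp, by simp⟩ (P y),
        Finset.mul_sum]
      refine Finset.sum_congr rfl fun i _ => ?_
      rw [hP]; ring
    · rw [← Q.sum_pair_mul' (f := fun x => Q.pair (D.cov x u) y) ⟨by simp, by simp⟩ (P z),
        Finset.mul_sum]
      refine Finset.sum_congr rfl fun i _ => ?_
      rw [hP, Q.pair_comm z, Q.pair_comm y]; ring
  set V := ∑ k, (Q.div D (b k) • a k + D.cov (b k) (a k)) with hV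
  -- Each of the two halves contributes `2 div V`: they differ in the order of the contractions,
  -- which `div_div_mixed` shows to be irrelevant.
  have hω : Q.tr (Q.dcov D (D.omega (Q.lieEnd u G))) = 4 * Q.div D V := by
    have h1 : D.omega (Q.lieEnd u G) = fun z => Q.pair (∑ k : ι ⊕ ι,
      (Q.div D (Sum.elim a b k) • Sum.elim (fun k => (2 : A) • b k) (fun k => (2 : A) • a k) k +
        D.cov (Sum.elim a b k)
          (Sum.elim (fun k => (2 : A) • b k) (fun k => (2 : A) • a k) k))) z :=
      funext fun z => D.omega_of_sum (Q.lieEnd u G) _ _ hlie z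
    have h2 : ∀ x y : Γ, D.cov x ((2 : A) • y) = (2 : A) • D.cov x y := fun x y => by
      rw [two_smul, two_smul, map_add]
    have h3 : ∀ x : Γ, Q.div D ((2 : A) • x) = 2 * Q.div D x := fun x => by
      rw [two_smul, D.div_add, two_mul]
    rw [h1, div_eq_tr_dcov, Fintype.sum_sum_type, D.div_add, D.div_sum, D.div_sum, hV, D.div_sum]
    simp only [Sum.elim_inl, Sum.elim_inr, h2, smul_comm _ (2 : A), ← smul_add, h3,
      ← Finset.mul_sum, div_div_mixed hD hF hG h (ha _) (hb _)]
    ring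
  -- Pairing with `V` reproduces the right side of `fRic_mixed` at `P z`, except for the derivative
  -- of `div u`.
  have hVz : ∀ z, Q.pair V z = (1 / 2 : ℝ) • D.ric G u z + Q.anchor (P z) (Q.div D u) := by
    intro z
    have h1 : Q.pair V z = Q.div D (D.cov (P z) u) -
        Q.tr (fun x y => Q.pair (D.cov (D.cov x u) (P z)) y) := by
      have h2 : D.cov (P z) u = ∑ k, Q.pair (P z) (Q.e k) • b k := by
        conv_lhs => rw [← Q.expand' (P z)]
        simp [b]
      have h3 : Q.tr (fun x y => Q.pair (D.cov (D.cov x u) (P z)) y) =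
          ∑ k, Q.pair (D.cov (b k) (P z)) (Q.e k) := by
        rw [← Q.tr_swap (B := fun x y => Q.pair (D.cov (D.cov x u) (P z)) y)
          ⟨fun _ => ⟨by simp, by simp⟩, fun _ => ⟨by simp, by simp⟩⟩]
        rfl
      rw [h2, D.div_sum, h3, ← Finset.sum_sub_distrib, hV]
      simp only [map_sum, LinearMap.sum_apply]
      refine Finset.sum_congr rfl fun k _ => ?_
      rw [D.div_smul, D.metric]
      simp only [a, map_add, map_smul, LinearMap.add_apply, LinearMap.smul_apply, smul_eq_mul]
      rw [h.projNeg (b k) (Q.e k), ← hPdef, hP, hP, Q.pair_comm (P z), Q.pair_comm (P z)]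
      ring
    rw [h1, ← ric_projNeg hD hG hu z, ric_mixed hD hu (hG.map_projNeg z), half_smul_two_mul,
      fRic_mixed hD hF hG h hu (hG.map_projNeg z)]
    ring
  have hdV : Q.div D V = (1 / 2 : ℝ) • (D.divRic G u + Q.tr (fun x y => D.ric G (D.cov x u) y))
      - (1 / 2 : ℝ) • D.lap G (Q.div D u) := by
    have h1 : ∀ x y, Q.dcov D (fun z => Q.pair V z) x y =
        (1 / 2 : ℝ) • ((Q.anchor x (D.ric G u y) - D.ric G (D.cov x u) y - D.ric G u (D.cov x y)) +
          D.ric G (D.cov x u) y) + ((1 / 2 : ℝ) • Q.dcov D (fun v => Q.anchor v (Q.div D u)) x y -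
          (1 / 2 : ℝ) • Q.dcov D (fun v => Q.anchor v (Q.div D u)) x (G y)) := by
      intro x y
      have hl : IsLin (fun v => Q.anchor v (Q.div D u)) := ⟨by simp, by simp⟩
      have h2 := D.dcov_comp_end hl (G := P) x y
      rw [h.projNeg.dEnd, map_zero] at h2
      have h3 := ((D.dcov_bilin hl).right x).map_real_smul (1 / 2 : ℝ) (y - G y)
      rw [((D.dcov_bilin hl).right x).map_sub] at h3
      rw [← smul_sub, ← h3]
      change _ = _ + Q.dcov D _ x (P y)
      simp only [Derivation.coe_zero, Pi.zero_apply, add_zero] at h2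
      rw [← h2]
      simp only [dcov, hVz, map_add, Derivation.map_smul]
      rw [show ∀ s t r : A, s - t - r + t = s - r from fun s t r => by ring, smul_sub]
      ring
    rw [← div_eq_tr_dcov, Q.tr_congr h1]
    simp only [Q.tr_add, Q.tr_sub, Q.tr_smul, divRic, lap]
    -- With `P = (1 - G) / 2`, the divergence of the projected gradient is half of `div grad`, which
    -- vanishes, minus half of the Laplacian.
    have := hF.grad (Q.div D u)
    rw [show Q.tr (fun x y => Q.dcov D (fun v => Q.anchor v (Q.div D u)) x y) = 0 from this]
    simp [sub_eq_add_neg]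
  rw [anchor_scal_eq hD hF hG h, hω, hdV, tr_lieEnd hD hG h hu]
  have e1 := two_mul_half_smul (D.divRic G u + Q.tr (fun x y => D.ric G (D.cov x u) y))
  have e2 := two_mul_half_smul (D.lap G (Q.div D u))
  linear_combination (-2) * e1 + 2 * e2

theorem divRic_add (hD : D.TorsionFree) (u v : Γ) :
    D.divRic G (u + v) = D.divRic G u + D.divRic G v := by
  simp only [divRic, ← Q.tr_add]
  refine Q.tr_congr fun x y => ?_
  simp only [((hD.ric_bilin G).left _).add, map_add]
  ring

/-- The contracted Bianchi identity. -/
theorem bianchi (hD : D.TorsionFree) (hF : D.IsFlat) (hG : Q.IsInvolution G)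
    (h : D.Preserves G) (u : Γ) :
    Q.anchor (G u) (D.scal G) = -2 * D.divRic G u := by
  -- Passing from `G` to `-G` exchanges the eigenbundles, reverses the sign of the scalar curvature
  -- and leaves `ric` unchanged.
  have hs : D.scal (-G) = - D.scal G := by
    rw [scal, scal, ← Q.tr_neg]
    exact Q.tr_congr fun x y => by simp [(hD.fRic_bilin.right x).map_neg]
  have hr : D.ric (-G) = D.ric G := by
    funext x y
    simp [ric, (hD.fRic_bilin.right _).map_neg, (hD.fRic_bilin.left _).map_neg]
  have h1 := bianchi_pos hD hF hG h (u := CourantModule.projNeg (-G) u) (hG.map_projNeg_neg u)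
  have h2 := bianchi_pos hD hF hG.neg h.neg (u := CourantModule.projNeg G u)
    (by simp [hG.map_projNeg])
  have h3 : D.divRic (-G) = D.divRic G := by funext x; simp [divRic, hr]
  rw [hs, h3, map_neg] at h2
  rw [← projNeg_add_projNeg_neg (G := G) u, map_add, hG.map_projNeg, hG.map_projNeg_neg,
    divRic_add hD]
  simp only [map_add, map_neg, Derivation.add_apply, Derivation.neg_apply]
  linear_combination h1 + h2

end Conn

end CourantModule

end

end CourantFlow

/-! ### Explicit Levi-Civita connections with prescribed divergence. -/

namespace CourantFlow

noncomputable section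

variable {A Γ ι : Type*} [CommRing A] [Algebra ℝ A] [AddCommGroup Γ] [Module ℝ Γ]
    [Module A Γ] [IsScalarTower ℝ A Γ] [Fintype ι]

/-- `A`-trilinearity of a scalar valued function of three arguments. -/
structure IsTrilin (T : Γ → Γ → Γ → A) : Prop where
  fst : ∀ y z, IsLin (fun x => T x y z)
  snd : ∀ x z, IsLin (fun y => T x y z)
  trd : ∀ x y, IsLin (fun z => T x y z)

namespace CourantModule

variable {Q : CourantModule A Γ ι} {G : Γ →ₗ[A] Γ}

variable (Q) in
/-- The tensor `K` with `⟨K_x y, z⟩ = T(x, y, z)`. -/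
def ofTrilin {T : Γ → Γ → Γ → A} (hT : IsTrilin T) : Γ →ₗ[A] Γ →ₗ[A] Γ :=
  LinearMap.mk₂ A (fun x y => ∑ j, T x y (Q.e j) • Q.e' j)
    (by intros; simp only [(hT.fst _ _).add, add_smul, Finset.sum_add_distrib])
    (by intros; simp only [(hT.fst _ _).smul, mul_smul, Finset.smul_sum])
    (by intros; simp only [(hT.snd _ _).add, add_smul, Finset.sum_add_distrib])
    (by intros; simp only [(hT.snd _ _).smul, mul_smul, Finset.smul_sum])

theorem pair_ofTrilin {T : Γ → Γ → Γ → A} (hT : IsTrilin T) (x y z : Γ) :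
    Q.pair (Q.ofTrilin hT x y) z = T x y z := by
  simp only [ofTrilin, LinearMap.mk₂_apply, map_sum, map_smul, LinearMap.sum_apply,
    LinearMap.smul_apply, smul_eq_mul]
  rw [← Q.sum_pair_mul (hT.trd x y) z]
  exact Finset.sum_congr rfl fun i _ => by rw [Q.pair_comm]; ring

variable (Q) in
/-- A metric connection defined by the dual frames. -/
def frameConn : Q.Conn where
  -- The two operators built from `e` and from `e'` are adjoint to each other for the pairing. Their
  -- average is metric, while each alone need not be.
  cov := LinearMap.mk₂' A ℝ (fun u v => ∑ i, (1 / 2 : ℝ) • (Q.anchor u (Q.pair v (Q.e' i)) • Q.e i +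
      Q.anchor u (Q.pair v (Q.e i)) • Q.e' i))
    (by
      intro u u' v
      rw [← Finset.sum_add_distrib]
      refine Finset.sum_congr rfl fun i _ => ?_
      simp only [map_add, Derivation.add_apply, add_smul, smul_add]; abel)
    (by
      intro a u v
      rw [Finset.smul_sum]
      refine Finset.sum_congr rfl fun i _ => ?_
      simp only [map_smul, Derivation.smul_apply, smul_add, smul_assoc, smul_comm a (1 / 2 : ℝ)])
    (by
      intro u v v'
      rw [← Finset.sum_add_distrib]
      refine Finset.sum_congr rfl fun i _ => ?_
      simp only [map_add, LinearMap.add_apply, add_smul, smul_add]; abel)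
    (by
      intro c u v
      rw [Finset.smul_sum]
      refine Finset.sum_congr rfl fun i _ => ?_
      simp only [pair_real_smul_left, Derivation.map_smul, smul_add, smul_assoc,
        smul_comm c (1 / 2 : ℝ)])
  leibniz u v f := by
    have h : ∀ x y : Γ, x = y → (1 / 2 : ℝ) • (x + y) = x := by
      rintro x _ rfl; rw [← two_smul ℝ x, smul_smul]; norm_num
    have h1 : Q.anchor u f • v = ∑ i, (1 / 2 : ℝ) • ((Q.anchor u f * Q.pair v (Q.e' i)) • Q.e i +
        (Q.anchor u f * Q.pair v (Q.e i)) • Q.e' i) := by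
      rw [← Finset.smul_sum, Finset.sum_add_distrib]
      simp only [mul_smul, ← Finset.smul_sum]
      rw [Q.expand, Q.expand', h _ _ rfl]
    simp only [LinearMap.mk₂'_apply]
    rw [h1, Finset.smul_sum, ← Finset.sum_add_distrib]
    refine Finset.sum_congr rfl fun i _ => ?_
    rw [smul_comm f, ← smul_add]
    simp only [map_smul, LinearMap.smul_apply, smul_eq_mul, Derivation.leibniz, add_smul,
      smul_add, smul_smul, mul_comm (Q.pair v _) (Q.anchor u f)]
    abel
  metric u v w := by
    simp only [LinearMap.mk₂'_apply, map_sum, LinearMap.sum_apply, pair_real_smul_left,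
      pair_real_smul_right, map_add, LinearMap.add_apply, map_smul, LinearMap.smul_apply,
      smul_eq_mul, ← Finset.sum_add_distrib, ← smul_add]
    rw [← Finset.smul_sum]
    have h1 := congrArg (Q.anchor u) (Q.sum_pair_mul_pair v w)
    have h2 := congrArg (Q.anchor u) (Q.sum_pair_mul_pair w v)
    simp only [map_sum, Derivation.leibniz, smul_eq_mul, Q.pair_comm (Q.e' _)] at h1 h2
    rw [Q.pair_comm w v] at h2
    rw [← half_smul_two_mul (Q.anchor u (Q.pair v w)), two_mul]
    nth_rewrite 1 [← h1]
    rw [← h2, ← Finset.sum_add_distrib]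
    congr 1
    refine Finset.sum_congr rfl fun i _ => ?_
    rw [Q.pair_comm (Q.e i), Q.pair_comm (Q.e' i)]
    ring

namespace Conn

/-- The symmetric part of the bracket is `𝒟⟨u, v⟩`, and the metric property cancels it against the
terms `⟨D_w u, v⟩` and `⟨D_w v, u⟩`. -/
theorem torsion_anti₁₂ (D : Q.Conn) (u v w : Γ) : Q.torsion D u v w = - Q.torsion D v u w := by
  have h1 := Q.bracket_symm u v w
  have h2 := D.metric w u v
  rw [Q.pair_comm u (D.cov w v)] at h2
  simp only [torsion, map_sub, map_add, LinearMap.sub_apply, LinearMap.add_apply] at h1 ⊢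
  linear_combination -h2 - h1

theorem torsion_anti₂₃ (D : Q.Conn) (u v w : Γ) : Q.torsion D u v w = - Q.torsion D u w v := by
  have h1 := Q.invariance u v w
  have h2 := D.metric u v w
  rw [Q.pair_comm v (Q.bracket u w)] at h1
  rw [Q.pair_comm v (D.cov u w)] at h2
  simp only [torsion, map_sub, LinearMap.sub_apply] at h1 ⊢
  linear_combination h1 - h2

/-- Tensoriality is evident only in the last argument; the antisymmetries carry it to the others. -/
theorem torsion_trilin (D : Q.Conn) : IsTrilin (Q.torsion D) := by
  have h3 : ∀ u v, IsLin (fun w => Q.torsion D u v w) := fun u v =>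
    ⟨by intros; simp [torsion]; ring, by intros; simp [torsion]; ring⟩
  have h2 : ∀ u w, IsLin (fun v => Q.torsion D u v w) := fun u w => by
    constructor
    · intro x y; simp only [D.torsion_anti₂₃ u _ w]; rw [(h3 u w).add]; ring
    · intro a x; simp only [D.torsion_anti₂₃ u _ w]; rw [(h3 u w).smul]; ring
  refine ⟨fun v w => ?_, h2, h3⟩
  constructor
  · intro x y; simp only [D.torsion_anti₁₂ _ v w]; rw [(h2 v w).add]; ring
  · intro a x; simp only [D.torsion_anti₁₂ _ v w]; rw [(h2 v w).smul]; ring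

/-- A torsion-free metric connection exists. -/
theorem exists_torsionFree (Q : CourantModule A Γ ι) : ∃ D : Q.Conn, D.TorsionFree := by
  set D := Q.frameConn
  -- Adding a totally skew tensor to `D` changes the torsion by three times that tensor.
  have hT : IsTrilin (fun u v w => -(1 / 3 : ℝ) • Q.torsion D u v w) :=
    ⟨fun _ _ => ⟨by intros; rw [(D.torsion_trilin.fst _ _).add, smul_add],
      by intros; rw [(D.torsion_trilin.fst _ _).smul, mul_smul_comm]⟩,
     fun _ _ => ⟨by intros; rw [(D.torsion_trilin.snd _ _).add, smul_add],
      by intros; rw [(D.torsion_trilin.snd _ _).smul, mul_smul_comm]⟩,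
     fun _ _ => ⟨by intros; rw [(D.torsion_trilin.trd _ _).add, smul_add],
      by intros; rw [(D.torsion_trilin.trd _ _).smul, mul_smul_comm]⟩⟩
  set S := Q.ofTrilin hT
  have hS := Q.pair_ofTrilin hT
  refine ⟨⟨LinearMap.mk₂' A ℝ (fun x y => D.cov x y + S x y) (by intros; simp; abel)
    (by intros; simp) (by intros; simp; abel)
    (by intro c x y; simp), by intros; simp [D.leibniz]; abel, ?_⟩, ?_⟩
  · intro u v w
    simp only [LinearMap.mk₂'_apply, D.metric, map_add, LinearMap.add_apply]
    rw [Q.pair_comm v (S u w), hS, hS, D.torsion_anti₂₃ u w v, smul_neg]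
    ring
  · intro u v w
    simp only [torsion, LinearMap.mk₂'_apply, map_add, map_sub, LinearMap.add_apply,
      LinearMap.sub_apply]
    rw [hS, hS, hS, D.torsion_anti₁₂ v u w, D.torsion_anti₁₂ w u v, D.torsion_anti₂₃ u w v, neg_neg,
      smul_neg]
    have h3 : (1 / 3 : ℝ) • Q.torsion D u v w + (1 / 3 : ℝ) • Q.torsion D u v w +
        (1 / 3 : ℝ) • Q.torsion D u v w = Q.torsion D u v w := by
      rw [← add_smul, ← add_smul]; norm_num
    have h4 : Q.torsion D u v w = Q.pair (D.cov u v) w - Q.pair (D.cov v u) w -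
      Q.pair (Q.bracket u v) w + Q.pair (D.cov w u) v := by
      simp [torsion]
    simp only [neg_smul]
    linear_combination - h3 - h4

/-- The tensor `½ ⟨(D_x G) y, G z⟩`. -/
def compTensor (D : Q.Conn) (G : Γ →ₗ[A] Γ) (x y z : Γ) : A :=
  (1 / 2 : ℝ) • Q.pair (D.dEnd G x y) (G z)

/-- The correction of a torsion-free connection to one that preserves `G`. -/
def preserveTensor (D : Q.Conn) (G : Γ →ₗ[A] Γ) (x y z : Γ) : A :=
  -- The first term alone compensates `D G`. The subtracted terms commute with `G`, so they do not
  -- disturb this, and they make the cyclic sum vanish.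
  D.compTensor G x y z - (1 / 2 : ℝ) • (D.compTensor G y z x + D.compTensor G z x y +
    D.compTensor G (G y) (G z) x + D.compTensor G (G z) x (G y))

/-- The correction of the divergence by a covector `k`. -/
def divTensor (Q : CourantModule A Γ ι) (G : Γ →ₗ[A] Γ) (c c' : A) (k : Γ → A) (x y z : Γ) : A :=
  c * (Q.pair (projNeg (-G) x) z * k (projNeg (-G) y) -
    Q.pair (projNeg (-G) x) y * k (projNeg (-G) z)) +
  c' * (Q.pair (projNeg G x) z * k (projNeg G y) - Q.pair (projNeg G x) y * k (projNeg G z))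

/-- The trace of `preserveTensor`. -/
def preserveTrace (D : Q.Conn) (G : Γ →ₗ[A] Γ) (v : Γ) : A :=
  Q.tr (fun x y => D.preserveTensor G x v y)

/-- The difference of a Levi-Civita connection for `G` with divergence `δ` and a torsion-free
connection `D`. -/
def lcTensor (D : Q.Conn) (G : Γ →ₗ[A] Γ) (c c' : A) (δ : Γ → A) (x y z : Γ) : A :=
  D.preserveTensor G x y z +
    divTensor Q G c c' (fun v => δ v - Q.div D v - D.preserveTrace G v) x y z

variable (D : Q.Conn)

theorem compTensor_trilin : IsTrilin (D.compTensor G) :=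
  ⟨fun _ _ => ⟨by intros; simp [compTensor, dEnd_add_left],
      by intros; simp [compTensor, dEnd_smul_left]⟩,
    fun _ _ => ⟨by intros; simp [compTensor, dEnd_add_right],
      by intros; simp [compTensor, dEnd_smul_right]⟩,
    fun _ _ => ⟨by intros; simp [compTensor], by intros; simp [compTensor]⟩⟩

theorem preserveTensor_trilin : IsTrilin (D.preserveTensor G) := by
  have h := D.compTensor_trilin (G := G)
  refine ⟨fun _ _ => ⟨?_, ?_⟩, fun _ _ => ⟨?_, ?_⟩, fun _ _ => ⟨?_, ?_⟩⟩ <;> intros <;>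
  simp only [preserveTensor, map_add, map_smul, (h.fst _ _).add, (h.fst _ _).smul, (h.snd _ _).add,
    (h.snd _ _).smul, (h.trd _ _).add, (h.trd _ _).smul, smul_add, mul_add, mul_sub,
    mul_smul_comm] <;> ring

theorem preserveTrace_lin : IsLin (D.preserveTrace G) := by
  have h := D.preserveTensor_trilin (G := G)
  exact ⟨by intros; simp [preserveTrace, (h.snd _ _).add, Q.tr_add],
    by intros; simp [preserveTrace, (h.snd _ _).smul, Q.tr_mul]⟩

theorem divTensor_trilin (c c' : A) {k : Γ → A} (hk : IsLin k) :
    IsTrilin (divTensor Q G c c' k) := by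
  refine ⟨fun _ _ => ⟨?_, ?_⟩, fun _ _ => ⟨?_, ?_⟩, fun _ _ => ⟨?_, ?_⟩⟩ <;> intros <;>
  simp only [divTensor, map_add, map_smul, hk.add, hk.smul, LinearMap.add_apply,
    LinearMap.smul_apply, smul_eq_mul] <;> ring

theorem dEnd_selfAdjoint (hG : Q.IsInvolution G) (x y z : Γ) :
    Q.pair (D.dEnd G x y) z = Q.pair y (D.dEnd G x z) := by
  have h1 := congrArg (Q.anchor x) (hG.selfAdjoint y z)
  rw [D.metric, D.metric, hG.selfAdjoint y (D.cov x z)] at h1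
  simp only [dEnd, map_sub, LinearMap.sub_apply, hG.selfAdjoint]
  linear_combination h1

/-- This is the derivative of `G² = 1`. -/
theorem dEnd_map (hG : Q.IsInvolution G) (x y : Γ) : D.dEnd G x (G y) = - G (D.dEnd G x y) := by
  simp [dEnd, hG.involutive]

theorem compTensor_skew (hG : Q.IsInvolution G) (x y z : Γ) :
    D.compTensor G x y z = - D.compTensor G x z y := by
  rw [compTensor, compTensor, D.dEnd_selfAdjoint hG, D.dEnd_map hG, ← hG.selfAdjoint,
    Q.pair_comm y]
  simp

theorem compTensor_map (hG : Q.IsInvolution G) (x y z : Γ) :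
    D.compTensor G x (G y) z = - D.compTensor G x y (G z) := by
  rw [compTensor, compTensor, D.dEnd_map hG, ← hG.selfAdjoint, ← hG.selfAdjoint]
  simp [hG.involutive, hG.selfAdjoint]

theorem map_projNeg_comm (hG : Q.IsInvolution G) (x : Γ) :
    projNeg G (G x) = - projNeg G x := by
  simp [projNeg_apply, hG.involutive, ← smul_neg]

theorem divTensor_map (hG : Q.IsInvolution G) (c c' : A) {k : Γ → A} (hk : IsLin k) (x y z : Γ) :
    divTensor Q G c c' k x (G y) z = divTensor Q G c c' k x y (G z) := by
  have h1 : ∀ x, projNeg (-G) (G x) = projNeg (-G) x := fun x => by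
    have := map_projNeg_comm hG.neg x
    simpa using this
  have h2 := map_projNeg_comm hG
  simp only [divTensor, h1, h2, ← hG.selfAdjoint, hG.map_projNeg, hG.map_projNeg_neg, hk.map_neg,
    map_neg, LinearMap.neg_apply]
  ring

/-- On each eigenbundle the contraction multiplies `k` by the trace of the projection minus one. The
factors `c` and `c'` invert these numbers, which is possible because no eigenbundle has rank one. -/
theorem tr_divTensor (hG : Q.IsInvolution G) {c c' : A}
    (hc : c * (Q.tr (fun x y => Q.pair (projNeg (-G) x) y) - 1) = 1)
    (hc' : c' * (Q.tr (fun x y => Q.pair (projNeg G x) y) - 1) = 1)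
    {k : Γ → A} (hk : IsLin k) (v : Γ) :
    Q.tr (fun x y => divTensor Q G c c' k x v y) = k v := by
  have h1 : ∀ G' : Γ →ₗ[A] Γ, Q.IsInvolution G' →
      Q.tr (fun x y => Q.pair (projNeg G' x) y * k (projNeg G' v)) =
        Q.tr (fun x y => Q.pair (projNeg G' x) y) * k (projNeg G' v) := fun G' _ => by
    simp [tr, Finset.sum_mul]
  have hP : ∀ G' : Γ →ₗ[A] Γ, Q.IsInvolution G' → ∀ x, projNeg G' (projNeg G' x) = projNeg G' x := by
    intro G' h' x
    rw [projNeg_apply (x := projNeg G' x), h'.map_projNeg, sub_neg_eq_add, ← two_smul ℝ, smul_smul]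
    norm_num
  have h2 : ∀ G' : Γ →ₗ[A] Γ, Q.IsInvolution G' →
      Q.tr (fun x y => Q.pair (projNeg G' x) v * k (projNeg G' y)) = k (projNeg G' v) := by
    intro G' h'
    have := Q.tr_pair_mul (f := fun y => k (projNeg G' y)) ⟨by simp [hk.add], by simp [hk.smul]⟩
      (projNeg G' v)
    rw [hP G' h'] at this
    rw [← this]
    exact Q.tr_congr fun x y => by rw [h'.projNeg_selfAdjoint, Q.pair_comm]
  simp only [divTensor, Q.tr_add, Q.tr_mul, Q.tr_sub]
  rw [h1 _ hG, h1 _ hG.neg, h2 _ hG, h2 _ hG.neg]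
  have h3 : k (projNeg G v) + k (projNeg (-G) v) = k v := by
    rw [← hk.add, projNeg_add_projNeg_neg]
  linear_combination k (projNeg (-G) v) * hc + k (projNeg G v) * hc' + h3

variable {δ : Γ → A}

theorem lcTensor_trilin (hδ : IsLin (fun v => δ v - Q.div D v)) (c c' : A) :
    IsTrilin (D.lcTensor G c c' δ) := by
  have hk : IsLin (fun v => δ v - Q.div D v - D.preserveTrace G v) :=
    ⟨fun x y => by rw [hδ.add, D.preserveTrace_lin.add]; ring,
     fun a x => by rw [hδ.smul, D.preserveTrace_lin.smul]; ring⟩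
  have h1 := D.preserveTensor_trilin (G := G)
  have h2 := divTensor_trilin (Q := Q) (G := G) c c' hk
  refine ⟨fun _ _ => ⟨?_, ?_⟩, fun _ _ => ⟨?_, ?_⟩, fun _ _ => ⟨?_, ?_⟩⟩ <;> intros <;>
  simp only [lcTensor, (h1.fst _ _).add, (h1.fst _ _).smul, (h1.snd _ _).add,
    (h1.snd _ _).smul, (h1.trd _ _).add, (h1.trd _ _).smul, (h2.fst _ _).add, (h2.fst _ _).smul,
    (h2.snd _ _).add, (h2.snd _ _).smul, (h2.trd _ _).add, (h2.trd _ _).smul] <;> ring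

/-- In the cyclic sum the terms of `preserveTensor` with two arguments hit by `G` cancel by
`compTensor_map`. Those without `G` occur with total weight zero, since the factor `1/2` meets two
of them. For `divTensor` the self-adjointness of the projections suffices. -/
theorem lcTensor_isVariation (hG : Q.IsInvolution G) (hδ : IsLin (fun v => δ v - Q.div D v))
    (c c' : A) : Q.IsVariation (Q.ofTrilin (D.lcTensor_trilin (G := G) hδ c c')) := by
  have hs := D.compTensor_skew hG
  have hm := D.compTensor_map hG
  have hP := fun x y => hG.projNeg_selfAdjoint x y
  have hP' := fun x y => hG.neg.projNeg_selfAdjoint x y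
  constructor
  · intro x y z
    simp only [pair_ofTrilin, lcTensor, preserveTensor, divTensor]
    rw [hs x z y, hs z y x, hs y x z, hs (G z) (G y) x, hs (G y) x (G z)]
    simp only [smul_add, smul_neg]
    ring
  · intro x y z
    simp only [pair_ofTrilin, lcTensor, preserveTensor, divTensor]
    rw [hm (G y) z x, hm (G z) x y, hm (G x) y z, hP y x, hP' y x, hP z x, hP' z x, hP z y, hP' z y,
      Q.pair_comm y (projNeg G x), Q.pair_comm y (projNeg (-G) x),
      Q.pair_comm z (projNeg G x), Q.pair_comm z (projNeg (-G) x),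
      Q.pair_comm z (projNeg G y), Q.pair_comm z (projNeg (-G) y)]
    have e : ∀ t : A, t = (1 / 2 : ℝ) • t + (1 / 2 : ℝ) • t := fun t => by
      rw [← add_smul]; norm_num
    simp only [smul_add, smul_neg]
    linear_combination e (D.compTensor G x y z) + e (D.compTensor G y z x) + e (D.compTensor G z x y)

/-- Of the three ingredients only `compTensor` fails to commute with `G`, and its failure is exactly
`D G`. -/
theorem lcTensor_preserves (hG : Q.IsInvolution G) (hδ : IsLin (fun v => δ v - Q.div D v))
    (c c' : A) (x y : Γ) : D.dEnd G x y =
      G (Q.ofTrilin (D.lcTensor_trilin (G := G) hδ c c') x y) -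
        Q.ofTrilin (D.lcTensor_trilin (G := G) hδ c c') x (G y) := by
  have hk : IsLin (fun v => δ v - Q.div D v - D.preserveTrace G v) :=
    ⟨fun x y => by rw [hδ.add, D.preserveTrace_lin.add]; ring,
     fun a x => by rw [hδ.smul, D.preserveTrace_lin.smul]; ring⟩
  refine Q.pair_ext fun z => ?_
  rw [map_sub, LinearMap.sub_apply, hG.selfAdjoint, pair_ofTrilin, pair_ofTrilin, lcTensor, lcTensor,
    divTensor_map hG c c' hk, preserveTensor, preserveTensor]
  simp only [hG.involutive]
  rw [D.compTensor_map hG x y z]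
  have h1 : Q.pair (D.dEnd G x y) z = D.compTensor G x y (G z) + D.compTensor G x y (G z) := by
    rw [compTensor, hG.involutive, ← smul_add, ← two_mul, half_smul_two_mul]
  rw [h1]
  simp only [smul_add]
  ring

theorem lcTensor_kappa (hG : Q.IsInvolution G) (hδ : IsLin (fun v => δ v - Q.div D v)) {c c' : A}
    (hc : c * (Q.tr (fun x y => Q.pair (projNeg (-G) x) y) - 1) = 1)
    (hc' : c' * (Q.tr (fun x y => Q.pair (projNeg G x) y) - 1) = 1) (v : Γ) :
    Q.kappa (Q.ofTrilin (D.lcTensor_trilin (G := G) hδ c c')) v = δ v - Q.div D v := by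
  have hk : IsLin (fun v => δ v - Q.div D v - D.preserveTrace G v) :=
    ⟨fun x y => by rw [hδ.add, D.preserveTrace_lin.add]; ring,
     fun a x => by rw [hδ.smul, D.preserveTrace_lin.smul]; ring⟩
  simp only [kappa, pair_ofTrilin, lcTensor, Q.tr_add, tr_divTensor hG hc hc' hk]
  simp [preserveTrace]

variable {D}

theorem add_preserves {K : Γ →ₗ[A] Γ →ₗ[A] Γ} (hK : Q.IsVariation K)
    (h : ∀ x y, D.dEnd G x y = G (K x y) - K x (G y)) : (D.add hK).Preserves G := fun x y => by
  have := h x y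
  simp only [dEnd] at this
  rw [add_cov, add_cov, map_add, ← sub_eq_zero]
  rw [← sub_eq_zero] at this
  rw [← this]; abel

variable (Q) in
/-- Levi-Civita connections with prescribed divergence exist. -/
theorem exists_leviCivita (hG : Q.IsInvolution G) {c c' : A}
    (hc : c * (Q.tr (fun x y => Q.pair (projNeg (-G) x) y) - 1) = 1)
    (hc' : c' * (Q.tr (fun x y => Q.pair (projNeg G x) y) - 1) = 1)
    (hadd : ∀ u v, δ (u + v) = δ u + δ v)
    (hsmul : ∀ (f : A) u, δ (f • u) = f * δ u + Q.anchor u f) :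
    ∃ D : Q.Conn, D.TorsionFree ∧ D.Preserves G ∧ ∀ u, Q.div D u = δ u := by
  obtain ⟨D, hD⟩ := exists_torsionFree Q
  have hδ : IsLin (fun v => δ v - Q.div D v) :=
    ⟨fun u v => by rw [hadd, D.div_add]; ring, fun f u => by rw [hsmul, D.div_smul]; ring⟩
  have hK := D.lcTensor_isVariation hG hδ c c'
  refine ⟨D.add hK, hD.add hK, add_preserves hK (D.lcTensor_preserves hG hδ c c'), fun u => ?_⟩
  rw [D.div_add_var, D.lcTensor_kappa hG hδ hc hc']; ring

end Conn

end CourantModule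

end

end CourantFlow

/-! ### Time derivative of the scalar curvature in the algebraic setting. -/

namespace CourantFlow

noncomputable section

variable {A Γ ι : Type*} [CommRing A] [Algebra ℝ A] [AddCommGroup Γ] [Module ℝ Γ]
    [Module A Γ] [IsScalarTower ℝ A Γ] [Fintype ι]

namespace CourantModule

variable {Q : CourantModule A Γ ι}

/-- A notion of derivative at time `t` of families in `A`: `HasD f f'` means that `f'` is the
derivative of `f` at `t`. -/
structure TimeDeriv (Q : CourantModule A Γ ι) (t : ℝ) where
  HasD : (ℝ → A) → A → Prop
  const : ∀ a, HasD (fun _ => a) 0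
  add : ∀ {f g f' g'}, HasD f f' → HasD g g' → HasD (fun s => f s + g s) (f' + g')
  mul : ∀ {f g f' g'}, HasD f f' → HasD g g' → HasD (fun s => f s * g s) (f' * g t + f t * g')
  anchor : ∀ {f f'} (u : Γ), HasD f f' → HasD (fun s => Q.anchor u (f s)) (Q.anchor u f')

namespace TimeDeriv

variable {t : ℝ} (T : TimeDeriv Q t)

theorem const_mul {f : ℝ → A} {f' : A} (a : A) (h : T.HasD f f') :
    T.HasD (fun s => a * f s) (a * f') := by
  simpa using T.mul (T.const a) h

theorem mul_const {f : ℝ → A} {f' : A} (h : T.HasD f f') (a : A) :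
    T.HasD (fun s => f s * a) (f' * a) := by
  simpa using T.mul h (T.const a)

theorem smul {f : ℝ → A} {f' : A} (c : ℝ) (h : T.HasD f f') :
    T.HasD (fun s => c • f s) (c • f') := by
  simpa only [Algebra.smul_def] using T.const_mul (algebraMap ℝ A c) h

theorem neg {f : ℝ → A} {f' : A} (h : T.HasD f f') : T.HasD (fun s => - f s) (- f') := by
  simpa using T.const_mul (-1) h

theorem sub {f g : ℝ → A} {f' g' : A} (h : T.HasD f f') (h' : T.HasD g g') :
    T.HasD (fun s => f s - g s) (f' - g') := by
  simpa only [sub_eq_add_neg] using T.add h (T.neg h')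

theorem sum {κ : Type*} (S : Finset κ) {f : κ → ℝ → A} {f' : κ → A}
    (h : ∀ k, T.HasD (f k) (f' k)) :
    T.HasD (fun s => ∑ k ∈ S, f k s) (∑ k ∈ S, f' k) := by
  classical
  induction S using Finset.induction_on with
  | empty => simpa using T.const 0
  | insert a S ha ih => simpa only [Finset.sum_insert ha] using T.add (h a) ih

theorem tr {B : ℝ → Γ → Γ → A} {B' : Γ → Γ → A} (h : ∀ x y, T.HasD (fun s => B s x y) (B' x y)) :
    T.HasD (fun s => Q.tr (B s)) (Q.tr B') :=
  T.sum _ fun _ => h _ _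

/-- Differentiability at time `t`. -/
def Diff (f : ℝ → A) : Prop := ∃ df, T.HasD f df

/-- Differentiability and vanishing at time `t`. -/
def Null (f : ℝ → A) : Prop := T.Diff f ∧ f t = 0

variable {T}

theorem Diff.add {f g : ℝ → A} (hf : T.Diff f) (hg : T.Diff g) : T.Diff (fun s => f s + g s) :=
  ⟨_, T.add hf.choose_spec hg.choose_spec⟩

theorem Diff.sub {f g : ℝ → A} (hf : T.Diff f) (hg : T.Diff g) : T.Diff (fun s => f s - g s) :=
  ⟨_, T.sub hf.choose_spec hg.choose_spec⟩

theorem Diff.mul {f g : ℝ → A} (hf : T.Diff f) (hg : T.Diff g) : T.Diff (fun s => f s * g s) :=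
  ⟨_, T.mul hf.choose_spec hg.choose_spec⟩

theorem Diff.smul {f : ℝ → A} (c : ℝ) (hf : T.Diff f) : T.Diff (fun s => c • f s) :=
  ⟨_, T.smul c hf.choose_spec⟩

theorem Diff.anchor {f : ℝ → A} (u : Γ) (hf : T.Diff f) : T.Diff (fun s => Q.anchor u (f s)) :=
  ⟨_, T.anchor u hf.choose_spec⟩

theorem diff_const (a : A) : T.Diff (fun _ => a) := ⟨_, T.const a⟩

theorem Diff.tr {B : ℝ → Γ → Γ → A} (h : ∀ x y, T.Diff (fun s => B s x y)) :
    T.Diff (fun s => Q.tr (B s)) := by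
  choose B' hB' using h
  exact ⟨_, T.tr hB'⟩

/-- This removes every term quadratic in the variation; the derivatives of the two factors need not
be known. -/
theorem Null.mul {f g : ℝ → A} (hf : T.Null f) (hg : T.Null g) :
    T.HasD (fun s => f s * g s) 0 := by
  obtain ⟨⟨f', h1⟩, h2⟩ := hf
  obtain ⟨⟨g', h3⟩, h4⟩ := hg
  simpa [h2, h4] using T.mul h1 h3

theorem HasD.congr {f g : ℝ → A} {f' g' : A} (h : T.HasD f f') (h1 : ∀ s, g s = f s)
    (h2 : g' = f') : T.HasD g g' := by
  rw [funext h1, h2]; exact h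

theorem Diff.congr {f g : ℝ → A} (h : T.Diff f) (h1 : ∀ s, g s = f s) : T.Diff g := by
  rw [show g = f from funext h1]; exact h

theorem tr_zero_of {B : ℝ → Γ → Γ → A} (h : ∀ x y, T.HasD (fun s => B s x y) 0) :
    T.HasD (fun s => Q.tr (B s)) 0 := by
  simpa [Q.tr_zero] using T.tr h

variable {G : ℝ → Γ →ₗ[A] Γ}

/-- A linear function evaluated on a differentiable family of vectors. -/
theorem Diff.apply {f : ℝ → Γ → A} (hf : ∀ s, IsLin (f s)) {v : ℝ → Γ}
    (hv : ∀ z, T.Diff (fun s => Q.pair (v s) z)) (h : ∀ z, T.Diff (fun s => f s z)) :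
    T.Diff (fun s => f s (v s)) :=
  (Diff.tr fun z z' => (hv z).mul (h z')).congr fun s => (Q.tr_pair_mul (hf s) (v s)).symm

theorem Null.apply {f : ℝ → Γ → A} (hf : ∀ s, IsLin (f s)) {v : ℝ → Γ}
    (hv : ∀ z, T.Diff (fun s => Q.pair (v s) z)) (h : ∀ z, T.Null (fun s => f s z)) :
    T.Null (fun s => f s (v s)) := by
  refine ⟨Diff.apply hf hv fun z => (h z).1, ?_⟩
  exact (Q.tr_pair_mul (hf t) (v t)).symm.trans (by simp [CourantModule.tr, (h _).2])

/-- A vanishing linear function evaluated on a vanishing family of vectors. -/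
theorem Null.apply_null {f : ℝ → Γ → A} (hf : ∀ s, IsLin (f s)) {v : ℝ → Γ}
    (hv : ∀ z, T.Null (fun s => Q.pair (v s) z)) (h : ∀ z, T.Null (fun s => f s z)) :
    T.HasD (fun s => f s (v s)) 0 :=
  HasD.congr (tr_zero_of fun z z' => (hv z).mul (h z'))
    (fun s => (Q.tr_pair_mul (hf s) (v s)).symm) rfl

theorem diff_dEnd (D : Q.Conn) (hG : ∀ u v, T.Diff (fun s => Q.pair (G s u) v)) (x y z : Γ) :
    T.Diff (fun s => Q.pair (D.dEnd (G s) x y) z) := by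
  refine Diff.congr (((hG y z).anchor x).sub (hG y (D.cov x z)) |>.sub (hG (D.cov x y) z))
    fun s => ?_
  simp only [Conn.dEnd, D.metric, map_sub, LinearMap.sub_apply]
  ring

theorem diff_compTensor (D : Q.Conn) (hG : ∀ u v, T.Diff (fun s => Q.pair (G s u) v)) (x y z : Γ) :
    T.Diff (fun s => D.compTensor (G s) x y z) :=
  (Diff.apply (fun s => (Q.pair_bilin.right (D.dEnd (G s) x y))) (hG z)
    (diff_dEnd D hG x y)).smul _

theorem diff_projNeg (hG : ∀ u v, T.Diff (fun s => Q.pair (G s u) v)) (x z : Γ) :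
    T.Diff (fun s => Q.pair (projNeg (G s) x) z) := by
  refine (((diff_const (Q.pair x z)).sub (hG x z)).smul (1 / 2)).congr fun s => ?_
  rw [projNeg_apply, pair_real_smul_left, map_sub, LinearMap.sub_apply]

theorem diff_neg (hG : ∀ u v, T.Diff (fun s => Q.pair (G s u) v)) (x z : Γ) :
    T.Diff (fun s => Q.pair ((-(G s)) x) z) := by
  refine ((diff_const 0).sub (hG x z)).congr fun s => ?_
  simp

theorem diff_preserveTensor (D : Q.Conn) (hG : ∀ u v, T.Diff (fun s => Q.pair (G s u) v))
    (x y z : Γ) : T.Diff (fun s => D.preserveTensor (G s) x y z) := by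
  have h := diff_compTensor D hG
  have ht : ∀ s, IsTrilin (D.compTensor (G s)) := fun s => D.compTensor_trilin
  refine (h x y z).sub (((((h y z x).add (h z x y)).add ?_).add ?_).smul _)
  · exact Diff.apply (fun s => (ht s).fst (G s z) x) (hG y) fun y' =>
      Diff.apply (fun s => (ht s).snd y' x) (hG z) fun z' => h y' z' x
  · exact Diff.apply (fun s => (ht s).fst x (G s y)) (hG z) fun z' =>
      Diff.apply (fun s => (ht s).trd z' x) (hG y) fun y' => h z' x y'

theorem diff_divTensor {c c' : ℝ → A} {k : ℝ → Γ → A} (hk : ∀ s, IsLin (k s))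
    (hG : ∀ u v, T.Diff (fun s => Q.pair (G s u) v)) (hc : T.Diff c) (hc' : T.Diff c')
    (hkd : ∀ v, T.Diff (fun s => k s v)) (x y z : Γ) :
    T.Diff (fun s => Conn.divTensor Q (G s) (c s) (c' s) (k s) x y z) := by
  have h1 := diff_projNeg hG
  have h2 := diff_projNeg (diff_neg hG)
  have h3 : ∀ v, T.Diff (fun s => k s (projNeg (G s) v)) := fun v => Diff.apply hk (h1 v) hkd
  have h4 : ∀ v, T.Diff (fun s => k s (projNeg (-(G s)) v)) := fun v => Diff.apply hk (h2 v) hkd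
  exact (hc.mul (((h2 x z).mul (h4 y)).sub ((h2 x y).mul (h4 z)))).add
    (hc'.mul (((h1 x z).mul (h3 y)).sub ((h1 x y).mul (h3 z))))

/-- The tensor is built from `G s`, `c s`, `c' s` and `δ s` by products, contractions and the
anchor, so differentiability is inherited. It vanishes at `t` because `D` already preserves `G t`
and has the required divergence. -/
theorem null_lcTensor {D : Q.Conn} {c c' : ℝ → A} {δ : ℝ → Γ → A}
    (hδ : ∀ s, IsLin (fun v => δ s v - Q.div D v))
    (hG : ∀ u v, T.Diff (fun s => Q.pair (G s u) v)) (hc : T.Diff c) (hc' : T.Diff c')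
    (hδd : ∀ v, T.Diff (fun s => δ s v)) (hP : D.Preserves (G t)) (hδt : ∀ v, δ t v = Q.div D v)
    (x y z : Γ) : T.Null (fun s => D.lcTensor (G s) (c s) (c' s) (δ s) x y z) := by
  have h1 := diff_preserveTensor D hG
  have h2 : ∀ v, T.Diff (fun s => D.preserveTrace (G s) v) := fun v =>
    Diff.tr fun x y => h1 x v y
  have hk : ∀ s, IsLin (fun v => δ s v - Q.div D v - D.preserveTrace (G s) v) := fun s =>
    ⟨fun x y => by rw [(hδ s).add, D.preserveTrace_lin.add]; ring,
     fun a x => by rw [(hδ s).smul, D.preserveTrace_lin.smul]; ring⟩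
  refine ⟨(h1 x y z).add (diff_divTensor hk hG hc hc'
    (fun v => ((hδd v).sub (diff_const _)).sub (h2 v)) x y z), ?_⟩
  have h3 : ∀ x y z, D.preserveTensor (G t) x y z = 0 := fun x y z => by
    simp [Conn.preserveTensor, Conn.compTensor, hP.dEnd]
  have h4 : ∀ v, D.preserveTrace (G t) v = 0 := fun v => by
    simp [Conn.preserveTrace, h3, Q.tr_zero]
  simp [Conn.lcTensor, h3, h4, hδt, Conn.divTensor]

/-- After moving one `K` across the pairing by skewness, every term is a product of two components
of `K`, each vanishing at `t`. -/
theorem hasD_quad {K : ℝ → Γ →ₗ[A] Γ →ₗ[A] Γ} (hK : ∀ s, Q.IsVariation (K s))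
    (hG : ∀ u v, T.Diff (fun s => Q.pair (G s u) v))
    (h : ∀ x y z, T.Null (fun s => Q.pair (K s x y) z)) (w y a x : Γ) :
    T.HasD (fun s => Conn.quad Q (K s) w (G s y) a x) 0 := by
  have hs : ∀ s x y z, Q.pair x (K s y z) = - Q.pair (K s y x) z := fun s x y z => by
    rw [Q.pair_comm, (hK s).skew]
  have hKG : ∀ x z, T.Null (fun s => Q.pair (K s x (G s y)) z) := fun x z =>
    Null.apply (f := fun s v => Q.pair (K s x v) z) (fun s => ⟨by simp, by simp⟩) (hG y)
      fun v => h x v z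
  have hKG' : ∀ x z, T.Null (fun s => Q.pair (K s (G s y) x) z) := fun x z =>
    Null.apply (f := fun s v => Q.pair (K s v x) z) (fun s => ⟨by simp, by simp⟩) (hG y)
      fun v => h v x z
  have t1 : T.HasD (fun s => - Q.pair (K s a w) (K s x (G s y))) 0 := by
    simpa using T.neg (Null.apply_null (f := fun s v => Q.pair (K s a w) v)
      (fun s => Q.pair_bilin.right _) (hKG x) (h a w))
  have t2 : T.HasD (fun s => - Q.pair (K s x w) (K s a (G s y))) 0 := by
    simpa using T.neg (Null.apply_null (f := fun s v => Q.pair (K s x w) v)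
      (fun s => Q.pair_bilin.right _) (hKG a) (h x w))
  have t3 : T.HasD (fun s => - Q.pair (K s (G s y) x) (K s w a)) 0 := by
    simpa using T.neg (Null.apply_null (f := fun s v => Q.pair (K s (G s y) x) v)
      (fun s => Q.pair_bilin.right _) (h w a) (hKG' x))
  have t4 : T.HasD (fun s => - Q.pair (K s w x) (K s (G s y) a)) 0 := by
    simpa using T.neg (Null.apply_null (f := fun s v => Q.pair (K s w x) v)
      (fun s => Q.pair_bilin.right _) (hKG' a) (h w x))
  have t5 : T.HasD (fun s => Q.tr (fun c d => Q.pair (K s c a) x * Q.pair (K s d (G s y)) w)) 0 :=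
    tr_zero_of fun c d => (h c a x).mul (hKG d w)
  refine HasD.congr (T.add (T.add (T.sub t1 t2) (T.sub t3 t4)) t5) (fun s => ?_) (by simp)
  simp only [Conn.quad, map_sub]
  rw [hs s w a, hs s w x, hs s x (G s y), hs s x w]

/-- The evolution of the scalar curvature under a variation `h = -2 Rc`, `φ' = -R / 2`. -/
theorem hasD_scal {D : Q.Conn} (hD : D.TorsionFree) (hF : D.IsFlat)
    (hGi : ∀ s, Q.IsInvolution (G s)) (hP : D.Preserves (G t))
    (hG : ∀ u v, T.HasD (fun s => Q.pair (G s u) v) (-2 * D.ric (G t) u v))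
    {φ : ℝ → A} (hφ : T.HasD φ (-(1 / 2 : ℝ) • D.scal (G t))) (hφt : φ t = 0)
    {c c' : ℝ → A} (hc : T.Diff c) (hc' : T.Diff c')
    (hcs : ∀ s, c s * (Q.tr (fun x y => Q.pair (projNeg (-(G s)) x) y) - 1) = 1)
    (hcs' : ∀ s, c' s * (Q.tr (fun x y => Q.pair (projNeg (G s) x) y) - 1) = 1)
    {R : ℝ → A} (hR : ∀ s (D' : Q.Conn), D'.TorsionFree → D'.Preserves (G s) →
      (∀ u, Q.div D' u = Q.div D u + 2 * Q.anchor u (φ s)) → R s = D'.scal (G s)) :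
    T.HasD R (D.lap (G t) (D.scal (G t)) +
      Q.tr (fun x x' => Q.tr (fun y y' =>
        D.ric (G t) x y * D.ric (G t) (G t x') (G t y')))) := by
  set δ : ℝ → Γ → A := fun s u => Q.div D u + 2 * Q.anchor u (φ s) with hδdef
  have hl : ∀ s, IsLin (fun v => 2 * Q.anchor v (φ s)) := fun s =>
    ⟨by intros; simp; ring, by intros; simp; ring⟩
  have hδ : ∀ s, IsLin (fun v => δ s v - Q.div D v) := fun s => by
    simpa [hδdef] using hl s
  have hGd : ∀ u v, T.Diff (fun s => Q.pair (G s u) v) := fun u v => ⟨_, hG u v⟩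
  have hφa : ∀ u, T.HasD (fun s => 2 * Q.anchor u (φ s)) (- Q.anchor u (D.scal (G t))) := by
    intro u
    refine HasD.congr (T.const_mul 2 (T.anchor u hφ)) (fun _ => rfl) ?_
    rw [Derivation.map_smul, neg_smul, mul_neg, two_mul_half_smul]
  set K : ℝ → Γ →ₗ[A] Γ →ₗ[A] Γ := fun s =>
    Q.ofTrilin (D.lcTensor_trilin (G := G s) (hδ s) (c s) (c' s)) with hKdef
  have hK : ∀ s, Q.IsVariation (K s) := fun s => D.lcTensor_isVariation (hGi s) (hδ s) _ _
  have hKp : ∀ s x y, D.dEnd (G s) x y = G s (K s x y) - K s x (G s y) := fun s =>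
    D.lcTensor_preserves (hGi s) (hδ s) _ _
  have hKk : ∀ s v, Q.kappa (K s) v = 2 * Q.anchor v (φ s) := fun s v => by
    rw [hKdef, D.lcTensor_kappa (hGi s) (hδ s) (hcs s) (hcs' s)]
    simp [hδdef]
  have hKn : ∀ x y z, T.Null (fun s => Q.pair (K s x y) z) := fun x y z => by
    simp only [hKdef, pair_ofTrilin]
    refine null_lcTensor hδ hGd hc hc' (fun v => ?_) hP (fun v => ?_) x y z
    · exact (diff_const _).add ⟨_, hφa v⟩
    · simp [hδdef, hφt]
  -- The connection `D + K s` is Levi-Civita for the data at time `s`, so it may replace any other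
  -- in computing `R s`.
  have hRs : ∀ s, R s = (D.add (hK s)).scal (G s) := fun s =>
    hR s _ (hD.add _) (Conn.add_preserves _ (hKp s)) fun u => by
      rw [D.div_add_var, hKk]
  have hdE : ∀ x y z, T.Null (fun s => Q.pair (D.dEnd (G s) x y) z) := fun x y z =>
    ⟨diff_dEnd D hGd x y z, by simp [hP.dEnd]⟩
  have hb := hD.ric_bilin (G t)
  have hf := hD.fRic_bilin
  have t1 : T.HasD (fun s => Q.tr (fun x y => D.fRic x (G s y)))
      (Q.tr (fun x y => Q.tr (fun z z' => -2 * D.ric (G t) y z * D.fRic x z'))) := by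
    refine T.tr fun x y => ?_
    exact HasD.congr (T.tr fun z z' => T.mul_const (hG y z) (D.fRic x z'))
      (fun s => (Q.tr_pair_mul (hf.right x) (G s y)).symm) rfl
  -- The divergence of `∂_t G = -2 Rc` is a derivative of the scalar curvature: this is where the
  -- Bianchi identity enters.
  have hω : ∀ z, T.HasD (fun s => D.omega (G s) z) (Q.anchor (G t z) (D.scal (G t))) := by
    intro z
    refine HasD.congr (T.tr fun x y => T.sub (T.sub (T.anchor x (hG y z)) (hG y (D.cov x z)))
      (hG (D.cov x y) z)) (fun s => Q.tr_congr fun x y => ?_) ?_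
    · simp only [Conn.dEnd, D.metric, map_sub, LinearMap.sub_apply]
      ring
    · rw [Conn.bianchi hD hF (hGi t) hP, Conn.divRic, ← Q.tr_mul]
      refine Q.tr_congr fun x y => ?_
      have h2 : ∀ v : A, Q.anchor x (-2 * v) = -2 * Q.anchor x v := fun v => by
        have : -2 * v = (-2 : ℝ) • v := by rw [Algebra.smul_def, map_neg, map_ofNat]
        rw [this, Derivation.map_smul, Algebra.smul_def, map_neg, map_ofNat]
      rw [hD.ric_symm _ y z, h2, hD.ric_symm _ y, hD.ric_symm _ _ z]
      ring
  have t2 : T.HasD (fun s => Q.tr (Q.dcov D (D.omega (G s)))) (D.lap (G t) (D.scal (G t))) := by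
    refine HasD.congr (T.tr fun x y => T.sub (T.anchor x (hω y)) (hω (D.cov x y)))
      (fun s => Q.tr_congr fun x y => rfl) (Q.tr_congr fun x y => ?_)
    have := D.dcov_comp_end (f := fun v => Q.anchor v (D.scal (G t))) ⟨by simp, by simp⟩
      (G := G t) x y
    rw [hP.dEnd] at this
    simpa [dcov] using this.symm
  -- The trace of `K s` is `2 dφ_s`, whose derivative at `t` is `-dR`; the derivative of `G` is
  -- multiplied by a trace that vanishes at `t`.
  have t3 : T.HasD (fun s => Q.tr (fun x y => Q.dcov D (Q.kappa (K s)) x (G s y)))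
      (- D.lap (G t) (D.scal (G t))) := by
    have hk0 : ∀ v, Q.kappa (K t) v = 0 := fun v => by rw [hKk, hφt]; simp
    have hd : ∀ x z, T.HasD (fun s => Q.dcov D (Q.kappa (K s)) x z)
        (- Q.dcov D (fun v => Q.anchor v (D.scal (G t))) x z) := by
      intro x z
      refine HasD.congr (T.sub (T.anchor x (hφa z)) (hφa (D.cov x z))) (fun s => ?_) ?_
      · simp only [dcov, hKk]
      · simp only [dcov, map_neg]; ring
    have hl' : IsLin (fun v => Q.anchor v (D.scal (G t))) := ⟨by simp, by simp⟩
    rw [Conn.lap, ← Q.tr_neg]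
    refine T.tr fun x y => ?_
    refine HasD.congr (T.tr fun z z' => T.mul (hG y z) (hd x z'))
      (fun s => (Q.tr_pair_mul ((D.dcov_bilin (kappa_lin (K s))).right x) (G s y)).symm) ?_
    rw [← Q.tr_pair_mul ((D.dcov_bilin hl').right x) (G t y), ← Q.tr_neg]
    refine Q.tr_congr fun z z' => ?_
    simp only [dcov, hk0, map_zero]
    ring
  have t4 : T.HasD (fun s => Q.tr (fun x y => Q.kappa (K s) (D.dEnd (G s) x y))) 0 :=
    tr_zero_of fun x y => Null.apply_null (fun s => kappa_lin (K s)) (hdE x y) fun z =>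
      ⟨⟨_, HasD.congr (hφa z) (fun s => hKk s z) rfl⟩, by simp [hKk, hφt]⟩
  have t5 : T.HasD (fun s => Q.tr (fun a b => Q.tr (fun x y =>
      Q.pair (K s x (D.dEnd (G s) a y)) b))) 0 :=
    tr_zero_of fun a b => tr_zero_of fun x y =>
      Null.apply_null (f := fun s v => Q.pair (K s x v) b) (fun s => ⟨by simp, by simp⟩) (hdE a y)
        fun z => hKn x z b
  have t6 : T.HasD (fun s => (1 / 2 : ℝ) • Q.tr (fun x y => Q.tr (fun a b =>
      Conn.quad Q (K s) b (G s y) a x))) 0 := by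
    simpa using T.smul (1 / 2 : ℝ)
      (tr_zero_of fun x y => tr_zero_of fun a b => hasD_quad hK hGd hKn b y a x)
  -- The term `t2` enters with coefficient `-1` and contributes `-ΔR`, while `t3` enters with
  -- coefficient `-2` and contributes `2 ΔR`.
  refine HasD.congr (T.add (T.sub (T.sub (T.sub (T.sub t1 t2) (T.const_mul 2 t3)) t4) t5) t6)
    (fun s => ?_) ?_
  · rw [hRs, D.scal_add (hK s) (hGi s).selfAdjoint (hKp s)]
  · have hb' : ∀ x x', IsBilin (fun z z' => D.ric (G t) x' z * D.fRic x z') := fun x x' =>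
      ⟨fun _ => ⟨by intros; rw [(hb.right _).add]; ring, by intros; rw [(hb.right _).smul]; ring⟩,
       fun _ => ⟨by intros; rw [(hf.right _).add]; ring, by intros; rw [(hf.right _).smul]; ring⟩⟩
    set S := Q.tr (fun x x' => Q.tr (fun y y' => D.fRic x y * D.ric (G t) x' y')) with hS
    have e1 : Q.tr (fun x y => Q.tr (fun z z' => -2 * D.ric (G t) y z * D.fRic x z')) =
        -2 * S := by
      rw [hS, ← Q.tr_mul]
      refine Q.tr_congr fun x x' => ?_
      rw [← Q.tr_mul]
      rw [Q.tr_congr (fun z z' => mul_assoc (-2) _ _), Q.tr_mul, ← Q.tr_swap (hb' x x'),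
        ← Q.tr_mul]
      exact Q.tr_congr fun y y' => by ring
    have e2 : Q.tr (fun x x' => Q.tr (fun y y' =>
        D.fRic (G t x) (G t y) * D.ric (G t) x' y')) = - S := by
      have h1 : ∀ x x', Q.tr (fun y y' => D.fRic (G t x) (G t y) * D.ric (G t) x' y') =
          Q.tr (fun y y' => D.fRic (G t x) y * D.ric (G t) x' (G t y')) := fun x x' =>
        Q.tr_adjoint (B := fun y y' => D.fRic (G t x) y * D.ric (G t) x' y')
          ⟨fun _ => ⟨by intros; rw [(hf.right _).add]; ring,
              by intros; rw [(hf.right _).smul]; ring⟩,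
            fun _ => ⟨by intros; rw [(hb.right _).add]; ring,
              by intros; rw [(hb.right _).smul]; ring⟩⟩ (hGi t).selfAdjoint
      rw [Q.tr_congr h1, Q.tr_adjoint (B := fun x x' => Q.tr (fun y y' =>
          D.fRic x y * D.ric (G t) x' (G t y'))) ?_ (hGi t).selfAdjoint, hS, ← Q.tr_neg]
      · refine Q.tr_congr fun x x' => ?_
        rw [← Q.tr_neg]
        refine Q.tr_congr fun y y' => ?_
        rw [Conn.ric_map (hGi t)]; ring
      · refine ⟨fun _ => ⟨fun x x' => ?_, fun a x => ?_⟩, fun _ => ⟨fun x x' => ?_, fun a x => ?_⟩⟩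
        · simp only [(hf.left _).add, add_mul, Q.tr_add]
        · simp only [(hf.left _).smul, mul_assoc, Q.tr_mul]
        · simp only [(hb.left _).add, mul_add, Q.tr_add]
        · simp only [(hb.left _).smul, mul_left_comm _ a, Q.tr_mul]
    -- Since `ric` changes sign under `G`, both parts of `ric = fRic - G fRic G` contribute the same
    -- amount to the squared norm.
    have e3 : Q.tr (fun x x' => Q.tr (fun y y' =>
        D.ric (G t) x y * D.ric (G t) (G t x') (G t y'))) = -2 * S := by
      have h1 : ∀ x x', Q.tr (fun y y' => D.ric (G t) x y * D.ric (G t) (G t x') (G t y')) =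
          Q.tr (fun y y' => D.fRic (G t x) (G t y) * D.ric (G t) x' y') -
            Q.tr (fun y y' => D.fRic x y * D.ric (G t) x' y') := fun x x' => by
        rw [← Q.tr_sub]
        refine Q.tr_congr fun y y' => ?_
        rw [Conn.ric_map (hGi t), Conn.ric.eq_1 D (G t) x y]; ring
      rw [Q.tr_congr h1, Q.tr_sub, e2]; ring
    rw [e1, e3]; ring

end TimeDeriv

end CourantModule

end

end CourantFlow

/-! ### Sections as a module, and global dual families on a compact base. -/

namespace CourantFlow

noncomputable section

section Smooth

variable {n : ℕ} {M : Type*} [TopologicalSpace M] [ChartedSpace (EuclideanSpace ℝ (Fin n)) M]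

theorem contMDiffAt_det {κ : Type*} [Fintype κ] [DecidableEq κ] {g : M → Matrix κ κ ℝ} {p : M}
    (hg : ∀ i j, ContMDiffAt (𝓡 n) 𝓘(ℝ, ℝ) ∞ (fun q => g q i j) p) :
    ContMDiffAt (𝓡 n) 𝓘(ℝ, ℝ) ∞ (fun q => (g q).det) p := by
  simp only [Matrix.det_apply]
  refine contMDiffAt_finsetSum fun τ _ => ?_
  simp only [Units.smul_def, zsmul_eq_mul]
  exact contMDiffAt_const.mul (contMDiffAt_finsetProd fun i _ => hg _ _)

theorem contMDiffAt_matrix_inv {κ : Type*} [Fintype κ] [DecidableEq κ] {g : M → Matrix κ κ ℝ}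
    {p : M} (hg : ∀ i j, ContMDiffAt (𝓡 n) 𝓘(ℝ, ℝ) ∞ (fun q => g q i j) p) (hp : (g p).det ≠ 0)
    (i j : κ) : ContMDiffAt (𝓡 n) 𝓘(ℝ, ℝ) ∞ (fun q => (g q)⁻¹ i j) p := by
  simp only [Matrix.inv_def, Matrix.smul_apply, Ring.inverse_eq_inv', Matrix.adjugate_apply,
    smul_eq_mul]
  refine ((contMDiffAt_det hg).inv₀ hp).mul (contMDiffAt_det fun k l => ?_)
  simp only [Matrix.updateRow_apply]
  split_ifs
  · exact contMDiffAt_const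
  · exact hg _ _

end Smooth

section Sections

variable {n : ℕ} {M : Type*} [TopologicalSpace M] [ChartedSpace (EuclideanSpace ℝ (Fin n)) M]
  {F : Type*} [NormedAddCommGroup F] [NormedSpace ℝ F]
  {E : M → Type*} [TopologicalSpace (TotalSpace F E)]
  [∀ p, AddCommGroup (E p)] [∀ p, Module ℝ (E p)] [∀ p, TopologicalSpace (E p)]
  [FiberBundle F E] [VectorBundle ℝ F E]

instance secModule : Module C^∞⟮𝓡 n, M; ℝ⟯ (Sec n F E) where
  smul f u := fsmul f u
  one_smul u := ContMDiffSection.ext fun p => one_smul ℝ (u p)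
  mul_smul f g u := ContMDiffSection.ext fun p => mul_smul (f p) (g p) (u p)
  smul_zero f := ContMDiffSection.ext fun p => smul_zero (f p)
  smul_add f u v := ContMDiffSection.ext fun p => smul_add (f p) (u p) (v p)
  add_smul f g u := ContMDiffSection.ext fun p => add_smul (f p) (g p) (u p)
  zero_smul u := ContMDiffSection.ext fun p => zero_smul ℝ (u p)

@[simp] theorem sec_smul_apply (f : C^∞⟮𝓡 n, M; ℝ⟯) (u : Sec n F E) (p : M) :
    (f • u) p = f p • u p := rfl

@[simp] theorem sec_add_apply (u v : Sec n F E) (p : M) : (u + v) p = u p + v p := rfl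

@[simp] theorem sec_sub_apply (u v : Sec n F E) (p : M) : (u - v) p = u p - v p := rfl

@[simp] theorem sec_neg_apply (u : Sec n F E) (p : M) : (-u) p = - u p := rfl

@[simp] theorem sec_zero_apply (p : M) : (0 : Sec n F E) p = 0 := rfl

@[simp] theorem sec_real_smul_apply (c : ℝ) (u : Sec n F E) (p : M) : (c • u) p = c • u p := rfl

theorem sec_sum_apply {κ : Type*} (s : Finset κ) (u : κ → Sec n F E) (p : M) :
    (∑ k ∈ s, u k) p = ∑ k ∈ s, u k p := by
  classical
  induction s using Finset.induction_on with
  | empty => simp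
  | insert a s ha ih => simp [Finset.sum_insert ha, ih]

theorem fun_sum_apply {κ : Type*} (s : Finset κ) (f : κ → C^∞⟮𝓡 n, M; ℝ⟯) (p : M) :
    (∑ k ∈ s, f k) p = ∑ k ∈ s, f k p := by
  classical
  induction s using Finset.induction_on with
  | empty => simp
  | insert a s ha ih => simp [Finset.sum_insert ha, ih]

instance : IsScalarTower ℝ C^∞⟮𝓡 n, M; ℝ⟯ (Sec n F E) :=
  ⟨fun c f u => ContMDiffSection.ext fun p => smul_assoc c (f p) (u p)⟩

end Sections

section Basic

variable {n : ℕ} {M : Type*} [TopologicalSpace M] [ChartedSpace (EuclideanSpace ℝ (Fin n)) M]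
  [IsManifold (𝓡 n) ∞ M]
  {F : Type*} [NormedAddCommGroup F] [NormedSpace ℝ F]
  {E : M → Type*} [TopologicalSpace (TotalSpace F E)]
  [∀ p, AddCommGroup (E p)] [∀ p, Module ℝ (E p)] [∀ p, TopologicalSpace (E p)]
  [FiberBundle F E] [VectorBundle ℝ F E]

theorem ext_apply [ContMDiffVectorBundle ∞ F E (𝓡 n)] [SigmaCompactSpace M] [T2Space M] {p : M} (e : E p) : (ext e : Sec n F E) p = e :=
  (exists_section (n := n) (F := F) p e).choose_spec

variable (C : CourantAlgebroid n F E)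

theorem CourantAlgebroid.pairing_comm (p : M) (x y : E p) : C.pairing p x y = C.pairing p y x :=
  (C.pairing_symm p).eq x y

theorem CourantAlgebroid.pairing_ext {p : M} {x y : E p}
    (h : ∀ z, C.pairing p x z = C.pairing p y z) : x = y := by
  rw [← sub_eq_zero]
  refine (C.pairing_nondegenerate p).1 _ fun z => ?_
  simp [h]

/-- The Gram matrix of a family of sections. -/
def gram (b : Fin (Module.finrank ℝ F) → Sec n F E) (p : M) :
    Matrix (Fin (Module.finrank ℝ F)) (Fin (Module.finrank ℝ F)) ℝ :=
  Matrix.of fun α β => C.pairing p (b α p) (b β p)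

theorem gram_smooth (b : Fin (Module.finrank ℝ F) → Sec n F E) (p : M) (α β) :
    ContMDiffAt (𝓡 n) 𝓘(ℝ, ℝ) ∞ (fun q => gram C b q α β) p :=
  C.pairing_smooth (b α) (b β) p

end Basic

section Frames

variable {n : ℕ} {M : Type*} [TopologicalSpace M] [ChartedSpace (EuclideanSpace ℝ (Fin n)) M]
  [IsManifold (𝓡 n) ∞ M]
  {F : Type*} [NormedAddCommGroup F] [NormedSpace ℝ F] [FiniteDimensional ℝ F]
  {E : M → Type*} [TopologicalSpace (TotalSpace F E)]
  [∀ p, AddCommGroup (E p)] [∀ p, Module ℝ (E p)] [∀ p, TopologicalSpace (E p)]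
  [FiberBundle F E] [VectorBundle ℝ F E]
  (C : CourantAlgebroid n F E)

/-- A linear relation among the vectors would lie in the kernel of the Gram matrix. -/
theorem span_of_gram {b : Fin (Module.finrank ℝ F) → Sec n F E} {p : M}
    (h : (gram C b p).det ≠ 0) : Submodule.span ℝ (Set.range fun α => b α p) = ⊤ := by
  have hli : LinearIndependent ℝ (fun α => b α p) := by
    rw [Fintype.linearIndependent_iff]
    intro c hc
    have : Matrix.vecMul c (gram C b p) = 0 := by
      funext β
      have := congrArg (fun x => C.pairing p x (b β p)) hc
      simpa [Matrix.vecMul, dotProduct, gram] using this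
    have h0 := Matrix.eq_zero_of_vecMul_eq_zero h this
    exact fun i => congrFun h0 i
  have : FiniteDimensional ℝ (E p) := Module.Finite.of_basis (frame F E p)
  exact hli.span_eq_top_of_card_eq_finrank' (by
    rw [Module.finrank_eq_card_basis (frame F E p)])

theorem pairing_ext_of_gram {b : Fin (Module.finrank ℝ F) → Sec n F E} {p : M}
    (h : (gram C b p).det ≠ 0) {x y : E p}
    (hxy : ∀ α, C.pairing p x (b α p) = C.pairing p y (b α p)) : x = y := by
  refine C.pairing_ext fun z => ?_
  have hz : z ∈ Submodule.span ℝ (Set.range fun α => b α p) := by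
    rw [span_of_gram C h]; trivial
  induction hz using Submodule.span_induction with
  | mem z hz => obtain ⟨α, rfl⟩ := hz; exact hxy α
  | zero => simp
  | add z w _ _ hz hw => simp [hz, hw]
  | smul a z _ hz => simp [hz]

theorem gram_eventually {b : Fin (Module.finrank ℝ F) → Sec n F E} {p : M}
    (h : (gram C b p).det ≠ 0) : ∀ᶠ q in nhds p, (gram C b q).det ≠ 0 :=
  (contMDiffAt_det (gram_smooth C b p)).continuousAt.eventually_ne h

/-- A section is smooth at `p` if its pairings with a local frame of smooth sections are. -/
theorem contMDiffAt_section_of_gram {b : Fin (Module.finrank ℝ F) → Sec n F E} {p : M}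
    (h : (gram C b p).det ≠ 0) {s : ∀ q, E q}
    (hs : ∀ α, ContMDiffAt (𝓡 n) 𝓘(ℝ, ℝ) ∞ (fun q => C.pairing q (s q) (b α q)) p) :
    ContMDiffAt (𝓡 n) ((𝓡 n).prod 𝓘(ℝ, F)) ∞ (fun q => (⟨q, s q⟩ : TotalSpace F E)) p := by
  -- The components of `s` in the local frame are recovered from its pairings by the inverse Gram
  -- matrix.
  have h1 : ContMDiffAt (𝓡 n) ((𝓡 n).prod 𝓘(ℝ, F)) ∞
      (fun q => (⟨q, ∑ α, (∑ β, C.pairing q (s q) (b β q) * (gram C b q)⁻¹ β α) • b α q⟩ :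
        TotalSpace F E)) p := by
    refine ContMDiffAt.sum_section fun α _ => ContMDiffAt.smul_section ?_ (b α).contMDiff.contMDiffAt
    exact contMDiffAt_finsetSum fun β _ => (hs β).mul
      (contMDiffAt_matrix_inv (gram_smooth C b p) h β α)
  refine h1.congr_of_eventuallyEq ?_
  filter_upwards [gram_eventually C h] with q hq
  congr 1
  refine pairing_ext_of_gram C hq fun γ => ?_
  have h2 : (gram C b q)⁻¹ * gram C b q = 1 :=
    Matrix.nonsing_inv_mul _ (isUnit_iff_ne_zero.mpr hq)
  have h3 : Matrix.vecMul (Matrix.vecMul (fun β => C.pairing q (s q) (b β q)) (gram C b q)⁻¹)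
      (gram C b q) = fun β => C.pairing q (s q) (b β q) := by
    rw [Matrix.vecMul_vecMul, h2, Matrix.vecMul_one]
  have h4 := congrFun h3 γ
  simp only [map_sum, map_smul, LinearMap.sum_apply, LinearMap.smul_apply, smul_eq_mul]
  exact h4.symm

variable [ContMDiffVectorBundle ∞ F E (𝓡 n)] [SigmaCompactSpace M] [T2Space M]

theorem gram_ext_ne_zero (p : M) :
    (gram C (fun α => (ext (frame F E p α) : Sec n F E)) p).det ≠ 0 := by
  have : gram C (fun α => (ext (frame F E p α) : Sec n F E)) p =
      (LinearMap.BilinForm.toMatrix (frame F E p)) (C.pairing p) := by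
    ext α β
    simp [gram, ext_apply, LinearMap.BilinForm.toMatrix_apply]
  rw [this]
  exact (LinearMap.BilinForm.nondegenerate_iff_det_ne_zero _).mp (C.pairing_nondegenerate p)

end Frames

section Compact

variable {n : ℕ} {M : Type*} [TopologicalSpace M] [ChartedSpace (EuclideanSpace ℝ (Fin n)) M]
  [IsManifold (𝓡 n) ∞ M] [CompactSpace M] [T2Space M]
  {F : Type*} [NormedAddCommGroup F] [NormedSpace ℝ F] [FiniteDimensional ℝ F]
  {E : M → Type*} [TopologicalSpace (TotalSpace F E)]
  [∀ p, AddCommGroup (E p)] [∀ p, Module ℝ (E p)] [∀ p, TopologicalSpace (E p)]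
  [FiberBundle F E] [VectorBundle ℝ F E] [ContMDiffVectorBundle ∞ F E (𝓡 n)]
  (C : CourantAlgebroid n F E)

/-- Finitely many smooth sections span every fibre. -/
theorem exists_spanning : ∃ (N : ℕ) (s : Fin N → Sec n F E),
    ∀ (p : M) (x : E p), (∀ i, C.pairing p x (s i p) = 0) → x = 0 := by
  classical
  let b : M → Fin (Module.finrank ℝ F) → Sec n F E := fun p α => ext (frame F E p α)
  obtain ⟨T, -, hT⟩ := (isCompact_univ (X := M)).elim_nhds_subcover
    (fun p => {q | (gram C (b p) q).det ≠ 0}) (fun p _ => gram_eventually C (gram_ext_ne_zero C p))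
  let κ := T × Fin (Module.finrank ℝ F)
  let eqv := Fintype.equivFin κ
  refine ⟨Fintype.card κ, fun i => b (eqv.symm i).1 (eqv.symm i).2, fun p x hx => ?_⟩
  obtain ⟨q, hq, hpq⟩ := mem_iUnion₂.mp (hT (mem_univ p))
  refine pairing_ext_of_gram C hpq fun α => ?_
  have := hx (eqv ⟨⟨q, hq⟩, α⟩)
  simpa using this

/-- Dual families of smooth sections with `u = ⟨u, e'_i⟩ e_i` for every `u`. -/
theorem exists_dual_frames : ∃ (N : ℕ) (e e' : Fin N → Sec n F E),
    ∀ (p : M) (x : E p), ∑ i, C.pairing p x (e' i p) • e i p = x := by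
  obtain ⟨N, s, hs⟩ := exists_spanning C
  let Φ : ∀ p, E p →ₗ[ℝ] E p := fun p =>
    ∑ i, (LinearMap.toSpanSingleton ℝ (E p) (s i p)).comp ((C.pairing p).flip (s i p))
  have hΦ : ∀ p x, Φ p x = ∑ i, C.pairing p x (s i p) • s i p := fun p x => by
    simp [Φ, LinearMap.sum_apply]
  -- The pairing may be indefinite, but `⟨x, Φ x⟩ = ∑ ⟨x, s i⟩²` is a sum of squares and vanishes
  -- only if all `⟨x, s i⟩` do.
  have hinj : ∀ p, Function.Injective (Φ p) := fun p => by
    rw [injective_iff_map_eq_zero]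
    intro x hx
    refine hs p x fun i => ?_
    have h1 := congrArg (fun y => C.pairing p x y) hx
    simp only [hΦ, map_sum, map_smul, smul_eq_mul, map_zero] at h1
    rw [Finset.sum_eq_zero_iff_of_nonneg (fun i _ => mul_self_nonneg _)] at h1
    exact mul_self_eq_zero.mp (h1 i (Finset.mem_univ i))
  have hfd : ∀ p, FiniteDimensional ℝ (E p) := fun p => Module.Finite.of_basis (frame F E p)
  have hsurj : ∀ p, Function.Surjective (Φ p) := fun p =>
    LinearMap.injective_iff_surjective.mp (hinj p)
  choose t ht using fun i p => hsurj p (s i p)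
  have hself : ∀ p x y, C.pairing p (Φ p x) y = C.pairing p x (Φ p y) := fun p x y => by
    simp only [hΦ, map_sum, map_smul, LinearMap.sum_apply, LinearMap.smul_apply, smul_eq_mul]
    refine Finset.sum_congr rfl fun i _ => ?_
    rw [C.pairing_comm p y]; ring
  let Φs : Sec n F E → Sec n F E := fun u => ∑ i,
    fsmul ⟨fun p => C.pairing p (u p) (s i p), C.pairing_smooth u (s i)⟩ (s i)
  have hΦs : ∀ u p, Φs u p = Φ p (u p) := fun u p => by
    simp only [Φs, sec_sum_apply, hΦ]; rfl
  -- Because `Φ` is self-adjoint, `⟨Φ⁻¹ s i, Φ b⟩ = ⟨s i, b⟩` is smooth, and the sections `Φ b` can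
  -- be chosen to form a frame near `p`.
  have hsm : ∀ i, ContMDiff (𝓡 n) ((𝓡 n).prod 𝓘(ℝ, F)) ∞
      (fun q => (⟨q, t i q⟩ : TotalSpace F E)) := fun i p => by
    let b : Fin (Module.finrank ℝ F) → Sec n F E := fun α =>
      ext (Classical.choose (hsurj p (frame F E p α)))
    have hb : ∀ α, Φs (b α) p = frame F E p α := fun α => by
      rw [hΦs]
      simp only [b, ext_apply]
      exact Classical.choose_spec (hsurj p (frame F E p α))
    refine contMDiffAt_section_of_gram C (b := fun α => Φs (b α)) ?_ fun α => ?_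
    · have h1 := gram_ext_ne_zero C p
      have h2 : gram C (fun α => Φs (b α)) p =
          gram C (fun α => (ext (frame F E p α) : Sec n F E)) p := by
        ext α β
        simp [gram, hb, ext_apply]
      rwa [h2]
    · have h1 : (fun q => C.pairing q (t i q) (Φs (b α) q)) =
          fun q => C.pairing q (s i q) (b α q) := by
        funext q
        rw [hΦs, ← hself, ht]
      rw [h1]
      exact C.pairing_smooth _ _ p
  refine ⟨N, s, fun i => ⟨t i, hsm i⟩, fun p x => ?_⟩
  obtain ⟨y, rfl⟩ := hsurj p x
  have h1 : ∀ i, C.pairing p (Φ p y) (t i p) = C.pairing p y (s i p) := fun i => by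
    rw [hself, ht]
  change ∑ i, C.pairing p (Φ p y) (t i p) • s i p = Φ p y
  simp only [h1]
  exact (hΦ p y).symm

end Compact

end

end CourantFlow

/-! ### Determinants and divergences in coordinates. -/

namespace CourantFlow

noncomputable section

section Calculus

variable {V W : Type*} [NormedAddCommGroup V] [NormedSpace ℝ V] [NormedAddCommGroup W]
  [NormedSpace ℝ W] {f : V → W} {x : V}

theorem _root_.ContDiffAt.hasFDerivAt_fderiv (hf : ContDiffAt ℝ 2 f x) :
    HasFDerivAt (fderiv ℝ f) (fderiv ℝ (fderiv ℝ f) x) x :=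
  ((hf.fderiv_right (m := 1) (by norm_num)).differentiableAt (by norm_num)).hasFDerivAt

theorem _root_.ContDiffAt.hasFDerivAt_self (hf : ContDiffAt ℝ 2 f x) :
    HasFDerivAt f (fderiv ℝ f x) x :=
  (hf.differentiableAt (by norm_num)).hasFDerivAt

end Calculus

section Determinant

variable {V : Type*} [NormedAddCommGroup V] [NormedSpace ℝ V] [FiniteDimensional ℝ V]

theorem differentiable_det :
    Differentiable ℝ (fun L : V →L[ℝ] V => LinearMap.det (L : V →ₗ[ℝ] V)) := by
  let b := Module.finBasis ℝ V
  have h : (fun L : V →L[ℝ] V => LinearMap.det (L : V →ₗ[ℝ] V)) = fun L =>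
      ∑ τ : Equiv.Perm _, ((τ.sign : ℤ) : ℝ) * ∏ i, LinearMap.toContinuousLinearMap (b.coord (τ i))
        (L (b i)) := by
    funext L
    rw [← LinearMap.det_toMatrix b, Matrix.det_apply]
    simp [LinearMap.toMatrix_apply, Units.smul_def]
  rw [h]
  fun_prop

theorem hasDerivAt_det_one_add_smul (H : V →ₗ[ℝ] V) :
    HasDerivAt (fun r : ℝ => LinearMap.det (1 + r • H)) (LinearMap.trace ℝ V H) 0 := by
  let b := Module.finBasis ℝ V
  let m := LinearMap.toMatrix b b H
  have h : (fun r : ℝ => LinearMap.det (1 + r • H)) = fun r =>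
      (Matrix.det (1 + (Polynomial.X : Polynomial ℝ) • m.map Polynomial.C)).eval r := by
    funext r
    rw [← LinearMap.det_toMatrix b, ← Polynomial.coe_evalRingHom, RingHom.map_det]
    congr 1
    ext i j
    simp [m, Matrix.one_apply, LinearMap.toMatrix_one, apply_ite]
    ring
  have h2 := Matrix.derivative_det_one_add_X_smul m
  rw [h, LinearMap.trace_eq_matrix_trace ℝ b, ← h2]
  exact Polynomial.hasDerivAt _ _

/-- Differentiability is known from the polynomial formula, so the derivative can be read off along
the lines `1 + r • H`. -/
theorem hasFDerivAt_det_one :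
    HasFDerivAt (fun L : V →L[ℝ] V => LinearMap.det (L : V →ₗ[ℝ] V))
      (LinearMap.toContinuousLinearMap
        ((LinearMap.trace ℝ V).comp (ContinuousLinearMap.coeLM ℝ))) 1 := by
  have h := (differentiable_det (V := V) 1).hasFDerivAt
  convert h using 1
  ext H
  have h1 : HasDerivAt (fun r : ℝ => (1 : V →L[ℝ] V) + r • H) H 0 := by
    simpa using ((hasDerivAt_id (0 : ℝ)).smul_const H).const_add 1
  have h2 := (show HasFDerivAt (fun L : V →L[ℝ] V => LinearMap.det (L : V →ₗ[ℝ] V)) _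
    ((1 : V →L[ℝ] V) + (0 : ℝ) • H) by simpa using h).comp_hasDerivAt 0 h1
  have h3 := hasDerivAt_det_one_add_smul (H : V →ₗ[ℝ] V)
  have h4 := h3.unique (h2.congr_of_eventuallyEq (Filter.Eventually.of_forall fun r => by
    simp [Function.comp]))
  simpa using h4

/-- This is Jacobi's formula at an invertible value: factoring `det (L y) = det (L x) * det (B ∘ L
y)` moves the base point to the identity. -/
theorem hasFDerivAt_det_comp {W : Type*} [NormedAddCommGroup W] [NormedSpace ℝ W]
    {L : W → V →L[ℝ] V} {L' : W →L[ℝ] V →L[ℝ] V} {x : W} (hL : HasFDerivAt L L' x)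
    {B : V →L[ℝ] V} (hB : B.comp (L x) = 1) :
    HasFDerivAt (fun y => LinearMap.det (L y : V →ₗ[ℝ] V))
      (LinearMap.det (L x : V →ₗ[ℝ] V) • (LinearMap.toContinuousLinearMap
        ((LinearMap.trace ℝ V).comp (ContinuousLinearMap.coeLM ℝ))).comp
          ((ContinuousLinearMap.compL ℝ V V V B).comp L')) x := by
  have hB' : (L x).comp B = 1 := by
    have h1 : (B : V →ₗ[ℝ] V) * (L x : V →ₗ[ℝ] V) = 1 := by
      ext v; exact congrArg (fun T : V →L[ℝ] V => T v) hB
    have h2 := mul_eq_one_comm.mp h1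
    ext v; exact congrArg (fun T : V →ₗ[ℝ] V => T v) h2
  have h1 : HasFDerivAt (fun y => B.comp (L y)) ((ContinuousLinearMap.compL ℝ V V V B).comp L') x :=
    (ContinuousLinearMap.compL ℝ V V V B).hasFDerivAt.comp x hL
  have h2 := ((show HasFDerivAt (fun L : V →L[ℝ] V => LinearMap.det (L : V →ₗ[ℝ] V)) _
    (B.comp (L x)) by rw [hB]; exact hasFDerivAt_det_one).comp x h1).const_mul
      (LinearMap.det (L x : V →ₗ[ℝ] V))
  refine h2.congr_of_eventuallyEq (Filter.Eventually.of_forall fun y => ?_)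
  have h3 : (L y : V →ₗ[ℝ] V) = (L x : V →ₗ[ℝ] V) * (B.comp (L y) : V →L[ℝ] V) := by
    ext v
    exact (congrArg (fun T : V →L[ℝ] V => T (L y v)) hB').symm
  simp only [Function.comp]
  rw [← map_mul, ← h3]

/-- The coordinate expression of the divergence of a vector field with respect to a half-density
does not depend on the coordinates. -/
theorem divergence_change {φ X Y : V → V} {s s' : V → ℝ} {x : V} (hφ : ContDiffAt ℝ 2 φ x)
    (hX : DifferentiableAt ℝ X x) (hY : DifferentiableAt ℝ Y (φ x))
    (hs : DifferentiableAt ℝ s x) (hs' : DifferentiableAt ℝ s' (φ x))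
    {B : V →L[ℝ] V} (hB : B.comp (fderiv ℝ φ x) = 1)
    (hXY : ∀ᶠ z in nhds x, Y (φ z) = fderiv ℝ φ z (X z))
    (hss : ∀ᶠ z in nhds x, s z ^ 4 = LinearMap.det (fderiv ℝ φ z : V →ₗ[ℝ] V) ^ 2 * s' (φ z) ^ 4)
    (h0 : s x ≠ 0) (h0' : s' (φ x) ≠ 0) :
    2 * fderiv ℝ s' (φ x) (Y (φ x)) / s' (φ x) +
        LinearMap.trace ℝ V (fderiv ℝ Y (φ x) : V →ₗ[ℝ] V) =
      2 * fderiv ℝ s x (X x) / s x + LinearMap.trace ℝ V (fderiv ℝ X x : V →ₗ[ℝ] V) := by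
  have hL : HasFDerivAt (fderiv ℝ φ) (fderiv ℝ (fderiv ℝ φ) x) x :=
    hφ.hasFDerivAt_fderiv
  have hsym : ∀ a b, fderiv ℝ (fderiv ℝ φ) x a b = fderiv ℝ (fderiv ℝ φ) x b a :=
    hφ.isSymmSndFDerivAt (by simp)
  have hφ1 : HasFDerivAt φ (fderiv ℝ φ x) x := hφ.hasFDerivAt_self
  generalize hL' : fderiv ℝ (fderiv ℝ φ) x = L' at hL hsym
  have hB' : (fderiv ℝ φ x).comp B = 1 := by
    have h1 : (B : V →ₗ[ℝ] V) * (fderiv ℝ φ x : V →ₗ[ℝ] V) = 1 := by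
      ext v; exact congrArg (fun T : V →L[ℝ] V => T v) hB
    have h2 := mul_eq_one_comm.mp h1
    ext v; exact congrArg (fun T : V →ₗ[ℝ] V => T v) h2
  have e1 : ∀ h, fderiv ℝ Y (φ x) (fderiv ℝ φ x h) =
      L' (X x) h + fderiv ℝ φ x (fderiv ℝ X x h) := fun h => by
    have a1 := hY.hasFDerivAt.comp x hφ1
    have a2 := hL.clm_apply hX.hasFDerivAt
    have a3 := a1.unique (a2.congr_of_eventuallyEq hXY)
    have := congrArg (fun T : V →L[ℝ] V => T h) a3
    simp only [ContinuousLinearMap.comp_apply, add_apply,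
      ContinuousLinearMap.flip_apply] at this
    rw [this, hsym h, add_comm]
  -- Up to conjugation the traces of the two Jacobians agree, and the discrepancy is the logarithmic
  -- derivative of the Jacobian determinant along `X`. The symmetry of second derivatives entered
  -- through `e1`.
  have e2 : LinearMap.trace ℝ V (fderiv ℝ Y (φ x) : V →ₗ[ℝ] V) =
      LinearMap.trace ℝ V (B.comp (L' (X x)) : V →L[ℝ] V) +
        LinearMap.trace ℝ V (fderiv ℝ X x : V →ₗ[ℝ] V) := by
    have a1 : (fderiv ℝ Y (φ x) : V →ₗ[ℝ] V) = (L' (X x) : V →ₗ[ℝ] V) * (B : V →ₗ[ℝ] V) +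
        (fderiv ℝ φ x : V →ₗ[ℝ] V) * ((fderiv ℝ X x : V →ₗ[ℝ] V) * (B : V →ₗ[ℝ] V)) := by
      ext v
      have := e1 (B v)
      have hv : fderiv ℝ φ x (B v) = v := congrArg (fun T : V →L[ℝ] V => T v) hB'
      rw [hv] at this
      exact this
    have a2 : (B : V →ₗ[ℝ] V) * (fderiv ℝ φ x : V →ₗ[ℝ] V) = 1 := by
      ext v; exact congrArg (fun T : V →L[ℝ] V => T v) hB
    rw [a1, map_add, LinearMap.trace_mul_comm, LinearMap.trace_mul_comm ℝ (fderiv ℝ φ x : V →ₗ[ℝ] V),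
      mul_assoc, a2, mul_one]
    rfl
  -- Fourth powers turn the factor `|det|^{1/2}` into the polynomial `det²`, so differentiating the
  -- transformation law needs no choice of sign.
  have e3 : 4 * s x ^ 3 * fderiv ℝ s x (X x) =
      LinearMap.det (fderiv ℝ φ x : V →ₗ[ℝ] V) ^ 2 *
        (2 * LinearMap.trace ℝ V (B.comp (L' (X x)) : V →L[ℝ] V) * s' (φ x) ^ 4 +
          4 * s' (φ x) ^ 3 * fderiv ℝ s' (φ x) (Y (φ x))) := by
    have a1 := hs.hasFDerivAt.pow 4
    have a2 := ((hasFDerivAt_det_comp hL hB).pow 2).mul ((hs'.hasFDerivAt.comp x hφ1).pow 4)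
    have a3 := a1.unique (a2.congr_of_eventuallyEq (by
      filter_upwards [hss] with z hz
      simpa using hz))
    have := congrArg (fun T : V →L[ℝ] ℝ => T (X x)) a3
    simp at this
    rw [hXY.self_of_nhds, this]
    simp
    ring
  have e4 := hss.self_of_nhds
  have hdet : LinearMap.det (fderiv ℝ φ x : V →ₗ[ℝ] V) ≠ 0 := by
    intro h
    rw [h] at e4
    simp at e4
    exact h0 e4
  rw [e2]
  have e5 : 2 * fderiv ℝ s x (X x) / s x =
      LinearMap.trace ℝ V (B.comp (L' (X x)) : V →L[ℝ] V) +
        2 * fderiv ℝ s' (φ x) (Y (φ x)) / s' (φ x) := by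
    have : 2 * fderiv ℝ s x (X x) / s x = (4 * s x ^ 3 * fderiv ℝ s x (X x)) / (2 * s x ^ 4) := by
      field_simp
      try ring
    rw [this, e3, e4]
    field_simp
    try ring
  rw [e5]
  ring

/-- The divergence of a Lie bracket, in coordinates. -/
theorem divergence_bracket {X Y Z : V → V} {l : V → ℝ} {x : V} (hX : ContDiffAt ℝ 2 X x)
    (hY : ContDiffAt ℝ 2 Y x) (hl : ContDiffAt ℝ 2 l x)
    (hZ : ∀ᶠ z in nhds x, Z z = fderiv ℝ Y z (X z) - fderiv ℝ X z (Y z)) :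
    fderiv ℝ l x (Z x) + LinearMap.trace ℝ V (fderiv ℝ Z x : V →ₗ[ℝ] V) =
      fderiv ℝ (fun z => fderiv ℝ l z (Y z) + LinearMap.trace ℝ V (fderiv ℝ Y z : V →ₗ[ℝ] V)) x
          (X x) -
        fderiv ℝ (fun z => fderiv ℝ l z (X z) + LinearMap.trace ℝ V (fderiv ℝ X z : V →ₗ[ℝ] V)) x
          (Y x) := by
  let tr : (V →L[ℝ] V) →L[ℝ] ℝ := LinearMap.toContinuousLinearMap
        ((LinearMap.trace ℝ V).comp (ContinuousLinearMap.coeLM ℝ))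
  have key : ∀ {U : V → V}, ContDiffAt ℝ 2 U x → HasFDerivAt
      (fun z => fderiv ℝ l z (U z) + LinearMap.trace ℝ V (fderiv ℝ U z : V →ₗ[ℝ] V))
      ((fderiv ℝ l x).comp (fderiv ℝ U x) + (fderiv ℝ (fderiv ℝ l) x).flip (U x) +
        tr.comp (fderiv ℝ (fderiv ℝ U) x)) x := fun hU =>
    ((hl.hasFDerivAt_fderiv).clm_apply (hU.hasFDerivAt_self)).add (tr.hasFDerivAt.comp x (hU.hasFDerivAt_fderiv))
  have hZ' : HasFDerivAt Z _ x :=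
    (((hY.hasFDerivAt_fderiv).clm_apply (hX.hasFDerivAt_self)).sub ((hX.hasFDerivAt_fderiv).clm_apply (hY.hasFDerivAt_self))).congr_of_eventuallyEq hZ
  rw [(key hY).fderiv, (key hX).fderiv, hZ'.fderiv, hZ.self_of_nhds]
  have sX : ∀ a b, fderiv ℝ (fderiv ℝ X) x a b = fderiv ℝ (fderiv ℝ X) x b a :=
    hX.isSymmSndFDerivAt (by simp)
  have sY : ∀ a b, fderiv ℝ (fderiv ℝ Y) x a b = fderiv ℝ (fderiv ℝ Y) x b a :=
    hY.isSymmSndFDerivAt (by simp)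
  have sl : ∀ a b, fderiv ℝ (fderiv ℝ l) x a b = fderiv ℝ (fderiv ℝ l) x b a :=
    hl.isSymmSndFDerivAt (by simp)
  have a1 : (((fderiv ℝ Y x).comp (fderiv ℝ X x) + (fderiv ℝ (fderiv ℝ Y) x).flip (X x) -
      ((fderiv ℝ X x).comp (fderiv ℝ Y x) + (fderiv ℝ (fderiv ℝ X) x).flip (Y x)) : V →L[ℝ] V) :
        V →ₗ[ℝ] V) = (fderiv ℝ Y x : V →ₗ[ℝ] V) * (fderiv ℝ X x : V →ₗ[ℝ] V) +
        (fderiv ℝ (fderiv ℝ Y) x (X x) : V →L[ℝ] V) -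
        ((fderiv ℝ X x : V →ₗ[ℝ] V) * (fderiv ℝ Y x : V →ₗ[ℝ] V) +
        (fderiv ℝ (fderiv ℝ X) x (Y x) : V →L[ℝ] V)) := by
    ext v
    simp [sX v, sY v]
  rw [a1]
  simp only [map_add, map_sub, LinearMap.trace_mul_comm ℝ (fderiv ℝ Y x : V →ₗ[ℝ] V),
    add_apply, ContinuousLinearMap.comp_apply, ContinuousLinearMap.flip_apply,
    sl (X x)]
  simp [tr]
  ring

end Determinant
end

end CourantFlow

/-! ### Functions and vector fields in charts. -/

namespace CourantFlow

noncomputable section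

section Charts

variable {n : ℕ} {M : Type*} [TopologicalSpace M] [ChartedSpace (EuclideanSpace ℝ (Fin n)) M]

theorem mem_chart_of_mem_target {p₀ : M} {y : EuclideanSpace ℝ (Fin n)}
    (hy : y ∈ (extChartAt (𝓡 n) p₀).target) :
    (extChartAt (𝓡 n) p₀).symm y ∈ (chartAt (EuclideanSpace ℝ (Fin n)) p₀).source := by
  have := (extChartAt (𝓡 n) p₀).map_target hy
  rwa [extChartAt_source] at this

theorem contMDiffAt_of_chart [IsManifold (𝓡 n) ∞ M] {f : M → ℝ} {p₀ : M}
    {g : EuclideanSpace ℝ (Fin n) → ℝ}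
    (hg : ContDiffAt ℝ ∞ g (extChartAt (𝓡 n) p₀ p₀))
    (h : ∀ y ∈ (extChartAt (𝓡 n) p₀).target, f ((extChartAt (𝓡 n) p₀).symm y) = g y) :
    ContMDiffAt (𝓡 n) 𝓘(ℝ, ℝ) ∞ f p₀ := by
  have h1 := hg.contMDiffAt.comp p₀ (contMDiffAt_extChartAt (I := 𝓡 n) (n := ∞))
  refine h1.congr_of_eventuallyEq ?_
  filter_upwards [(chartAt (EuclideanSpace ℝ (Fin n)) p₀).open_source.mem_nhds
    (mem_chart_source _ p₀)] with q hq
  have hq' : q ∈ (extChartAt (𝓡 n) p₀).source := by rwa [extChartAt_source]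
  have := h _ ((extChartAt (𝓡 n) p₀).map_source hq')
  rw [(extChartAt (𝓡 n) p₀).left_inv hq'] at this
  exact this

variable [IsManifold (𝓡 n) ∞ M]

theorem contDiffOn_comp_chart {f : M → ℝ} {p₀ : M}
    (hf : ContMDiffOn (𝓡 n) 𝓘(ℝ, ℝ) ∞ f (chartAt (EuclideanSpace ℝ (Fin n)) p₀).source) :
    ContDiffOn ℝ ∞ (fun y => f ((extChartAt (𝓡 n) p₀).symm y)) (extChartAt (𝓡 n) p₀).target := by
  rw [← contMDiffOn_iff_contDiffOn]
  refine hf.comp (contMDiffOn_extChartAt_symm p₀) fun y hy => ?_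
  have := (extChartAt (𝓡 n) p₀).map_target hy
  rwa [extChartAt_source] at this

theorem contDiffAt_comp_chart {f : M → ℝ} {p₀ q : M}
    (hf : ContMDiffOn (𝓡 n) 𝓘(ℝ, ℝ) ∞ f (chartAt (EuclideanSpace ℝ (Fin n)) p₀).source)
    (hq : q ∈ (chartAt (EuclideanSpace ℝ (Fin n)) p₀).source) :
    ContDiffAt ℝ ∞ (fun y => f ((extChartAt (𝓡 n) p₀).symm y)) (extChartAt (𝓡 n) p₀ q) :=
  (contDiffOn_comp_chart hf).contDiffAt ((isOpen_extChartAt_target p₀).mem_nhds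
    ((extChartAt (𝓡 n) p₀).map_source (by rwa [extChartAt_source])))

/-- The coordinate expression of the derivative of a function along a tangent vector. -/
theorem dirDeriv_eq_fderiv {f : M → ℝ} {p₀ q : M}
    (hf : ContMDiffOn (𝓡 n) 𝓘(ℝ, ℝ) ∞ f (chartAt (EuclideanSpace ℝ (Fin n)) p₀).source)
    (hq : q ∈ (chartAt (EuclideanSpace ℝ (Fin n)) p₀).source) (X : TangentSpace (𝓡 n) q) :
    dirDeriv f q X = fderiv ℝ (fun y => f ((extChartAt (𝓡 n) p₀).symm y)) (extChartAt (𝓡 n) p₀ q)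
      ((trivializationAt (EuclideanSpace ℝ (Fin n)) (TangentSpace (𝓡 n)) p₀).continuousLinearMapAt
        ℝ q X) := by
  rw [TangentBundle.continuousLinearMapAt_trivializationAt hq]
  have h1 : mfderiv (𝓡 n) 𝓘(ℝ, ℝ)
      ((fun y => f ((extChartAt (𝓡 n) p₀).symm y)) ∘ extChartAt (𝓡 n) p₀) q = _ :=
    mfderiv_comp q ((contDiffAt_comp_chart hf hq).differentiableAt (by simp)).mdifferentiableAt
      (mdifferentiableAt_extChartAt hq)
  have h2 : f =ᶠ[nhds q] (fun y => f ((extChartAt (𝓡 n) p₀).symm y)) ∘ extChartAt (𝓡 n) p₀ := by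
    filter_upwards [(chartAt (EuclideanSpace ℝ (Fin n)) p₀).open_source.mem_nhds hq] with z hz
    simp only [Function.comp]
    rw [(extChartAt (𝓡 n) p₀).left_inv (by rwa [extChartAt_source])]
  unfold dirDeriv
  rw [h2.mfderiv_eq, h1, mfderiv_eq_fderiv]
  rfl

/-- The components of a smooth vector field in a chart are smooth. -/
theorem contDiffOn_vecInChart {X : ∀ p : M, TangentSpace (𝓡 n) p}
    (hX : ContMDiff (𝓡 n) (𝓡 n).tangent ∞ (fun p => (⟨p, X p⟩ : TangentBundle (𝓡 n) M))) (p₀ : M) :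
    ContDiffOn ℝ ∞ (HalfDensity.vecInChart X p₀) (extChartAt (𝓡 n) p₀).target := by
  let t := trivializationAt (EuclideanSpace ℝ (Fin n)) (TangentSpace (𝓡 n) : M → Type _) p₀
  have hb : t.baseSet = (chartAt (EuclideanSpace ℝ (Fin n)) p₀).source :=
    TangentBundle.trivializationAt_baseSet p₀
  have h1 : ContMDiffOn (𝓡 n) 𝓘(ℝ, EuclideanSpace ℝ (Fin n)) ∞ (fun q => (t ⟨q, X q⟩).2) t.baseSet :=
    (t.contMDiffOn_section_iff t.open_baseSet subset_rfl).mp hX.contMDiffOn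
  rw [← contMDiffOn_iff_contDiffOn]
  have hm : ∀ y ∈ (extChartAt (𝓡 n) p₀).target, (extChartAt (𝓡 n) p₀).symm y ∈ t.baseSet :=
    fun y hy => by
      have := (extChartAt (𝓡 n) p₀).map_target hy
      rwa [extChartAt_source, ← hb] at this
  refine (h1.comp (contMDiffOn_extChartAt_symm p₀) hm).congr fun y hy => ?_
  exact t.continuousLinearMapAt_apply_of_mem (R := ℝ) (hm y hy) _

theorem vecInChart_extChartAt (X : ∀ p : M, TangentSpace (𝓡 n) p) {p₀ q : M}
    (hq : q ∈ (chartAt (EuclideanSpace ℝ (Fin n)) p₀).source) :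
    HalfDensity.vecInChart X p₀ (extChartAt (𝓡 n) p₀ q) =
      (trivializationAt (EuclideanSpace ℝ (Fin n)) (TangentSpace (𝓡 n)) p₀).continuousLinearMapAt
        ℝ q (X q) := by
  unfold HalfDensity.vecInChart
  rw [(extChartAt (𝓡 n) p₀).left_inv (by rwa [extChartAt_source])]

/-- The derivative of a function along a vector field, in a chart. -/
theorem dirDeriv_chart {f : M → ℝ} {p₀ : M}
    (hf : ContMDiffOn (𝓡 n) 𝓘(ℝ, ℝ) ∞ f (chartAt (EuclideanSpace ℝ (Fin n)) p₀).source)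
    (X : ∀ p : M, TangentSpace (𝓡 n) p)
    {y : EuclideanSpace ℝ (Fin n)} (hy : y ∈ (extChartAt (𝓡 n) p₀).target) :
    dirDeriv f ((extChartAt (𝓡 n) p₀).symm y) (X ((extChartAt (𝓡 n) p₀).symm y)) =
      fderiv ℝ (fun y => f ((extChartAt (𝓡 n) p₀).symm y)) y (HalfDensity.vecInChart X p₀ y) := by
  have hq := (extChartAt (𝓡 n) p₀).map_target hy
  rw [extChartAt_source] at hq
  rw [dirDeriv_eq_fderiv hf hq, (extChartAt (𝓡 n) p₀).right_inv hy]
  rfl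

theorem contMDiff_dirDeriv {f : M → ℝ} (hf : ContMDiff (𝓡 n) 𝓘(ℝ, ℝ) ∞ f)
    {X : ∀ p : M, TangentSpace (𝓡 n) p}
    (hX : ContMDiff (𝓡 n) (𝓡 n).tangent ∞ (fun p => (⟨p, X p⟩ : TangentBundle (𝓡 n) M))) :
    ContMDiff (𝓡 n) 𝓘(ℝ, ℝ) ∞ (fun p => dirDeriv f p (X p)) := fun p => by
  refine contMDiffAt_of_chart (p₀ := p) ?_ fun y hy => dirDeriv_chart hf.contMDiffOn X hy
  have ho := isOpen_extChartAt_target (I := 𝓡 n) p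
  refine ContDiffOn.contDiffAt ?_ (ho.mem_nhds (mem_extChartAt_target p))
  exact ((contDiffOn_comp_chart hf.contMDiffOn).fderiv_of_isOpen ho (by simp)).clm_apply
    (contDiffOn_vecInChart hX p)

/-- Every smooth function on a chart domain agrees near a given point with a global one. -/
theorem exists_global [T2Space M] {p : M} {f : M → ℝ}
    (hf : ContMDiffOn (𝓡 n) 𝓘(ℝ, ℝ) ∞ f (chartAt (EuclideanSpace ℝ (Fin n)) p).source) :
    ∃ g : C^∞⟮𝓡 n, M; ℝ⟯, ∀ᶠ q in nhds p, g q = f q := by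
  let b : SmoothBumpFunction (𝓡 n) p := Classical.arbitrary _
  refine ⟨⟨fun q => b q • f q, b.contMDiff_smul hf⟩, ?_⟩
  filter_upwards [b.eventuallyEq_one] with q hq
  change b q • f q = f q
  rw [hq]
  simp

end Charts

end

end CourantFlow

/-! ### The divergence defined by a half-density. -/

namespace CourantFlow

noncomputable section

namespace HalfDensity

variable {n : ℕ} {M : Type*} [TopologicalSpace M] [ChartedSpace (EuclideanSpace ℝ (Fin n)) M]
  [IsManifold (𝓡 n) ∞ M] (σ : HalfDensity n M)

theorem coeff_pos {p₀ q : M} (hq : q ∈ (chartAt (EuclideanSpace ℝ (Fin n)) p₀).source) :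
    0 < σ.coeff p₀ q := by
  refine σ.pos q _ ?_
  have h1 : LinearIndependent ℝ (fun i : Fin n => EuclideanSpace.single i (1 : ℝ)) := by
    have h0 := (EuclideanSpace.basisFun (Fin n) ℝ).toBasis.linearIndependent
    have h2 : ⇑(EuclideanSpace.basisFun (Fin n) ℝ).toBasis =
        fun i : Fin n => EuclideanSpace.single i (1 : ℝ) := by
      funext i; simp
    rwa [h2] at h0
  refine h1.map' ((trivializationAt (EuclideanSpace ℝ (Fin n)) (TangentSpace (𝓡 n) : M → Type _)
    p₀).symmL ℝ q).toLinearMap ?_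
  rw [LinearMap.ker_eq_bot]
  exact Function.LeftInverse.injective (g := (trivializationAt (EuclideanSpace ℝ (Fin n))
    (TangentSpace (𝓡 n) : M → Type _) p₀).continuousLinearMapAt ℝ q) fun v =>
      Trivialization.continuousLinearMapAt_symmL _ hq v

/-- The change of the coefficient of a half-density under a change of coordinates. -/
theorem coeff_change {p₀ p q : M} (h₀ : q ∈ (chartAt (EuclideanSpace ℝ (Fin n)) p₀).source)
    (h : q ∈ (chartAt (EuclideanSpace ℝ (Fin n)) p).source) :
    σ.coeff p₀ q ^ 4 = LinearMap.det (tangentCoordChange (𝓡 n) p₀ p q).toLinearMap ^ 2 *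
      σ.coeff p q ^ 4 := by
  have e0 := TangentBundle.symmL_trivializationAt_eq_core (I := 𝓡 n) h₀
  have e1 := TangentBundle.continuousLinearMapAt_trivializationAt_eq_core (I := 𝓡 n) h
  -- `A` carries the coordinate frame of the chart at `p` to that of the chart at `p₀`. It composes
  -- the same two maps as the coordinate change, in the opposite order, and so has the same
  -- determinant.
  let A : TangentSpace (𝓡 n) q →ₗ[ℝ] TangentSpace (𝓡 n) q :=
    ((trivializationAt (EuclideanSpace ℝ (Fin n)) (TangentSpace (𝓡 n) : M → Type _)
      p₀).symmL ℝ q).toLinearMap ∘ₗ ((trivializationAt (EuclideanSpace ℝ (Fin n))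
        (TangentSpace (𝓡 n) : M → Type _) p).continuousLinearMapAt ℝ q).toLinearMap
  have h1 : σ.coeff p₀ q = Real.sqrt |LinearMap.det A| * σ.coeff p q := by
    unfold coeff
    rw [← σ.map_det q A]
    congr 1
    funext i
    simp only [A, LinearMap.comp_apply]
    exact congrArg _ (Trivialization.continuousLinearMapAt_symmL _ h _).symm
  have h2 : LinearMap.det A = LinearMap.det (tangentCoordChange (𝓡 n) p₀ p q).toLinearMap := by
    have h3 : (tangentCoordChange (𝓡 n) p₀ p q).toLinearMap =
        (tangentCoordChange (𝓡 n) q p q).toLinearMap ∘ₗ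
        (tangentCoordChange (𝓡 n) p₀ q q).toLinearMap := by
      ext1 v
      refine (tangentCoordChange_comp ⟨⟨?_, ?_⟩, ?_⟩).symm <;> simp [h, h₀]
    have h4 : A = (tangentCoordChange (𝓡 n) p₀ q q).toLinearMap ∘ₗ
        (tangentCoordChange (𝓡 n) q p q).toLinearMap := by
      simp only [A]
      rw [e0, e1]
      rfl
    rw [h3, h4, LinearMap.det_comp]
    exact (LinearMap.det_comp _ _).trans (mul_comm _ _)
  rw [h1, ← h2, mul_pow]
  congr 1
  rw [show 4 = 2 * 2 from rfl, pow_mul, Real.sq_sqrt (abs_nonneg _), sq_abs]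

/-- The coefficient of a half-density as a function of the coordinates. -/
def chartCoeff (p₀ : M) (y : EuclideanSpace ℝ (Fin n)) : ℝ :=
  σ.coeff p₀ ((extChartAt (𝓡 n) p₀).symm y)

theorem contDiffOn_chartCoeff (p₀ : M) :
    ContDiffOn ℝ ∞ (σ.chartCoeff p₀) (extChartAt (𝓡 n) p₀).target :=
  contDiffOn_comp_chart (σ.smooth p₀)

theorem chartCoeff_pos {p₀ : M} {y : EuclideanSpace ℝ (Fin n)}
    (hy : y ∈ (extChartAt (𝓡 n) p₀).target) : 0 < σ.chartCoeff p₀ y :=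
  σ.coeff_pos (mem_chart_of_mem_target hy)

/-- The divergence may be computed in any chart. -/
theorem vdiv_chart {X : ∀ p : M, TangentSpace (𝓡 n) p}
    (hX : ContMDiff (𝓡 n) (𝓡 n).tangent ∞ (fun p => (⟨p, X p⟩ : TangentBundle (𝓡 n) M))) {p₀ : M} {y : EuclideanSpace ℝ (Fin n)}
    (hy : y ∈ (extChartAt (𝓡 n) p₀).target) :
    σ.vdiv X ((extChartAt (𝓡 n) p₀).symm y) =
      2 * fderiv ℝ (σ.chartCoeff p₀) y (vecInChart X p₀ y) / σ.chartCoeff p₀ y +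
        LinearMap.trace ℝ _ (fderiv ℝ (vecInChart X p₀) y).toLinearMap := by
  set q := (extChartAt (𝓡 n) p₀).symm y with hq
  have hq₀ : q ∈ (chartAt (EuclideanSpace ℝ (Fin n)) p₀).source := mem_chart_of_mem_target hy
  -- The value at `q` is defined in the chart centred at `q`; `φ` is the transition from the chart
  -- at `p₀` to that one.
  let φ : EuclideanSpace ℝ (Fin n) → EuclideanSpace ℝ (Fin n) :=
    extChartAt (𝓡 n) q ∘ (extChartAt (𝓡 n) p₀).symm
  let U := (extChartAt (𝓡 n) p₀).target ∩ (extChartAt (𝓡 n) p₀).symm ⁻¹'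
    (extChartAt (𝓡 n) q).source
  have hU : IsOpen U := (continuousOn_extChartAt_symm p₀).isOpen_inter_preimage
    (isOpen_extChartAt_target p₀) (isOpen_extChartAt_source q)
  have hyU : y ∈ U := ⟨hy, mem_extChartAt_source q⟩
  have hφU : ContDiffOn ℝ ∞ φ U := by
    refine (contDiffOn_ext_coord_change (I := 𝓡 n) q p₀).mono fun z hz => ?_
    rw [PartialEquiv.trans_source, PartialEquiv.symm_source]
    exact hz
  have hφ' : ∀ z ∈ U, fderiv ℝ φ z =
      tangentCoordChange (𝓡 n) p₀ q ((extChartAt (𝓡 n) p₀).symm z) := fun z hz => by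
    have := hasFDerivWithinAt_tangentCoordChange (I := 𝓡 n) (x := p₀) (y := q)
      (z := (extChartAt (𝓡 n) p₀).symm z) ⟨(extChartAt (𝓡 n) p₀).map_target hz.1, hz.2⟩
    rw [ModelWithCorners.range_eq_univ, hasFDerivWithinAt_univ,
      (extChartAt (𝓡 n) p₀).right_inv hz.1] at this
    exact this.fderiv
  have hφy : φ y = extChartAt (𝓡 n) q q := rfl
  have hqt : φ y ∈ (extChartAt (𝓡 n) q).target := mem_extChartAt_target q
  have hnt : ∀ {r : M} {z}, z ∈ (extChartAt (𝓡 n) r).target →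
      (extChartAt (𝓡 n) r).target ∈ nhds z := fun hz => (isOpen_extChartAt_target _).mem_nhds hz
  have key := divergence_change (φ := φ) (X := vecInChart X p₀) (Y := vecInChart X q)
    (s := σ.chartCoeff p₀) (s' := σ.chartCoeff q) (x := y)
    (B := tangentCoordChange (𝓡 n) q p₀ q)
    ((hφU.contDiffAt (hU.mem_nhds hyU)).of_le (by norm_cast))
    (((contDiffOn_vecInChart hX p₀).contDiffAt (hnt hy)).differentiableAt (by simp))
    (((contDiffOn_vecInChart hX q).contDiffAt (hnt hqt)).differentiableAt (by simp))
    (((σ.contDiffOn_chartCoeff p₀).contDiffAt (hnt hy)).differentiableAt (by simp))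
    (((σ.contDiffOn_chartCoeff q).contDiffAt (hnt hqt)).differentiableAt (by simp))
    (by
      rw [hφ' y hyU]
      ext1 v
      refine (tangentCoordChange_comp ⟨⟨?_, ?_⟩, ?_⟩).trans (tangentCoordChange_self ?_) <;>
        simp [hq₀])
    (by
      filter_upwards [hU.mem_nhds hyU] with z hz
      rw [hφ' z hz]
      have h1 : (extChartAt (𝓡 n) p₀).symm z ∈ (chartAt (EuclideanSpace ℝ (Fin n)) q).source := by
        have := hz.2
        rwa [mem_preimage, extChartAt_source] at this
      have h2 := mem_chart_of_mem_target hz.1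
      change vecInChart X q (extChartAt (𝓡 n) q ((extChartAt (𝓡 n) p₀).symm z)) = _
      rw [vecInChart_extChartAt X h1]
      unfold vecInChart
      rw [TangentBundle.continuousLinearMapAt_trivializationAt_eq_core (I := 𝓡 n) h1,
        TangentBundle.continuousLinearMapAt_trivializationAt_eq_core (I := 𝓡 n) h2]
      refine (tangentCoordChange_comp ⟨⟨?_, ?_⟩, ?_⟩).symm <;> rw [extChartAt_source]
      exacts [mem_chart_source _ _, h2, h1])
    (by
      filter_upwards [hU.mem_nhds hyU] with z hz
      rw [hφ' z hz]
      have h1 : (extChartAt (𝓡 n) p₀).symm z ∈ (chartAt (EuclideanSpace ℝ (Fin n)) q).source := by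
        have := hz.2
        rwa [mem_preimage, extChartAt_source] at this
      have h2 := mem_chart_of_mem_target hz.1
      have h3 := σ.coeff_change h2 h1
      have h4 : (extChartAt (𝓡 n) q).symm (φ z) = (extChartAt (𝓡 n) p₀).symm z :=
        (extChartAt (𝓡 n) q).left_inv hz.2
      unfold chartCoeff
      rw [h4, h3])
    (σ.chartCoeff_pos hy).ne' (σ.chartCoeff_pos hqt).ne'
  rw [← key]
  have h5 : σ.chartCoeff q (φ y) = σ.coeff q q := by
    unfold chartCoeff
    rw [hφy, (extChartAt (𝓡 n) q).left_inv (mem_extChartAt_source q)]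
  have h6 : σ.coeff q q ≠ 0 := (σ.coeff_pos (mem_chart_source _ q)).ne'
  unfold vdiv lieCoeff
  rw [h5, ← hφy]
  change 2 * (fderiv ℝ (σ.chartCoeff q) (φ y) _ + _) / _ = _
  field_simp

theorem contDiffOn_vdiv {X : ∀ p : M, TangentSpace (𝓡 n) p}
    (hX : ContMDiff (𝓡 n) (𝓡 n).tangent ∞ (fun p => (⟨p, X p⟩ : TangentBundle (𝓡 n) M))) (p₀ : M) :
    ContDiffOn ℝ ∞ (fun y => 2 * fderiv ℝ (σ.chartCoeff p₀) y (vecInChart X p₀ y) /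
        σ.chartCoeff p₀ y + LinearMap.trace ℝ _ (fderiv ℝ (vecInChart X p₀) y).toLinearMap)
      (extChartAt (𝓡 n) p₀).target := by
  have ho := isOpen_extChartAt_target (I := 𝓡 n) p₀
  have hs := σ.contDiffOn_chartCoeff p₀
  have hv := contDiffOn_vecInChart hX p₀
  refine ContDiffOn.add ?_ ?_
  · exact (contDiffOn_const.mul ((hs.fderiv_of_isOpen ho (by simp)).clm_apply hv)).div hs
      fun y hy => (σ.chartCoeff_pos hy).ne'
  · exact (LinearMap.toContinuousLinearMap ((LinearMap.trace ℝ (EuclideanSpace ℝ (Fin n))).comp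
      (ContinuousLinearMap.coeLM ℝ))).contDiff.comp_contDiffOn (hv.fderiv_of_isOpen ho (by simp))

theorem contMDiff_vdiv {X : ∀ p : M, TangentSpace (𝓡 n) p}
    (hX : ContMDiff (𝓡 n) (𝓡 n).tangent ∞ (fun p => (⟨p, X p⟩ : TangentBundle (𝓡 n) M))) :
    ContMDiff (𝓡 n) 𝓘(ℝ, ℝ) ∞ (σ.vdiv X) := fun p =>
  contMDiffAt_of_chart (p₀ := p) ((σ.contDiffOn_vdiv hX p).contDiffAt
    ((isOpen_extChartAt_target (I := 𝓡 n) p).mem_nhds (mem_extChartAt_target p)))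
    fun _ hy => σ.vdiv_chart hX hy

theorem vdiv_self {X : ∀ p : M, TangentSpace (𝓡 n) p}
    (hX : ContMDiff (𝓡 n) (𝓡 n).tangent ∞ (fun p => (⟨p, X p⟩ : TangentBundle (𝓡 n) M))) (p : M) :
    σ.vdiv X p = 2 * fderiv ℝ (σ.chartCoeff p) (extChartAt (𝓡 n) p p)
        (vecInChart X p (extChartAt (𝓡 n) p p)) / σ.chartCoeff p (extChartAt (𝓡 n) p p) +
      LinearMap.trace ℝ _ (fderiv ℝ (vecInChart X p) (extChartAt (𝓡 n) p p)).toLinearMap := by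
  have := σ.vdiv_chart hX (mem_extChartAt_target p)
  rwa [(extChartAt (𝓡 n) p).left_inv (mem_extChartAt_source p)] at this

variable {X Y Z : ∀ p : M, TangentSpace (𝓡 n) p}

theorem vdiv_add (hX : ContMDiff (𝓡 n) (𝓡 n).tangent ∞ (fun p => (⟨p, X p⟩ : TangentBundle (𝓡 n) M)))
    (hY : ContMDiff (𝓡 n) (𝓡 n).tangent ∞ (fun p => (⟨p, Y p⟩ : TangentBundle (𝓡 n) M)))
    (hZ : ContMDiff (𝓡 n) (𝓡 n).tangent ∞ (fun p => (⟨p, Z p⟩ : TangentBundle (𝓡 n) M)))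
    (h : ∀ p, Z p = X p + Y p) (p : M) : σ.vdiv Z p = σ.vdiv X p + σ.vdiv Y p := by
  rw [σ.vdiv_self hX, σ.vdiv_self hY, σ.vdiv_self hZ]
  have hd : ∀ {W : ∀ p : M, TangentSpace (𝓡 n) p},
      ContMDiff (𝓡 n) (𝓡 n).tangent ∞ (fun p => (⟨p, W p⟩ : TangentBundle (𝓡 n) M)) →
      DifferentiableAt ℝ (vecInChart W p) (extChartAt (𝓡 n) p p) := fun hW =>
    ((contDiffOn_vecInChart hW p).contDiffAt ((isOpen_extChartAt_target (I := 𝓡 n) p).mem_nhds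
      (mem_extChartAt_target p))).differentiableAt (by simp)
  have e : vecInChart Z p = vecInChart X p + vecInChart Y p := by
    funext y
    simp only [vecInChart, h, map_add, Pi.add_apply]
  rw [e, fderiv_add (hd hX) (hd hY)]
  simp only [Pi.add_apply, map_add, ContinuousLinearMap.toLinearMap_add]
  ring

theorem vdiv_smul (hX : ContMDiff (𝓡 n) (𝓡 n).tangent ∞ (fun p => (⟨p, X p⟩ : TangentBundle (𝓡 n) M)))
    (hZ : ContMDiff (𝓡 n) (𝓡 n).tangent ∞ (fun p => (⟨p, Z p⟩ : TangentBundle (𝓡 n) M)))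
    {f : M → ℝ} (hf : ContMDiff (𝓡 n) 𝓘(ℝ, ℝ) ∞ f)
    (h : ∀ p, Z p = f p • X p) (p : M) : σ.vdiv Z p = f p * σ.vdiv X p + dirDeriv f p (X p) := by
  rw [σ.vdiv_self hX, σ.vdiv_self hZ]
  have hp := (extChartAt (𝓡 n) p).left_inv (mem_extChartAt_source p)
  have hd : DifferentiableAt ℝ (vecInChart X p) (extChartAt (𝓡 n) p p) :=
    ((contDiffOn_vecInChart hX p).contDiffAt ((isOpen_extChartAt_target (I := 𝓡 n) p).mem_nhds
      (mem_extChartAt_target p))).differentiableAt (by simp)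
  have hfd : DifferentiableAt ℝ (fun y => f ((extChartAt (𝓡 n) p).symm y))
      (extChartAt (𝓡 n) p p) :=
    (contDiffAt_comp_chart hf.contMDiffOn (mem_chart_source _ p)).differentiableAt (by simp)
  have e : vecInChart Z p = fun y => f ((extChartAt (𝓡 n) p).symm y) • vecInChart X p y := by
    funext y
    simp only [vecInChart, h, map_smul]
  have e2 := dirDeriv_chart (hf.contMDiffOn (s := (chartAt (EuclideanSpace ℝ (Fin n)) p).source))
    X (mem_extChartAt_target p)
  rw [hp] at e2
  rw [e, (hfd.hasFDerivAt.fun_smul hd.hasFDerivAt).fderiv, e2, hp]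
  simp only [ContinuousLinearMap.toLinearMap_add, map_add, map_smul,
    ContinuousLinearMap.toLinearMap_smul, smul_eq_mul]
  have e3 := LinearMap.trace_smulRight
    (fderiv ℝ (fun y => f ((extChartAt (𝓡 n) p).symm y)) (extChartAt (𝓡 n) p p)).toLinearMap
    (vecInChart X p (extChartAt (𝓡 n) p p))
  change _ + (_ + LinearMap.trace ℝ _ (LinearMap.smulRight _ _)) = _
  rw [e3]
  simp only [ContinuousLinearMap.coe_coe, hp]
  ring

/-- Rescaling the half-density changes the divergence by a derivative. -/
theorem vdiv_rescale (hX : ContMDiff (𝓡 n) (𝓡 n).tangent ∞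
      (fun p => (⟨p, X p⟩ : TangentBundle (𝓡 n) M)))
    {σ' : HalfDensity n M} {φ : M → ℝ} (hφ : ContMDiff (𝓡 n) 𝓘(ℝ, ℝ) ∞ φ) {p : M}
    (h : ∀ q ∈ (chartAt (EuclideanSpace ℝ (Fin n)) p).source,
      σ'.coeff p q = Real.exp (φ q) * σ.coeff p q) :
    σ'.vdiv X p = σ.vdiv X p + 2 * dirDeriv φ p (X p) := by
  rw [σ.vdiv_self hX, σ'.vdiv_self hX]
  have hp := (extChartAt (𝓡 n) p).left_inv (mem_extChartAt_source p)
  have hn := (isOpen_extChartAt_target (I := 𝓡 n) p).mem_nhds (mem_extChartAt_target p)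
  have hs := ((σ.contDiffOn_chartCoeff p).contDiffAt hn).differentiableAt (by simp)
  have hfd : DifferentiableAt ℝ (fun y => φ ((extChartAt (𝓡 n) p).symm y))
      (extChartAt (𝓡 n) p p) :=
    (contDiffAt_comp_chart hφ.contMDiffOn (mem_chart_source _ p)).differentiableAt (by simp)
  have e2 := dirDeriv_chart (hφ.contMDiffOn (s := (chartAt (EuclideanSpace ℝ (Fin n)) p).source))
    X (mem_extChartAt_target p)
  rw [hp] at e2
  have e : σ'.chartCoeff p =ᶠ[nhds (extChartAt (𝓡 n) p p)]
      fun y => Real.exp (φ ((extChartAt (𝓡 n) p).symm y)) * σ.chartCoeff p y := by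
    filter_upwards [hn] with y hy
    exact h _ (mem_chart_of_mem_target hy)
  have h0 := (σ.chartCoeff_pos (mem_extChartAt_target p)).ne'
  rw [e.fderiv_eq, (hfd.hasFDerivAt.exp.fun_mul hs.hasFDerivAt).fderiv, e.self_of_nhds, e2]
  simp only [add_apply, smul_apply, smul_eq_mul]
  field_simp
  ring

/-- The divergence is a cocycle on vector fields; the hypothesis says that `Z = [X, Y]`. -/
theorem vdiv_bracket [T2Space M]
    (hX : ContMDiff (𝓡 n) (𝓡 n).tangent ∞ (fun p => (⟨p, X p⟩ : TangentBundle (𝓡 n) M)))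
    (hY : ContMDiff (𝓡 n) (𝓡 n).tangent ∞ (fun p => (⟨p, Y p⟩ : TangentBundle (𝓡 n) M)))
    (hZ : ContMDiff (𝓡 n) (𝓡 n).tangent ∞ (fun p => (⟨p, Z p⟩ : TangentBundle (𝓡 n) M)))
    (h : ∀ (f : C^∞⟮𝓡 n, M; ℝ⟯) (q : M), dirDeriv f q (Z q) =
      dirDeriv (fun r => dirDeriv f r (Y r)) q (X q) -
        dirDeriv (fun r => dirDeriv f r (X r)) q (Y q)) (p : M) :
    σ.vdiv Z p = dirDeriv (σ.vdiv Y) p (X p) - dirDeriv (σ.vdiv X) p (Y p) := by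
  set x := extChartAt (𝓡 n) p p with hx
  have ho := isOpen_extChartAt_target (I := 𝓡 n) p
  have hn : (extChartAt (𝓡 n) p).target ∈ nhds x := ho.mem_nhds (mem_extChartAt_target p)
  have hp : (extChartAt (𝓡 n) p).symm x = p :=
    (extChartAt (𝓡 n) p).left_inv (mem_extChartAt_source p)
  have hvX := contDiffOn_vecInChart hX p
  have hvY := contDiffOn_vecInChart hY p
  have hs := σ.contDiffOn_chartCoeff p
  have hlie : ∀ᶠ z in nhds x, vecInChart Z p z = fderiv ℝ (vecInChart Y p) z (vecInChart X p z) -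
      fderiv ℝ (vecInChart X p) z (vecInChart Y p z) := by
    -- The hypothesis concerns global functions, so it is tested on coordinate functions cut off
    -- outside a neighbourhood of `p`.
    have hi : ∀ i : Fin n, ∀ᶠ z in nhds x, vecInChart Z p z i =
        (fderiv ℝ (vecInChart Y p) z (vecInChart X p z) -
          fderiv ℝ (vecInChart X p) z (vecInChart Y p z)) i := fun i => by
      have hc : ContMDiffOn (𝓡 n) 𝓘(ℝ, ℝ) ∞ (fun q => extChartAt (𝓡 n) p q i)
          (chartAt (EuclideanSpace ℝ (Fin n)) p).source :=
        (EuclideanSpace.proj (𝕜 := ℝ) i).contMDiff.comp_contMDiffOn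
          (contMDiffOn_extChartAt (I := 𝓡 n) (n := ∞))
      obtain ⟨g, hg⟩ := exists_global hc
      have hcont : ContinuousAt (extChartAt (𝓡 n) p).symm x :=
        (continuousOn_extChartAt_symm p).continuousAt hn
      have hg' : ∀ᶠ z in nhds x, z ∈ (extChartAt (𝓡 n) p).target ∧
          g ((extChartAt (𝓡 n) p).symm z) = z i := by
        have h1 := hcont.eventually (p := fun q => g q = extChartAt (𝓡 n) p q i) (by rwa [hp])
        filter_upwards [h1, hn] with z hz1 hz2
        exact ⟨hz2, by rw [hz1, (extChartAt (𝓡 n) p).right_inv hz2]⟩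
      have hgs : ContMDiffOn (𝓡 n) 𝓘(ℝ, ℝ) ∞ g (chartAt (EuclideanSpace ℝ (Fin n)) p).source :=
        g.contMDiff.contMDiffOn
      have hg1 : ∀ᶠ z in nhds x, ∀ W : ∀ p : M, TangentSpace (𝓡 n) p,
          dirDeriv g ((extChartAt (𝓡 n) p).symm z) (W ((extChartAt (𝓡 n) p).symm z)) =
            vecInChart W p z i := by
        filter_upwards [hg'.eventually_nhds] with z hz W
        rw [dirDeriv_chart hgs W hz.self_of_nhds.1]
        have h2 : (fun y => g ((extChartAt (𝓡 n) p).symm y)) =ᶠ[nhds z]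
            EuclideanSpace.proj (𝕜 := ℝ) i := by
          filter_upwards [hz] with w hw
          exact hw.2
        rw [h2.fderiv_eq, ContinuousLinearMap.fderiv]
        rfl
      have hd : ∀ {W : ∀ p : M, TangentSpace (𝓡 n) p},
          ContMDiff (𝓡 n) (𝓡 n).tangent ∞ (fun p => (⟨p, W p⟩ : TangentBundle (𝓡 n) M)) →
          ∀ z ∈ (extChartAt (𝓡 n) p).target, DifferentiableAt ℝ (vecInChart W p) z :=
        fun hW z hz => ((contDiffOn_vecInChart hW p).contDiffAt (ho.mem_nhds hz)).differentiableAt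
          (by simp)
      have hg2 : ∀ {W W' : ∀ p : M, TangentSpace (𝓡 n) p},
          ContMDiff (𝓡 n) (𝓡 n).tangent ∞ (fun p => (⟨p, W p⟩ : TangentBundle (𝓡 n) M)) →
          ∀ᶠ z in nhds x,
          dirDeriv (fun r => dirDeriv g r (W r)) ((extChartAt (𝓡 n) p).symm z)
            (W' ((extChartAt (𝓡 n) p).symm z)) =
              fderiv ℝ (vecInChart W p) z (vecInChart W' p z) i := by
        intro W W' hW
        filter_upwards [hg1.eventually_nhds, hn] with z hz hzt
        rw [dirDeriv_chart (contMDiff_dirDeriv g.contMDiff hW).contMDiffOn W' hzt]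
        have h2 : (fun y => dirDeriv g ((extChartAt (𝓡 n) p).symm y)
            (W ((extChartAt (𝓡 n) p).symm y))) =ᶠ[nhds z]
            fun y => EuclideanSpace.proj (𝕜 := ℝ) i (vecInChart W p y) := by
          filter_upwards [hz] with w hw
          exact hw W
        rw [h2.fderiv_eq]
        have h3 := (EuclideanSpace.proj (𝕜 := ℝ) i).hasFDerivAt.comp z (hd hW z hzt).hasFDerivAt
        exact congrArg (fun T : EuclideanSpace ℝ (Fin n) →L[ℝ] ℝ => T (vecInChart W' p z)) h3.fderiv
      filter_upwards [hg1, hg2 (W' := X) hY, hg2 (W' := Y) hX] with z h1 h2 h3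
      rw [← h1, h, h2, h3]
      rfl
    filter_upwards [Filter.eventually_all.mpr hi] with z hz
    ext i
    exact hz i
  -- Twice the logarithm of the coefficient turns `2 (X s) / s` into a derivative of `l`, the form
  -- used by `divergence_bracket`.
  let l : EuclideanSpace ℝ (Fin n) → ℝ := fun y => 2 * Real.log (σ.chartCoeff p y)
  have hl : ContDiffOn ℝ ∞ l (extChartAt (𝓡 n) p).target :=
    contDiffOn_const.mul (hs.log fun y hy => (σ.chartCoeff_pos hy).ne')
  have hl' : ∀ y ∈ (extChartAt (𝓡 n) p).target, ∀ v,
      fderiv ℝ l y v = 2 * fderiv ℝ (σ.chartCoeff p) y v / σ.chartCoeff p y := fun y hy v => by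
    have h1 := ((hs.contDiffAt (ho.mem_nhds hy)).differentiableAt (by simp)).hasFDerivAt
    rw [((h1.log (σ.chartCoeff_pos hy).ne').const_mul 2).fderiv]
    simp only [smul_apply, smul_eq_mul]
    ring
  have h2 : (2 : ℕ∞ω) ≤ ∞ := by norm_cast
  have key := divergence_bracket ((hvX.contDiffAt hn).of_le h2) ((hvY.contDiffAt hn).of_le h2)
    ((hl.contDiffAt hn).of_le h2) hlie
  have hdiv : ∀ {W W' : ∀ p : M, TangentSpace (𝓡 n) p},
      ContMDiff (𝓡 n) (𝓡 n).tangent ∞ (fun p => (⟨p, W p⟩ : TangentBundle (𝓡 n) M)) →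
      fderiv ℝ (fun z => fderiv ℝ l z (vecInChart W p z) +
        LinearMap.trace ℝ _ (fderiv ℝ (vecInChart W p) z).toLinearMap) x (vecInChart W' p x) =
          dirDeriv (σ.vdiv W) p (W' p) := by
    intro W W' hW
    have h3 := dirDeriv_chart ((σ.contMDiff_vdiv hW).contMDiffOn
      (s := (chartAt (EuclideanSpace ℝ (Fin n)) p).source)) W' (mem_extChartAt_target p)
    rw [← hx, hp] at h3
    rw [h3]
    congr 1
    refine Filter.EventuallyEq.fderiv_eq ?_
    filter_upwards [hn] with z hz
    rw [σ.vdiv_chart hW hz, hl' z hz]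
  rw [hdiv hY, hdiv hX] at key
  rw [σ.vdiv_self hZ, ← key, ← hx, hl' x (mem_extChartAt_target p)]

end HalfDensity

end

end CourantFlow

/-! ### From the Courant algebroid to its module of sections. -/

namespace CourantFlow

noncomputable section

namespace CourantModule

variable {A Γ ι : Type*} [CommRing A] [Algebra ℝ A] [AddCommGroup Γ] [Module ℝ Γ]
    [Module A Γ] [IsScalarTower ℝ A Γ] [Fintype ι] (Q : CourantModule A Γ ι)

/-- The gradient of a scalar, for which `⟨𝒟 f, u⟩ = ρ(u) f`. -/
def grad (f : A) : Γ := ∑ i, Q.anchor (Q.e i) f • Q.e' i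

theorem pair_grad (f : A) (u : Γ) : Q.pair (Q.grad f) u = Q.anchor u f := by
  rw [← Q.tr_pair_mul' (f := fun x => Q.anchor x f) ⟨by simp, by simp⟩ u]
  simp only [grad, map_sum, map_smul, LinearMap.sum_apply, LinearMap.smul_apply, smul_eq_mul, tr]
  refine Finset.sum_congr rfl fun i _ => ?_
  rw [Q.pair_comm, mul_comm]

theorem grad_mul (f g : A) : Q.grad (f * g) = f • Q.grad g + g • Q.grad f :=
  Q.pair_ext fun w => by simp [pair_grad]

theorem grad_pair (u v : Γ) : Q.grad (Q.pair u v) = Q.bracket u v + Q.bracket v u :=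
  Q.pair_ext fun w => by rw [pair_grad, Q.bracket_symm]

variable {Q} in
theorem Conn.tr_dcov_anchor (D : Q.Conn) (f : A) :
    Q.tr (Q.dcov D (fun v => Q.anchor v f)) = Q.div D (Q.grad f) := by
  have h : (fun v => Q.anchor v f) = fun v => Q.pair (Q.grad f) v := by
    funext v; rw [pair_grad]
  rw [h]
  exact Q.tr_congr fun x y => D.dcov_pair _ _ _

variable {Q} in
/-- If the divergence is a cocycle then gradients are divergence free wherever the pairing does
not vanish. -/
theorem Conn.pair_mul_div_grad (D : Q.Conn) (h : ∀ u v, Q.div D (Q.bracket u v) =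
      Q.anchor u (Q.div D v) - Q.anchor v (Q.div D u)) (u v : Γ) (f : A) :
    Q.pair u v * Q.div D (Q.grad f) = 0 := by
  have h1 : ∀ u v, Q.div D (Q.grad (Q.pair u v)) = 0 := fun u v => by
    rw [grad_pair, D.div_add, h, h]; ring
  have h2 : Q.anchor (Q.grad (Q.pair u v)) f = 0 := by
    rw [grad_pair, map_add, Derivation.add_apply, Q.anchor_bracket, Q.anchor_bracket]; ring
  have h3 : Q.anchor (Q.grad f) (Q.pair u v) = 0 := by
    rw [← Q.pair_grad, Q.pair_comm, Q.pair_grad, h2]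
  -- Expanding `div grad (f ⟨u, v⟩) = 0` leaves `⟨u, v⟩ div grad f`, since the anchor annihilates
  -- gradients of pairings.
  have h4 := h1 (f • u) v
  rw [map_smul, LinearMap.smul_apply, smul_eq_mul, grad_mul, D.div_add, D.div_smul, D.div_smul,
    h1, h2, h3] at h4
  linear_combination h4

end CourantModule

section DirDeriv

variable {n : ℕ} {M : Type*} [TopologicalSpace M] [ChartedSpace (EuclideanSpace ℝ (Fin n)) M]
  [IsManifold (𝓡 n) ∞ M]

theorem dirDeriv_add {f g : M → ℝ} (hf : ContMDiff (𝓡 n) 𝓘(ℝ, ℝ) ∞ f)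
    (hg : ContMDiff (𝓡 n) 𝓘(ℝ, ℝ) ∞ g) (p : M) (X : TangentSpace (𝓡 n) p) :
    dirDeriv (fun q => f q + g q) p X = dirDeriv f p X + dirDeriv g p X := by
  have hp := mem_chart_source (EuclideanSpace ℝ (Fin n)) p
  rw [show (fun q => f q + g q) = f + g from rfl,
    dirDeriv_eq_fderiv (hf.add hg).contMDiffOn hp, dirDeriv_eq_fderiv hf.contMDiffOn hp,
    dirDeriv_eq_fderiv hg.contMDiffOn hp]
  have h1 := ((contDiffAt_comp_chart hf.contMDiffOn hp).differentiableAt (by simp)).hasFDerivAt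
  have h2 := ((contDiffAt_comp_chart hg.contMDiffOn hp).differentiableAt (by simp)).hasFDerivAt
  exact DFunLike.congr_fun (h1.add h2).fderiv _

theorem dirDeriv_mul {f g : M → ℝ} (hf : ContMDiff (𝓡 n) 𝓘(ℝ, ℝ) ∞ f)
    (hg : ContMDiff (𝓡 n) 𝓘(ℝ, ℝ) ∞ g) (p : M) (X : TangentSpace (𝓡 n) p) :
    dirDeriv (fun q => f q * g q) p X = f p * dirDeriv g p X + g p * dirDeriv f p X := by
  have hp := mem_chart_source (EuclideanSpace ℝ (Fin n)) p
  rw [show (fun q => f q * g q) = f * g from rfl,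
    dirDeriv_eq_fderiv (hf.mul hg).contMDiffOn hp, dirDeriv_eq_fderiv hf.contMDiffOn hp,
    dirDeriv_eq_fderiv hg.contMDiffOn hp]
  have h1 := ((contDiffAt_comp_chart hf.contMDiffOn hp).differentiableAt (by simp)).hasFDerivAt
  have h2 := ((contDiffAt_comp_chart hg.contMDiffOn hp).differentiableAt (by simp)).hasFDerivAt
  refine (DFunLike.congr_fun (h1.mul h2).fderiv _).trans ?_
  simp only [add_apply, smul_apply, smul_eq_mul,
    (extChartAt (𝓡 n) p).left_inv (mem_extChartAt_source p)]

theorem dirDeriv_const (c : ℝ) (p : M) (X : TangentSpace (𝓡 n) p) :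
    dirDeriv (fun _ => c) p X = 0 := by
  rw [dirDeriv, mfderiv_const]
  rfl

end DirDeriv

section Courant

variable {n : ℕ} {M : Type*} [TopologicalSpace M] [ChartedSpace (EuclideanSpace ℝ (Fin n)) M]
  [IsManifold (𝓡 n) ∞ M]
  {F : Type*} [NormedAddCommGroup F] [NormedSpace ℝ F]
  {E : M → Type*} [TopologicalSpace (TotalSpace F E)]
  [∀ p, AddCommGroup (E p)] [∀ p, Module ℝ (E p)] [∀ p, TopologicalSpace (E p)]
  [FiberBundle F E] [VectorBundle ℝ F E]
  (C : CourantAlgebroid n F E)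

namespace CourantAlgebroid

/-- The pairing of sections. -/
def pairSec : Sec n F E →ₗ[C^∞⟮𝓡 n, M; ℝ⟯] Sec n F E →ₗ[C^∞⟮𝓡 n, M; ℝ⟯] C^∞⟮𝓡 n, M; ℝ⟯ :=
  LinearMap.mk₂ _ (fun u v => ⟨fun p => C.pairing p (u p) (v p), C.pairing_smooth u v⟩)
    (fun u u' v => ContMDiffMap.ext fun p => by
      change C.pairing p (u p + u' p) (v p) = C.pairing p (u p) (v p) + C.pairing p (u' p) (v p)
      simp)
    (fun f u v => ContMDiffMap.ext fun p => by
      change C.pairing p (f p • u p) (v p) = f p * C.pairing p (u p) (v p)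
      simp)
    (fun u v v' => ContMDiffMap.ext fun p => by
      change C.pairing p (u p) (v p + v' p) = C.pairing p (u p) (v p) + C.pairing p (u p) (v' p)
      simp)
    (fun f u v => ContMDiffMap.ext fun p => by
      change C.pairing p (u p) (f p • v p) = f p * C.pairing p (u p) (v p)
      simp)

@[simp] theorem pairSec_apply (u v : Sec n F E) (p : M) :
    C.pairSec u v p = C.pairing p (u p) (v p) := rfl

/-- The anchor as a derivation of the algebra of smooth functions. -/
def anchorSec : Sec n F E →ₗ[C^∞⟮𝓡 n, M; ℝ⟯] Derivation ℝ C^∞⟮𝓡 n, M; ℝ⟯ C^∞⟮𝓡 n, M; ℝ⟯ where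
  toFun u := Derivation.mk'
    { toFun := fun f => ⟨fun p => dirDeriv f p (C.anchor p (u p)),
        contMDiff_dirDeriv f.contMDiff (C.anchor_smooth u)⟩
      map_add' := fun f g => ContMDiffMap.ext fun p => dirDeriv_add f.contMDiff g.contMDiff p _
      map_smul' := fun c f => ContMDiffMap.ext fun p => by
        have := dirDeriv_mul (n := n) (contMDiff_const (c := c)) f.contMDiff p (C.anchor p (u p))
        rw [dirDeriv_const, mul_zero, add_zero] at this
        exact this }
    (fun f g => ContMDiffMap.ext fun p => dirDeriv_mul f.contMDiff g.contMDiff p _)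
  map_add' u v := Derivation.ext fun f => ContMDiffMap.ext fun p => by
    change dirDeriv f p (C.anchor p (u p + v p)) = _
    rw [map_add]
    exact map_add (mfderiv (𝓡 n) 𝓘(ℝ, ℝ) f p) _ _
  map_smul' g u := Derivation.ext fun f => ContMDiffMap.ext fun p => by
    change dirDeriv f p (C.anchor p (g p • u p)) = _
    rw [map_smul]
    exact map_smul (mfderiv (𝓡 n) 𝓘(ℝ, ℝ) f p) _ _

@[simp] theorem anchorSec_apply (u : Sec n F E) (f : C^∞⟮𝓡 n, M; ℝ⟯) (p : M) :
    C.anchorSec u f p = dirDeriv f p (C.anchor p (u p)) := rfl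

theorem anchorSec_eq_zero {u : Sec n F E} {p : M} (h : u p = 0) (f : C^∞⟮𝓡 n, M; ℝ⟯) :
    C.anchorSec u f p = 0 := by
  rw [anchorSec_apply, h, map_zero]
  exact map_zero (mfderiv (𝓡 n) 𝓘(ℝ, ℝ) f p)

theorem bracket_smul (u v : Sec n F E) (f : C^∞⟮𝓡 n, M; ℝ⟯) :
    C.bracket u (f • v) = f • C.bracket u v + C.anchorSec u f • v :=
  ContMDiffSection.ext fun p => C.leibniz u v f p

/-- The divergence of sections with respect to a half-density. -/
def divSec (σ : HalfDensity n M) (u : Sec n F E) : C^∞⟮𝓡 n, M; ℝ⟯ :=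
  ⟨divSigma C σ u, σ.contMDiff_vdiv (C.anchor_smooth u)⟩

theorem divSec_add (σ : HalfDensity n M) (u v : Sec n F E) :
    C.divSec σ (u + v) = C.divSec σ u + C.divSec σ v :=
  ContMDiffMap.ext fun p => σ.vdiv_add (C.anchor_smooth u) (C.anchor_smooth v)
    (C.anchor_smooth (u + v)) (fun q => map_add (C.anchor q) (u q) (v q)) p

theorem divSec_smul (σ : HalfDensity n M) (f : C^∞⟮𝓡 n, M; ℝ⟯) (u : Sec n F E) :
    C.divSec σ (f • u) = f * C.divSec σ u + C.anchorSec u f :=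
  ContMDiffMap.ext fun p => σ.vdiv_smul (C.anchor_smooth u) (C.anchor_smooth (f • u))
    f.contMDiff (fun q => map_smul (C.anchor q) (f q) (u q)) p

variable [ContMDiffVectorBundle ∞ F E (𝓡 n)] [SigmaCompactSpace M] [T2Space M]

/-- The anchor is a morphism of brackets. -/
theorem anchorSec_bracket (u v : Sec n F E) (f : C^∞⟮𝓡 n, M; ℝ⟯) :
    C.anchorSec (C.bracket u v) f =
      C.anchorSec u (C.anchorSec v f) - C.anchorSec v (C.anchorSec u f) := by
  -- Comparing the Jacobi identity for `f • w` with that for `w` leaves the defect of the anchor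
  -- multiplied by `w`.
  have h : ∀ w : Sec n F E, (C.anchorSec (C.bracket u v) f -
      (C.anchorSec u (C.anchorSec v f) - C.anchorSec v (C.anchorSec u f))) • w = 0 := fun w => by
    have h1 := C.jacobi u v (f • w)
    have h2 := C.jacobi u v w
    simp only [bracket_smul, map_add, h2, smul_add] at h1
    rw [sub_smul, sub_smul, sub_eq_zero]
    rw [← sub_eq_zero] at h1 ⊢
    rw [← neg_eq_zero, ← h1]
    abel
  refine ContMDiffMap.ext fun p => ?_
  -- On a zero fibre there is no `w` to cancel, but there the anchor itself is zero.
  by_cases hp : ∀ x : E p, x = 0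
  · change _ = C.anchorSec u (C.anchorSec v f) p - C.anchorSec v (C.anchorSec u f) p
    simp only [C.anchorSec_eq_zero (hp _), sub_zero]
  · push Not at hp
    obtain ⟨x, hx⟩ := hp
    have h1 := DFunLike.congr_fun (h (ext x)) p
    rw [sec_smul_apply, ext_apply] at h1
    have h2 := (smul_eq_zero.mp h1).resolve_right hx
    exact sub_eq_zero.mp h2

/-- The sections of a Courant algebroid, with a choice of dual families of sections. -/
def toModule {ι : Type*} [Fintype ι] (e e' : ι → Sec n F E)
    (h : ∀ (p : M) (x : E p), ∑ i, C.pairing p x (e' i p) • e i p = x) :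
    CourantModule C^∞⟮𝓡 n, M; ℝ⟯ (Sec n F E) ι where
  pair := C.pairSec
  anchor := C.anchorSec
  bracket := C.bracket
  e := e
  e' := e'
  pair_comm u v := ContMDiffMap.ext fun p => C.pairing_comm p _ _
  expand u := ContMDiffSection.ext fun p => by
    rw [sec_sum_apply]
    exact h p (u p)
  jacobi := C.jacobi
  leibniz := C.bracket_smul
  invariance u v w := ContMDiffMap.ext fun p => C.invariance u v w p
  bracket_symm u v w := ContMDiffMap.ext fun p => C.bracket_symm u v w p
  anchor_bracket := C.anchorSec_bracket

theorem divSec_bracket (σ : HalfDensity n M) (u v : Sec n F E) :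
    C.divSec σ (C.bracket u v) =
      C.anchorSec u (C.divSec σ v) - C.anchorSec v (C.divSec σ u) :=
  ContMDiffMap.ext fun p => σ.vdiv_bracket (C.anchor_smooth u) (C.anchor_smooth v)
    (C.anchor_smooth (C.bracket u v)) (fun f q => DFunLike.congr_fun (C.anchorSec_bracket u v f) q) p

/-- The cocycle identity is the one for vector fields. It implies that gradients are divergence free
wherever some `⟨x, y⟩` is nonzero, hence on every nonzero fibre; on a zero fibre all derivatives
along the anchor vanish. -/
theorem isFlat_of_div {ι : Type*} [Fintype ι] {e e' : ι → Sec n F E}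
    {h : ∀ (p : M) (x : E p), ∑ i, C.pairing p x (e' i p) • e i p = x} {σ : HalfDensity n M}
    {D : (C.toModule e e' h).Conn} (hD : ∀ u, (C.toModule e e' h).div D u = C.divSec σ u) :
    D.IsFlat := by
  have hb : ∀ u v, (C.toModule e e' h).div D ((C.toModule e e' h).bracket u v) =
      (C.toModule e e' h).anchor u ((C.toModule e e' h).div D v) -
        (C.toModule e e' h).anchor v ((C.toModule e e' h).div D u) := fun u v => by
    simp only [hD]
    exact C.divSec_bracket σ u v
  refine ⟨hb, fun f => ?_⟩
  rw [D.tr_dcov_anchor]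
  refine ContMDiffMap.ext fun p => ?_
  by_cases hp : ∀ x : E p, x = 0
  · rw [← D.tr_dcov_anchor, CourantModule.tr, fun_sum_apply]
    refine Finset.sum_eq_zero fun i _ => ?_
    have h1 : ∀ (u : Sec n F E) g, (C.toModule e e' h).anchor u g p = 0 := fun u g =>
      C.anchorSec_eq_zero (hp _) g
    change (C.toModule e e' h).anchor _ _ p - (C.toModule e e' h).anchor _ _ p = 0
    rw [h1, h1, sub_zero]
  · push Not at hp
    obtain ⟨x, hx⟩ := hp
    have hy : ∃ y, C.pairing p x y ≠ 0 := by
      by_contra hy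
      push Not at hy
      exact hx (C.pairing_ext fun z => by simpa using hy z)
    obtain ⟨y, hy⟩ := hy
    have h1 := DFunLike.congr_fun (D.pair_mul_div_grad hb (ext x) (ext y) f) p
    have h2 : C.pairing p ((ext x : Sec n F E) p) ((ext y : Sec n F E) p) *
      (C.toModule e e' h).div D ((C.toModule e e' h).grad f) p = 0 := h1
    rw [ext_apply, ext_apply] at h2
    exact (mul_eq_zero.mp h2).resolve_left hy

end CourantAlgebroid

end Courant

end

end CourantFlow

/-! ### Time derivatives of families of smooth functions. -/

namespace CourantFlow

noncomputable section

section Product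

variable {V : Type*} [NormedAddCommGroup V] [NormedSpace ℝ V]
  {J : Set ℝ} {U : Set V} {h : ℝ × V → ℝ}

theorem fderiv_slice (hU : IsOpen U) (hh : ContDiffOn ℝ ∞ h (J ×ˢ U)) {s : ℝ} {y : V}
    (hs : s ∈ J) (hy : y ∈ U) (v : V) :
    fderiv ℝ (fun z => h (s, z)) y v = fderivWithin ℝ h (J ×ˢ U) (s, y) (0, v) := by
  have h1 := ((hh (s, y) ⟨hs, hy⟩).differentiableWithinAt (by simp)).hasFDerivWithinAt
  have h2 : HasFDerivWithinAt (fun z : V => (s, z)) (ContinuousLinearMap.inr ℝ ℝ V) U y :=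
    (hasFDerivAt_prodMk_right s y).hasFDerivWithinAt
  have h3 := (h1.comp y h2 (fun z hz => ⟨hs, hz⟩)).hasFDerivAt (hU.mem_nhds hy)
  exact DFunLike.congr_fun h3.fderiv v

theorem contDiffOn_fderiv_slice (hU : IsOpen U) (hJ : UniqueDiffOn ℝ J)
    (hh : ContDiffOn ℝ ∞ h (J ×ˢ U)) {X : V → V} (hX : ContDiffOn ℝ ∞ X U) :
    ContDiffOn ℝ ∞ (fun z : ℝ × V => fderiv ℝ (fun y => h (z.1, y)) z.2 (X z.2)) (J ×ˢ U) := by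
  have h1 : ContDiffOn ℝ ∞ (fderivWithin ℝ h (J ×ˢ U)) (J ×ˢ U) :=
    hh.fderivWithin (hJ.prod hU.uniqueDiffOn) (by simp)
  have h2 : ContDiffOn ℝ ∞ (fun z : ℝ × V => ((0 : ℝ), X z.2)) (J ×ˢ U) :=
    contDiffOn_const.prodMk (hX.comp contDiff_snd.contDiffOn fun z hz => hz.2)
  exact (h1.clm_apply h2).congr fun z hz => fderiv_slice hU hh hz.1 hz.2 _

/-- Time and space derivatives commute. -/
theorem hasDerivWithinAt_fderiv_slice (hU : IsOpen U) (hJ : UniqueDiffOn ℝ J)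
    (hJc : J ⊆ closure (interior J)) (hh : ContDiffOn ℝ ∞ h (J ×ˢ U)) {t : ℝ} (ht : t ∈ J)
    {h' : V → ℝ} (hd : ∀ y ∈ U, HasDerivWithinAt (fun s => h (s, y)) (h' y) J t)
    {y : V} (hy : y ∈ U) (v : V) :
    HasDerivWithinAt (fun s => fderiv ℝ (fun z => h (s, z)) y v) (fderiv ℝ h' y v) J t := by
  have hS : UniqueDiffOn ℝ (J ×ˢ U) := hJ.prod hU.uniqueDiffOn
  have hty : (t, y) ∈ J ×ˢ U := ⟨ht, hy⟩
  -- Symmetry of second derivatives within `J ×ˢ U` is needed also at endpoints of `J`. It holds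
  -- there because such points are limits of interior points.
  have hm : (t, y) ∈ closure (interior (J ×ˢ U)) := by
    rw [interior_prod_eq, closure_prod_eq, hU.interior_eq]
    exact ⟨hJc ht, subset_closure hy⟩
  have hsym := (hh (t, y) hty).isSymmSndFDerivWithinAt
    (by rw [minSmoothness_of_isRCLikeNormedField]; norm_cast) hS hm hty
  have h1 : ContDiffOn ℝ ∞ (fderivWithin ℝ h (J ×ˢ U)) (J ×ˢ U) := hh.fderivWithin hS (by simp)
  have h2 := ((h1 (t, y) hty).differentiableWithinAt (by simp)).hasFDerivWithinAt
  have ha : HasDerivWithinAt (fun s => fderivWithin ℝ h (J ×ˢ U) (s, y) (0, v))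
      (fderivWithin ℝ (fderivWithin ℝ h (J ×ˢ U)) (J ×ˢ U) (t, y) (1, 0) (0, v)) J t := by
    have h3 : HasDerivWithinAt (fun s : ℝ => (s, y)) ((1 : ℝ), (0 : V)) J t :=
      ((hasDerivAt_id t).prodMk (hasDerivAt_const t y)).hasDerivWithinAt
    have h4 := h2.comp_hasDerivWithinAt t h3 (fun s hs => (⟨hs, hy⟩ : (s, y) ∈ J ×ˢ U))
    have h5 := h4.clm_apply (hasDerivWithinAt_const t J ((0 : ℝ), v))
    simpa using h5
  have hb : ∀ z ∈ U, h' z = fderivWithin ℝ h (J ×ˢ U) (t, z) (1, 0) := fun z hz => by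
    have h3 : HasDerivWithinAt (fun s : ℝ => (s, z)) ((1 : ℝ), (0 : V)) J t :=
      ((hasDerivAt_id t).prodMk (hasDerivAt_const t z)).hasDerivWithinAt
    have h4 := ((hh (t, z) ⟨ht, hz⟩).differentiableWithinAt
      (by simp)).hasFDerivWithinAt.comp_hasDerivWithinAt t h3
        (fun s hs => (⟨hs, hz⟩ : (s, z) ∈ J ×ˢ U))
    exact (hJ t ht).eq_deriv _ (hd z hz) h4
  have hc : fderiv ℝ h' y v =
      fderivWithin ℝ (fderivWithin ℝ h (J ×ˢ U)) (J ×ˢ U) (t, y) (0, v) (1, 0) := by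
    have h3 : HasFDerivWithinAt (fun z : V => (t, z)) (ContinuousLinearMap.inr ℝ ℝ V) U y :=
      (hasFDerivAt_prodMk_right t y).hasFDerivWithinAt
    have h4 := (h2.comp y h3 (fun z hz => ⟨ht, hz⟩)).clm_apply
      (hasFDerivWithinAt_const ((1 : ℝ), (0 : V)) y U)
    have h5 := (h4.congr hb (hb y hy)).hasFDerivAt (hU.mem_nhds hy)
    rw [h5.fderiv]
    simp
  rw [hc, hsym]
  exact ha.congr (fun s hs => fderiv_slice hU hh hs hy v) (fderiv_slice hU hh ht hy v)

end Product

section Manifold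

variable {n : ℕ} {M : Type*} [TopologicalSpace M] [ChartedSpace (EuclideanSpace ℝ (Fin n)) M]

theorem contMDiffOn_prod_univ {Φ : ℝ × M → ℝ} {J : Set ℝ}
    (h : ∀ p, ContMDiffOn (𝓘(ℝ, ℝ).prod (𝓡 n)) 𝓘(ℝ, ℝ) ∞ Φ
      (J ×ˢ (chartAt (EuclideanSpace ℝ (Fin n)) p).source)) :
    ContMDiffOn (𝓘(ℝ, ℝ).prod (𝓡 n)) 𝓘(ℝ, ℝ) ∞ Φ (J ×ˢ univ) := by
  refine contMDiffOn_of_locally_contMDiffOn fun x hx =>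
    ⟨univ ×ˢ (chartAt (EuclideanSpace ℝ (Fin n)) x.2).source,
      isOpen_univ.prod (chartAt (EuclideanSpace ℝ (Fin n)) x.2).open_source,
      ⟨mem_univ _, mem_chart_source _ _⟩, (h x.2).mono fun y hy => ⟨hy.1.1, hy.2.2⟩⟩

variable [IsManifold (𝓡 n) ∞ M]

theorem contDiffOn_prod_chart {Φ : ℝ × M → ℝ} {J : Set ℝ}
    (h : ContMDiffOn (𝓘(ℝ, ℝ).prod (𝓡 n)) 𝓘(ℝ, ℝ) ∞ Φ (J ×ˢ univ)) (p : M) :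
    ContDiffOn ℝ ∞ (fun z : ℝ × EuclideanSpace ℝ (Fin n) =>
      Φ (z.1, (extChartAt (𝓡 n) p).symm z.2)) (J ×ˢ (extChartAt (𝓡 n) p).target) := by
  rw [← contMDiffOn_iff_contDiffOn]
  refine h.comp (t := J ×ˢ univ) (f := fun z : ℝ × EuclideanSpace ℝ (Fin n) =>
      (z.1, (extChartAt (𝓡 n) p).symm z.2)) ?_ fun z hz => ⟨hz.1, mem_univ _⟩
  exact contDiff_fst.contMDiff.contMDiffOn.prodMk ((contMDiffOn_extChartAt_symm p).comp
    contDiff_snd.contMDiff.contMDiffOn fun z hz => hz.2)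

theorem contMDiffOn_of_prod_chart {Φ : ℝ × M → ℝ} {J : Set ℝ}
    (h : ∀ p, ContDiffOn ℝ ∞ (fun z : ℝ × EuclideanSpace ℝ (Fin n) =>
      Φ (z.1, (extChartAt (𝓡 n) p).symm z.2)) (J ×ˢ (extChartAt (𝓡 n) p).target)) :
    ContMDiffOn (𝓘(ℝ, ℝ).prod (𝓡 n)) 𝓘(ℝ, ℝ) ∞ Φ (J ×ˢ univ) := by
  refine contMDiffOn_prod_univ fun p => ?_
  have h1 := h p
  rw [← contMDiffOn_iff_contDiffOn] at h1
  have h2 : ContMDiffOn (𝓘(ℝ, ℝ).prod (𝓡 n)) 𝓘(ℝ, ℝ × EuclideanSpace ℝ (Fin n)) ∞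
      (fun x : ℝ × M => (x.1, extChartAt (𝓡 n) p x.2))
      (J ×ˢ (chartAt (EuclideanSpace ℝ (Fin n)) p).source) :=
    contMDiffOn_fst.prodMk_space (contMDiffOn_extChartAt.comp contMDiffOn_snd fun z hz => hz.2)
  refine (h1.comp h2 fun x hx => ⟨hx.1, ?_⟩).congr fun x hx => ?_
  · exact (extChartAt (𝓡 n) p).map_source (by rw [extChartAt_source]; exact hx.2)
  · simp only [Function.comp]
    rw [(extChartAt (𝓡 n) p).left_inv (by rw [extChartAt_source]; exact hx.2)]

/-- `f s` is a family of smooth functions, smooth on `J × M`, with time derivative `f'` at `t`. -/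
def HasTimeDeriv (J : Set ℝ) (t : ℝ) (f : ℝ → C^∞⟮𝓡 n, M; ℝ⟯) (f' : C^∞⟮𝓡 n, M; ℝ⟯) : Prop :=
  ContMDiffOn (𝓘(ℝ, ℝ).prod (𝓡 n)) 𝓘(ℝ, ℝ) ∞ (fun x : ℝ × M => f x.1 x.2) (J ×ˢ univ) ∧
    ∀ p, HasDerivWithinAt (fun s => f s p) (f' p) J t

variable {F : Type*} [NormedAddCommGroup F] [NormedSpace ℝ F]
  {E : M → Type*} [TopologicalSpace (TotalSpace F E)]
  [∀ p, AddCommGroup (E p)] [∀ p, Module ℝ (E p)] [∀ p, TopologicalSpace (E p)]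
  [FiberBundle F E] [VectorBundle ℝ F E]
  (C : CourantAlgebroid n F E)

theorem HasTimeDeriv.anchorSec {J : Set ℝ} {t : ℝ} (hJ : UniqueDiffOn ℝ J)
    (hJc : J ⊆ closure (interior J)) (ht : t ∈ J) {f : ℝ → C^∞⟮𝓡 n, M; ℝ⟯} {f' : C^∞⟮𝓡 n, M; ℝ⟯}
    (u : Sec n F E) (h : HasTimeDeriv J t f f') :
    HasTimeDeriv J t (fun s => C.anchorSec u (f s)) (C.anchorSec u f') := by
  have hX := fun p => contDiffOn_vecInChart (C.anchor_smooth u) p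
  refine ⟨contMDiffOn_of_prod_chart fun p => ?_, fun p => ?_⟩
  · refine (contDiffOn_fderiv_slice (isOpen_extChartAt_target p) hJ (contDiffOn_prod_chart h.1 p)
      (hX p)).congr fun z hz => ?_
    exact dirDeriv_chart (f z.1).contMDiff.contMDiffOn (fun q => C.anchor q (u q)) hz.2
  · have h1 := hasDerivWithinAt_fderiv_slice (isOpen_extChartAt_target p) hJ hJc
      (contDiffOn_prod_chart h.1 p) ht (h' := fun y => f' ((extChartAt (𝓡 n) p).symm y))
      (fun y _ => h.2 ((extChartAt (𝓡 n) p).symm y)) (mem_extChartAt_target p)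
      (HalfDensity.vecInChart (fun q => C.anchor q (u q)) p (extChartAt (𝓡 n) p p))
    have h2 : ∀ g : C^∞⟮𝓡 n, M; ℝ⟯, C.anchorSec u g p =
        fderiv ℝ (fun y => g ((extChartAt (𝓡 n) p).symm y)) (extChartAt (𝓡 n) p p)
          (HalfDensity.vecInChart (fun q => C.anchor q (u q)) p (extChartAt (𝓡 n) p p)) :=
      fun g => by
        have := dirDeriv_chart (g.contMDiff.contMDiffOn
          (s := (chartAt (EuclideanSpace ℝ (Fin n)) p).source)) (fun q => C.anchor q (u q))
          (mem_extChartAt_target p)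
        rwa [(extChartAt (𝓡 n) p).left_inv (mem_extChartAt_source p)] at this
    simp only [h2]
    exact h1

variable [ContMDiffVectorBundle ∞ F E (𝓡 n)] [SigmaCompactSpace M] [T2Space M]

/-- Differentiation in time of families of functions that are smooth in space and time. -/
def timeDeriv {ι : Type*} [Fintype ι] {e e' : ι → Sec n F E}
    {h : ∀ (p : M) (x : E p), ∑ i, C.pairing p x (e' i p) • e i p = x}
    {J : Set ℝ} {t : ℝ} (hJ : UniqueDiffOn ℝ J) (hJc : J ⊆ closure (interior J)) (ht : t ∈ J) :
    CourantModule.TimeDeriv (C.toModule e e' h) t where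
  HasD := HasTimeDeriv J t
  const a := ⟨a.contMDiff.comp_contMDiffOn contMDiffOn_snd, fun _ => hasDerivWithinAt_const _ _ _⟩
  add h1 h2 := ⟨h1.1.add h2.1, fun p => (h1.2 p).add (h2.2 p)⟩
  mul h1 h2 := ⟨h1.1.mul h2.1, fun p => (h1.2 p).mul (h2.2 p)⟩
  anchor u h1 := h1.anchorSec C hJ hJc ht u

end Manifold

end

end CourantFlow

/-! ### Fibrewise definitions compared with their algebraic counterparts. -/

namespace CourantFlow

noncomputable section

section Contractions

variable {n : ℕ} {M : Type*} [TopologicalSpace M] [ChartedSpace (EuclideanSpace ℝ (Fin n)) M]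
  [IsManifold (𝓡 n) ∞ M]
  {F : Type*} [NormedAddCommGroup F] [NormedSpace ℝ F] [FiniteDimensional ℝ F]
  {E : M → Type*} [TopologicalSpace (TotalSpace F E)]
  [∀ p, AddCommGroup (E p)] [∀ p, Module ℝ (E p)] [∀ p, TopologicalSpace (E p)]
  [FiberBundle F E] [VectorBundle ℝ F E]
  (C : CourantAlgebroid n F E)

theorem sum_pairing_frame {p : M} (x : E p) :
    ∑ α, C.pairing p x (frame F E p α) • coframe C p α = x := by
  conv_rhs => rw [← (coframe C p).sum_repr x]
  refine Finset.sum_congr rfl fun α _ => ?_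
  rw [coframe, LinearMap.BilinForm.dualBasis_repr_apply]

theorem sum_pairing_coframe {p : M} (x : E p) :
    ∑ α, C.pairing p x (coframe C p α) • frame F E p α = x := by
  refine C.pairing_ext fun z => ?_
  conv_rhs => rw [← sum_pairing_frame C z]
  simp only [map_sum, map_smul, LinearMap.sum_apply, LinearMap.smul_apply, smul_eq_mul]
  refine Finset.sum_congr rfl fun α _ => ?_
  rw [C.pairing_comm p z]; ring

theorem trace_eq_sum {p : M} (T : E p →ₗ[ℝ] E p) :
    LinearMap.trace ℝ (E p) T = ∑ α, C.pairing p (T (frame F E p α)) (coframe C p α) := by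
  rw [LinearMap.trace_eq_matrix_trace ℝ (frame F E p), Matrix.trace]
  refine Finset.sum_congr rfl fun α _ => ?_
  rw [Matrix.diag_apply, LinearMap.toMatrix_apply]
  conv_lhs => rw [← sum_pairing_coframe C (T (frame F E p α))]
  simp [Finsupp.single_apply]

/-- Contractions may be computed in any dual families of vectors. -/
theorem sum_frame_coframe {ι : Type*} [Fintype ι] {e e' : ι → Sec n F E}
    (hee : ∀ (p : M) (x : E p), ∑ i, C.pairing p x (e' i p) • e i p = x) {p : M}
    (B : E p →ₗ[ℝ] E p →ₗ[ℝ] ℝ) :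
    ∑ α, B (frame F E p α) (coframe C p α) = ∑ i, B (e i p) (e' i p) := by
  have h1 : ∀ α, B (frame F E p α) (coframe C p α) =
      ∑ i, C.pairing p (frame F E p α) (e' i p) * B (e i p) (coframe C p α) := fun α => by
    conv_lhs => rw [← hee p (frame F E p α)]
    simp
  have h2 : ∀ i, B (e i p) (e' i p) =
      ∑ α, C.pairing p (e' i p) (frame F E p α) * B (e i p) (coframe C p α) := fun i => by
    conv_lhs => rw [← sum_pairing_frame C (e' i p)]
    simp
  simp only [h1, h2]
  rw [Finset.sum_comm]
  refine Finset.sum_congr rfl fun i _ => Finset.sum_congr rfl fun α _ => ?_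
  rw [C.pairing_comm]

end Contractions

section Tensors

variable {n : ℕ} {M : Type*} [TopologicalSpace M] [ChartedSpace (EuclideanSpace ℝ (Fin n)) M]
  [IsManifold (𝓡 n) ∞ M]
  {F : Type*} [NormedAddCommGroup F] [NormedSpace ℝ F]
  {E : M → Type*} [TopologicalSpace (TotalSpace F E)]
  [∀ p, AddCommGroup (E p)] [∀ p, Module ℝ (E p)] [∀ p, TopologicalSpace (E p)]
  [FiberBundle F E] [VectorBundle ℝ F E] [ContMDiffVectorBundle ∞ F E (𝓡 n)]
  [SigmaCompactSpace M] [T2Space M]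
  {C : CourantAlgebroid n F E} {ι : Type*} [Fintype ι] {e e' : ι → Sec n F E}

/-- The value of a tensorial expression at a point depends only on the value of the argument. -/
theorem IsLin.congr_at
    (hee : ∀ (p : M) (x : E p), ∑ i, C.pairing p x (e' i p) • e i p = x)
    {T : Sec n F E → C^∞⟮𝓡 n, M; ℝ⟯} (hT : IsLin T) {u v : Sec n F E} {p : M}
    (h : u p = v p) : T u p = T v p := by
  rw [← (C.toModule e e' hee).sum_pair_mul hT u, ← (C.toModule e e' hee).sum_pair_mul hT v,
    fun_sum_apply, fun_sum_apply]
  refine Finset.sum_congr rfl fun i _ => ?_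
  change C.pairing p (u p) (e' i p) * _ = C.pairing p (v p) (e' i p) * _
  rw [h]

theorem IsBilin.congr_at
    (hee : ∀ (p : M) (x : E p), ∑ i, C.pairing p x (e' i p) • e i p = x)
    {B : Sec n F E → Sec n F E → C^∞⟮𝓡 n, M; ℝ⟯} (hB : IsBilin B)
    {u v u' v' : Sec n F E} {p : M} (hu : u p = v p) (hu' : u' p = v' p) :
    B u u' p = B v v' p :=
  ((hB.left u').congr_at hee hu).trans ((hB.right v).congr_at hee hu')

/-- The bilinear form on a fibre defined by a tensorial expression. -/
def IsBilin.at (hee : ∀ (p : M) (x : E p), ∑ i, C.pairing p x (e' i p) • e i p = x)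
    {B : Sec n F E → Sec n F E → C^∞⟮𝓡 n, M; ℝ⟯} (hB : IsBilin B) (p : M) :
    E p →ₗ[ℝ] E p →ₗ[ℝ] ℝ :=
  LinearMap.mk₂ ℝ (fun x y => B (ext x) (ext y) p)
    (fun x x' y => by
      rw [hB.congr_at hee (v := ext x + ext x') (v' := ext y) (by simp [ext_apply]) rfl,
        (hB.left _).add]
      rfl)
    (fun c x y => by
      rw [hB.congr_at hee (v := c • ext x) (v' := ext y) (by simp [ext_apply]) rfl,
        (hB.left _).map_real_smul]
      rfl)
    (fun x y y' => by
      rw [hB.congr_at hee (v := ext x) (v' := ext y + ext y') rfl (by simp [ext_apply]),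
        (hB.right _).add]
      rfl)
    (fun c x y => by
      rw [hB.congr_at hee (v := ext x) (v' := c • ext y) rfl (by simp [ext_apply]),
        (hB.right _).map_real_smul]
      rfl)

theorem IsBilin.at_sections
    (hee : ∀ (p : M) (x : E p), ∑ i, C.pairing p x (e' i p) • e i p = x)
    {B : Sec n F E → Sec n F E → C^∞⟮𝓡 n, M; ℝ⟯} (hB : IsBilin B) (p : M)
    (u v : Sec n F E) : hB.at hee p (u p) (v p) = B u v p :=
  hB.congr_at hee (ext_apply _) (ext_apply _)

variable [FiniteDimensional ℝ F]

theorem IsBilin.sum_frame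
    (hee : ∀ (p : M) (x : E p), ∑ i, C.pairing p x (e' i p) • e i p = x)
    {B : Sec n F E → Sec n F E → C^∞⟮𝓡 n, M; ℝ⟯} (hB : IsBilin B) (p : M) :
    ∑ α, B (ext (frame F E p α)) (ext (coframe C p α)) p = (C.toModule e e' hee).tr B p := by
  refine (sum_frame_coframe C hee (hB.at hee p)).trans ?_
  rw [CourantModule.tr, fun_sum_apply]
  exact Finset.sum_congr rfl fun i _ => hB.at_sections hee p _ _

end Tensors

section Connections

variable {n : ℕ} {M : Type*} [TopologicalSpace M] [ChartedSpace (EuclideanSpace ℝ (Fin n)) M]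
  [IsManifold (𝓡 n) ∞ M]
  {F : Type*} [NormedAddCommGroup F] [NormedSpace ℝ F]
  {E : M → Type*} [TopologicalSpace (TotalSpace F E)]
  [∀ p, AddCommGroup (E p)] [∀ p, Module ℝ (E p)] [∀ p, TopologicalSpace (E p)]
  [FiberBundle F E] [VectorBundle ℝ F E]
  {C : CourantAlgebroid n F E}

/-- A generalized pseudometric as an endomorphism of the module of sections. -/
def GenPseudometric.toLin (G : GenPseudometric C) :
    Sec n F E →ₗ[C^∞⟮𝓡 n, M; ℝ⟯] Sec n F E where
  toFun := G.onSec
  map_add' u v := ContMDiffSection.ext fun p => map_add (G.toFun p) (u p) (v p)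
  map_smul' f u := ContMDiffSection.ext fun p => map_smul (G.toFun p) (f p) (u p)

@[simp] theorem GenPseudometric.toLin_apply (G : GenPseudometric C) (u : Sec n F E) (p : M) :
    G.toLin u p = G.toFun p (u p) := rfl

variable [ContMDiffVectorBundle ∞ F E (𝓡 n)] [SigmaCompactSpace M] [T2Space M]
  {ι : Type*} [Fintype ι] {e e' : ι → Sec n F E}
  {hee : ∀ (p : M) (x : E p), ∑ i, C.pairing p x (e' i p) • e i p = x}

local notation "𝒬" => CourantAlgebroid.toModule C e e' hee

theorem GenPseudometric.isInvolution (G : GenPseudometric C) : (𝒬).IsInvolution G.toLin :=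
  ⟨fun u v => ContMDiffMap.ext fun p => G.selfAdjoint p (u p) (v p),
    fun u => ContMDiffSection.ext fun p => G.involutive p (u p)⟩

variable (hee) in
/-- A connection as an operator on the module of sections. -/
def Connection.toConn (D : Connection C) : (𝒬).Conn where
  cov :=
    { toFun := fun u =>
        { toFun := fun v => D.cov u v
          map_add' := fun v w => ContMDiffSection.ext fun p => map_add (D.toFun p (u p)) v w
          map_smul' := fun c v => ContMDiffSection.ext fun p => map_smul (D.toFun p (u p)) c v }
      map_add' := fun u v => LinearMap.ext fun w => ContMDiffSection.ext fun p =>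
        DFunLike.congr_fun (map_add (D.toFun p) (u p) (v p)) w
      map_smul' := fun f u => LinearMap.ext fun w => ContMDiffSection.ext fun p =>
        DFunLike.congr_fun (map_smul (D.toFun p) (f p) (u p)) w }
  leibniz u v f := ContMDiffSection.ext fun p => D.leibniz p (u p) f v
  metric u v w := ContMDiffMap.ext fun p => D.metric p (u p) v w

@[simp] theorem Connection.toConn_cov (D : Connection C) (u v : Sec n F E) :
    (D.toConn hee).cov u v = D.cov u v := rfl

/-- Every connection on the module of sections comes from a connection. -/
theorem exists_toConn_eq (D : (𝒬).Conn) : ∃ D' : Connection C, D'.toConn hee = D := by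
  have hlin : ∀ v w, IsLin (fun u => (𝒬).pair (D.cov u v) w) := fun v w => ⟨by simp, by simp⟩
  -- Linearity over functions makes `D_u v` at `p` depend only on `u p`, so the operator descends to
  -- vectors.
  have key : ∀ {u u' : Sec n F E} {p : M} (v : Sec n F E), u p = u' p →
      D.cov u v p = D.cov u' v p := fun {u u' p} v h => by
    refine C.pairing_ext fun z => ?_
    have h1 := (hlin v (ext z)).congr_at hee h
    change C.pairing p (D.cov u v p) ((ext z : Sec n F E) p) =
      C.pairing p (D.cov u' v p) ((ext z : Sec n F E) p) at h1
    rwa [ext_apply] at h1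
  let T : ∀ p, E p →ₗ[ℝ] Sec n F E →ₗ[ℝ] E p := fun p =>
    LinearMap.mk₂ ℝ (fun x v => D.cov (ext x) v p)
      (fun x x' v => by
        rw [key (u' := ext x + ext x') v (by simp [ext_apply]), map_add]; rfl)
      (fun c x v => by
        rw [key (u' := algebraMap ℝ C^∞⟮𝓡 n, M; ℝ⟯ c • ext x) v (by
          rw [ext_apply, sec_smul_apply, ext_apply]; rfl), map_smul]
        rfl)
      (fun x v v' => by rw [map_add]; rfl)
      (fun c x v => by rw [map_smul]; rfl)
  have hT : ∀ (u v : Sec n F E) p, T p (u p) v = D.cov u v p := fun u v p =>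
    key v (ext_apply _)
  refine ⟨⟨T, fun u v => ?_, fun p x f v => ?_, fun p x v w => ?_⟩, ?_⟩
  · simp only [hT]
    exact (D.cov u v).contMDiff
  · have h1 := DFunLike.congr_fun (D.leibniz (ext x) v f) p
    have h2 : D.cov (ext x) (f • v) p = f p • D.cov (ext x) v p +
      dirDeriv f p (C.anchor p ((ext x : Sec n F E) p)) • v p := h1
    rwa [ext_apply] at h2
  · have h1 := DFunLike.congr_fun (D.metric (ext x) v w) p
    have h2 : dirDeriv (fun q => C.pairing q (v q) (w q)) p
      (C.anchor p ((ext x : Sec n F E) p)) = C.pairing p (D.cov (ext x) v p) (w p) +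
        C.pairing p (v p) (D.cov (ext x) w p) := h1
    rwa [ext_apply] at h2
  · have h1 : ∀ {D₁ D₂ : (𝒬).Conn}, (∀ u v, D₁.cov u v = D₂.cov u v) → D₁ = D₂ := by
      rintro ⟨c₁, _, _⟩ ⟨c₂, _, _⟩ h
      have : c₁ = c₂ := LinearMap.ext fun u => LinearMap.ext fun v => h u v
      subst this
      rfl
    exact h1 fun u v => ContMDiffSection.ext fun p => hT u v p

variable [FiniteDimensional ℝ F]

namespace Connection

variable (D : Connection C)

theorem toConn_div (u : Sec n F E) (p : M) : (𝒬).div (D.toConn hee) u p = D.divergence u p := by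
  rw [divergence, trace_eq_sum C]
  let B : E p →ₗ[ℝ] E p →ₗ[ℝ] ℝ := LinearMap.comp (C.pairing p) ((D.toFun p).flip u)
  have h := sum_frame_coframe C hee B
  refine Eq.trans ?_ h.symm
  rw [CourantModule.div, CourantModule.tr, fun_sum_apply]
  rfl

theorem toConn_riem (w z x y : Sec n F E) (p : M) :
    (D.toConn hee).riem w z x y p = D.riemann w z x y p := by
  have h := sum_frame_coframe C hee (p := p) (LinearMap.mk₂ ℝ
    (fun a b => C.pairing p (D.toFun p a x) (y p) * C.pairing p (D.toFun p b z) (w p))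
    (by intros; simp [add_mul]) (by intros; simp [mul_assoc])
    (by intros; simp [mul_add]) (by intros; simp [mul_left_comm]))
  simp only [LinearMap.mk₂_apply] at h
  rw [riemann, h]
  have h1 : (𝒬).tr (fun a b => (𝒬).pair ((D.toConn hee).cov a x) y *
      (𝒬).pair ((D.toConn hee).cov b z) w) p =
      ∑ i, C.pairing p (D.toFun p (e i p) x) (y p) *
        C.pairing p (D.toFun p (e' i p) z) (w p) := by
    rw [CourantModule.tr, fun_sum_apply]
    rfl
  rw [← h1]
  rfl

variable {D}

/-- Tensoriality of `riem` makes the chosen extensions immaterial, and the contraction is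
independent of the dual families. -/
theorem fullRicci_eq (hD : (D.toConn hee).TorsionFree) {p : M} (u v : E p) :
    D.fullRicci p u v = (D.toConn hee).fRic (ext u) (ext v) p := by
  rw [CourantModule.Conn.fRic, ← (hD.riem_bilin_fst_trd (ext v) (ext u)).sum_frame hee p, fullRicci]
  exact Finset.sum_congr rfl fun α _ => (D.toConn_riem _ _ _ _ p).symm

theorem ricci_eq (hD : (D.toConn hee).TorsionFree) (G : GenPseudometric C) {p : M} (u v : E p) :
    D.ricci G p u v = (D.toConn hee).ric G.toLin (ext u) (ext v) p := by
  rw [ricci, fullRicci_eq hD, fullRicci_eq hD, hD.fRic_bilin.congr_at hee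
    (u := ext (G.toFun p u)) (u' := ext (G.toFun p v)) (v := G.toLin (ext u))
    (v' := G.toLin (ext v)) (by simp [ext_apply]) (by simp [ext_apply])]
  rfl

theorem ricci_sections (hD : (D.toConn hee).TorsionFree) (G : GenPseudometric C) (p : M)
    (u v : Sec n F E) : D.ricci G p (u p) (v p) = (D.toConn hee).ric G.toLin u v p := by
  rw [ricci_eq hD]
  exact (hD.ric_bilin _).congr_at hee (ext_apply _) (ext_apply _)

theorem scalar_eq (hD : (D.toConn hee).TorsionFree) (G : GenPseudometric C) (p : M) :
    D.scalar G p = (D.toConn hee).scal G.toLin p := by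
  have hB : IsBilin (fun x y => (D.toConn hee).fRic x (G.toLin y)) :=
    ⟨fun y => hD.fRic_bilin.left _, fun x => ⟨fun y y' => by
      rw [map_add, (hD.fRic_bilin.right x).add], fun a y => by
      rw [map_smul, (hD.fRic_bilin.right x).smul]⟩⟩
  rw [CourantModule.Conn.scal, ← hB.sum_frame hee p, scalar]
  refine Finset.sum_congr rfl fun α _ => ?_
  rw [fullRicci_eq hD]
  exact hD.fRic_bilin.congr_at hee rfl (by simp [ext_apply])

/-- The two sums are moved from the fibre basis to the global families one at a time, the inner one
first. -/
theorem normSq_ricci (hD : (D.toConn hee).TorsionFree) (G : GenPseudometric C) (p : M) :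
    normSq C G p (D.ricci G p) = (𝒬).tr (fun x x' => (𝒬).tr (fun y y' =>
      (D.toConn hee).ric G.toLin x y * (D.toConn hee).ric G.toLin (G.toLin x') (G.toLin y'))) p := by
  have hr := hD.ric_bilin G.toLin
  let b := hr.at hee p
  have hb : ∀ x y : E p, D.ricci G p x y = b x y := fun x y => ricci_eq hD G x y
  have h1 : ∀ α, ∑ β, b (frame F E p α) (frame F E p β) *
      b (G.toFun p (coframe C p α)) (G.toFun p (coframe C p β)) =
      ∑ j, b (frame F E p α) (e j p) * b (G.toFun p (coframe C p α)) (G.toFun p (e' j p)) :=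
    fun α => by
      have h := sum_frame_coframe C hee (p := p) (LinearMap.mk₂ ℝ
        (fun x y => b (frame F E p α) x * b (G.toFun p (coframe C p α)) (G.toFun p y))
        (by intros; simp [add_mul]) (by intros; simp [mul_assoc])
        (by intros; simp [mul_add]) (by intros; simp [mul_left_comm]))
      simpa only [LinearMap.mk₂_apply] using h
  have h2 := sum_frame_coframe C hee (p := p) (LinearMap.mk₂ ℝ
        (fun x y => ∑ j, b x (e j p) * b (G.toFun p y) (G.toFun p (e' j p)))
        (by intros; simp [add_mul, Finset.sum_add_distrib])
        (by intros; simp [mul_assoc, Finset.mul_sum])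
        (by intros; simp [mul_add, Finset.sum_add_distrib])
        (by intros; simp [mul_left_comm, Finset.mul_sum]))
  simp only [LinearMap.mk₂_apply] at h2
  simp only [normSq, hb, h1]
  rw [h2, CourantModule.tr, fun_sum_apply]
  refine Finset.sum_congr rfl fun i _ => ?_
  rw [CourantModule.tr, fun_sum_apply]
  refine Finset.sum_congr rfl fun j _ => ?_
  have h3 := hr.at_sections hee p (e i) (e j)
  have h4 := hr.at_sections hee p (G.toLin (e' i)) (G.toLin (e' j))
  exact congrArg₂ (· * ·) h3 h4

end Connection

theorem isLeviCivita_iff {G : GenPseudometric C} {σ : HalfDensity n M} {D : Connection C} :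
    IsLeviCivita C G σ D ↔ (D.toConn hee).TorsionFree ∧ (D.toConn hee).Preserves G.toLin ∧
      ∀ u, (𝒬).div (D.toConn hee) u = C.divSec σ u := by
  constructor
  · rintro ⟨h1, h2, h3⟩
    exact ⟨fun u v w => ContMDiffMap.ext fun p => h2 u v w p, h1,
      fun u => ContMDiffMap.ext fun p => (D.toConn_div u p).trans (h3 u p)⟩
  · rintro ⟨h1, h2, h3⟩
    exact ⟨h2, fun u v w p => DFunLike.congr_fun (h1 u v w) p,
      fun u p => (D.toConn_div (hee := hee) u p).symm.trans (DFunLike.congr_fun (h3 u) p)⟩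

theorem gradE_eq (f : C^∞⟮𝓡 n, M; ℝ⟯) (p : M) : gradE C f p = (𝒬).grad f p := by
  refine C.pairing_ext fun z => ?_
  have h1 := DFunLike.congr_fun ((𝒬).pair_grad f (ext z)) p
  change C.pairing p ((𝒬).grad f p) ((ext z : Sec n F E) p) =
    dirDeriv f p (C.anchor p ((ext z : Sec n F E) p)) at h1
  rw [ext_apply] at h1
  rw [h1]
  let L : E p →ₗ[ℝ] ℝ := (mfderiv (𝓡 n) 𝓘(ℝ, ℝ) f p).toLinearMap ∘ₗ C.anchor p
  change C.pairing p (∑ α, L (frame F E p α) • coframe C p α) z = L z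
  conv_rhs => rw [← sum_pairing_coframe C z]
  simp only [map_sum, map_smul, LinearMap.sum_apply, LinearMap.smul_apply, smul_eq_mul]
  refine Finset.sum_congr rfl fun α _ => ?_
  rw [C.pairing_comm]; ring

/-- The Laplacian on functions is the divergence of `G` applied to a gradient; as `D` preserves `G`,
it may be moved out of the derivative and across the pairing. -/
theorem laplacian_eq {G : GenPseudometric C} {σ : HalfDensity n M} {D : (𝒬).Conn}
    (hP : D.Preserves G.toLin) (hdiv : ∀ u, (𝒬).div D u = C.divSec σ u)
    (f : C^∞⟮𝓡 n, M; ℝ⟯) (p : M) : laplacian C G σ f p = D.lap G.toLin f p := by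
  have h1 : laplacian C G σ f p = C.divSec σ (G.toLin ((𝒬).grad f)) p := by
    have : (fun q => G.toFun q (gradE C f q)) = fun q => G.toLin ((𝒬).grad f) q := by
      funext q
      rw [gradE_eq (hee := hee)]
      rfl
    rw [laplacian, this]
    rfl
  rw [h1, ← hdiv]
  congr 1
  have h2 : (fun v => (𝒬).anchor v f) = fun v => (𝒬).pair ((𝒬).grad f) v := by
    funext v; rw [(𝒬).pair_grad]
  rw [CourantModule.Conn.lap, h2, CourantModule.div]
  refine (𝒬).tr_congr fun x y => ?_
  rw [D.dcov_pair, hP, G.isInvolution.selfAdjoint]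

end Connections

end

end CourantFlow

/-! ### Ranks, ratios of half-densities and the flow. -/

namespace CourantFlow

noncomputable section

section Ranks

variable {W : Type*} [AddCommGroup W] [Module ℝ W] [FiniteDimensional ℝ W]

/-- The rank of the `-1`-eigenspace of an involution. -/
theorem trace_half_id_sub {g : W →ₗ[ℝ] W} (hg : ∀ x, g (g x) = x) :
    LinearMap.trace ℝ W ((1 / 2 : ℝ) • (LinearMap.id - g)) =
      Module.finrank ℝ (LinearMap.ker (g + LinearMap.id)) := by
  refine LinearMap.IsProj.trace ⟨fun x => ?_, fun x hx => ?_⟩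
  · simp [LinearMap.mem_ker, hg]
  · have h : g x = -x := by
      rw [LinearMap.mem_ker] at hx
      exact eq_neg_of_add_eq_zero_left hx
    simp only [LinearMap.smul_apply, LinearMap.sub_apply, LinearMap.id_apply, h]
    module

theorem trace_half_id_add {g : W →ₗ[ℝ] W} (hg : ∀ x, g (g x) = x) :
    LinearMap.trace ℝ W ((1 / 2 : ℝ) • (LinearMap.id + g)) =
      Module.finrank ℝ (LinearMap.ker (g - LinearMap.id)) := by
  have h := trace_half_id_sub (g := -g) (by simp [hg])
  rw [sub_neg_eq_add] at h
  have hk : LinearMap.ker (-g + LinearMap.id) = LinearMap.ker (g - LinearMap.id) := by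
    ext x
    simp only [LinearMap.mem_ker, LinearMap.add_apply, LinearMap.neg_apply, LinearMap.sub_apply,
      LinearMap.id_apply]
    rw [← neg_eq_zero, neg_add, neg_neg, ← sub_eq_add_neg]
  rw [h, hk]

end Ranks

section Functions

variable {n : ℕ} {M : Type*} [TopologicalSpace M] [ChartedSpace (EuclideanSpace ℝ (Fin n)) M]

/-- The reciprocal of a nowhere vanishing smooth function. -/
def invFun (f : C^∞⟮𝓡 n, M; ℝ⟯) (hf : ∀ p, f p ≠ 0) : C^∞⟮𝓡 n, M; ℝ⟯ :=
  ⟨fun p => (f p)⁻¹, f.contMDiff.inv₀ hf⟩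

theorem two_mul_apply (f : C^∞⟮𝓡 n, M; ℝ⟯) (p : M) :
    ((2 : C^∞⟮𝓡 n, M; ℝ⟯) * f) p = 2 * f p := by
  rw [two_mul, two_mul]
  rfl

theorem invFun_mul (f : C^∞⟮𝓡 n, M; ℝ⟯) (hf : ∀ p, f p ≠ 0) : invFun f hf * f = 1 :=
  ContMDiffMap.ext fun p => inv_mul_cancel₀ (hf p)

theorem HasTimeDeriv.inv {J : Set ℝ} {t : ℝ} {f : ℝ → C^∞⟮𝓡 n, M; ℝ⟯} {f' : C^∞⟮𝓡 n, M; ℝ⟯}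
    (h : HasTimeDeriv J t f f') (hf : ∀ s p, f s p ≠ 0) :
    HasTimeDeriv J t (fun s => invFun (f s) (hf s)) (-f' * invFun (f t) (hf t) ^ 2) := by
  refine ⟨h.1.inv₀ fun x _ => hf x.1 x.2, fun p => ?_⟩
  have h1 := (h.2 p).inv (hf t p)
  refine h1.congr_deriv ?_
  change -f' p / f t p ^ 2 = -f' p * ((f t p)⁻¹) ^ 2
  rw [div_eq_mul_inv, inv_pow]

end Functions

namespace HalfDensity

variable {n : ℕ} {M : Type*} [TopologicalSpace M] [ChartedSpace (EuclideanSpace ℝ (Fin n)) M]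
  [IsManifold (𝓡 n) ∞ M]

/-- The ratio of two positive half-densities is a function. -/
theorem coeff_ratio (σ σ' : HalfDensity n M) {p₀ q : M}
    (hq : q ∈ (chartAt (EuclideanSpace ℝ (Fin n)) p₀).source) :
    σ'.coeff p₀ q / σ.coeff p₀ q = σ'.coeff q q / σ.coeff q q := by
  have h1 := σ.coeff_change hq (mem_chart_source _ q)
  have h2 := σ'.coeff_change hq (mem_chart_source _ q)
  have a1 := σ.coeff_pos hq
  have a2 := σ'.coeff_pos hq
  have a3 := σ.coeff_pos (mem_chart_source _ q)
  have a4 := σ'.coeff_pos (mem_chart_source _ q)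
  refine (pow_left_inj₀ (div_pos a2 a1).le (div_pos a4 a3).le (n := 4) (by norm_num)).mp ?_
  -- Both coefficients scale by the same power of the Jacobian, which cancels in the ratio once it
  -- is known to be nonzero.
  have h0 : LinearMap.det (tangentCoordChange (𝓡 n) p₀ q q).toLinearMap ^ 2 ≠ 0 := fun h => by
    rw [h, zero_mul] at h1
    exact a1.ne' (pow_eq_zero_iff (by norm_num) |>.mp h1)
  rw [div_pow, div_pow, h1, h2, mul_div_mul_left _ _ h0]

/-- The logarithm of the ratio of two positive half-densities. -/
def logRatio (σ σ' : HalfDensity n M) : C^∞⟮𝓡 n, M; ℝ⟯ :=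
  ⟨fun q => Real.log (σ'.coeff q q / σ.coeff q q), fun p => by
    have hm : (chartAt (EuclideanSpace ℝ (Fin n)) p).source ∈ nhds p :=
      (chartAt (EuclideanSpace ℝ (Fin n)) p).open_source.mem_nhds (mem_chart_source _ p)
    have h1 := ((σ'.smooth p).contMDiffAt hm).div₀ ((σ.smooth p).contMDiffAt hm)
      (σ.coeff_pos (mem_chart_source _ p)).ne'
    have h2 : ContMDiffAt (𝓡 n) 𝓘(ℝ, ℝ) ∞
        (fun q => Real.log (σ'.coeff p q / σ.coeff p q)) p :=
      (Real.contDiffAt_log.mpr (div_pos (σ'.coeff_pos (mem_chart_source _ p))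
        (σ.coeff_pos (mem_chart_source _ p))).ne').contMDiffAt.comp p h1
    refine h2.congr_of_eventuallyEq ?_
    filter_upwards [hm] with q hq
    rw [coeff_ratio σ σ' hq]⟩

theorem logRatio_apply (σ σ' : HalfDensity n M) {p₀ q : M}
    (hq : q ∈ (chartAt (EuclideanSpace ℝ (Fin n)) p₀).source) :
    logRatio σ σ' q = Real.log (σ'.coeff p₀ q / σ.coeff p₀ q) := by
  rw [coeff_ratio σ σ' hq]
  rfl

theorem coeff_eq_exp_logRatio (σ σ' : HalfDensity n M) {p₀ q : M}
    (hq : q ∈ (chartAt (EuclideanSpace ℝ (Fin n)) p₀).source) :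
    σ'.coeff p₀ q = Real.exp (logRatio σ σ' q) * σ.coeff p₀ q := by
  rw [logRatio_apply σ σ' hq, Real.exp_log (div_pos (σ'.coeff_pos hq) (σ.coeff_pos hq)),
    div_mul_cancel₀ _ (σ.coeff_pos hq).ne']

theorem logRatio_self (σ : HalfDensity n M) : logRatio σ σ = 0 :=
  ContMDiffMap.ext fun q => by
    rw [logRatio_apply σ σ (mem_chart_source _ q),
      div_self (σ.coeff_pos (mem_chart_source _ q)).ne', Real.log_one]
    rfl

theorem hasTimeDeriv_logRatio {J : Set ℝ} {σ : ℝ → HalfDensity n M} {t : ℝ}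
    (hσ : ∀ p₀ : M, ContMDiffOn (𝓘(ℝ, ℝ).prod (𝓡 n)) 𝓘(ℝ, ℝ) ∞
      (fun x : ℝ × M => (σ x.1).coeff p₀ x.2)
      (J ×ˢ (chartAt (EuclideanSpace ℝ (Fin n)) p₀).source)) {R : C^∞⟮𝓡 n, M; ℝ⟯}
    (hflow : ∀ (p : M) (v : Fin n → TangentSpace (𝓡 n) p),
      HasDerivWithinAt (fun s => (σ s).toFun p v) (-(1 / 2) * R p * (σ t).toFun p v) J t) :
    HasTimeDeriv J t (fun s => (σ t).logRatio (σ s)) (-(1 / 2 : ℝ) • R) := by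
  refine ⟨contMDiffOn_prod_univ fun p₀ => ?_, fun p => ?_⟩
  · have h1 : ContMDiffOn (𝓘(ℝ, ℝ).prod (𝓡 n)) 𝓘(ℝ, ℝ) ∞
        (fun x : ℝ × M => (σ x.1).coeff p₀ x.2 / (σ t).coeff p₀ x.2)
        (J ×ˢ (chartAt (EuclideanSpace ℝ (Fin n)) p₀).source) :=
      (hσ p₀).div₀ (((σ t).smooth p₀).comp contMDiffOn_snd fun x hx => hx.2)
        fun x hx => ((σ t).coeff_pos hx.2).ne'
    have h2 : ContMDiffOn 𝓘(ℝ, ℝ) 𝓘(ℝ, ℝ) ∞ Real.log {0}ᶜ :=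
      Real.contDiffOn_log.contMDiffOn
    refine (h2.comp h1 fun x hx => ?_).congr fun x hx => ?_
    · exact (div_pos ((σ x.1).coeff_pos hx.2) ((σ t).coeff_pos hx.2)).ne'
    · exact (σ t).logRatio_apply (σ x.1) hx.2
  · have hp := mem_chart_source (EuclideanSpace ℝ (Fin n)) p
    have h1 := hflow p (fun i =>
      (trivializationAt (EuclideanSpace ℝ (Fin n)) (TangentSpace (𝓡 n)) p).symmL ℝ p
        (EuclideanSpace.single i 1))
    have h2 : HasDerivWithinAt (fun s => (σ s).coeff p p) (-(1 / 2) * R p * (σ t).coeff p p) J t :=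
      h1
    have hpos := (σ t).coeff_pos hp
    have h3 := (h2.div_const ((σ t).coeff p p)).log (div_pos hpos hpos).ne'
    refine (h3.congr_deriv ?_).congr (fun s _ => (σ t).logRatio_apply (σ s) hp)
      ((σ t).logRatio_apply (σ t) hp)
    change _ = -(1 / 2 : ℝ) * R p
    field_simp

end HalfDensity

section Flow

variable {n : ℕ} {M : Type*} [TopologicalSpace M] [ChartedSpace (EuclideanSpace ℝ (Fin n)) M]
  [IsManifold (𝓡 n) ∞ M]
  {F : Type*} [NormedAddCommGroup F] [NormedSpace ℝ F]
  {E : M → Type*} [TopologicalSpace (TotalSpace F E)]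
  [∀ p, AddCommGroup (E p)] [∀ p, Module ℝ (E p)] [∀ p, TopologicalSpace (E p)]
  [FiberBundle F E] [VectorBundle ℝ F E] {C : CourantAlgebroid n F E}

/-- This puts the divergence at time `s` in the form `div_t + 2 dφ_s` required by `hasD_scal`. -/
theorem CourantAlgebroid.divSec_logRatio (σ σ' : HalfDensity n M) (u : Sec n F E) :
    C.divSec σ' u = C.divSec σ u + 2 * C.anchorSec u (σ.logRatio σ') :=
  ContMDiffMap.ext fun p => by
    change _ = C.divSec σ u p + (2 * C.anchorSec u (σ.logRatio σ')) p
    rw [two_mul_apply]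
    exact σ.vdiv_rescale (C.anchor_smooth u) (σ.logRatio σ').contMDiff
      fun _ hq => σ.coeff_eq_exp_logRatio σ' hq

variable [ContMDiffVectorBundle ∞ F E (𝓡 n)] [SigmaCompactSpace M] [T2Space M]
  [FiniteDimensional ℝ F]
  {ι : Type*} [Fintype ι] {e e' : ι → Sec n F E}
  {hee : ∀ (p : M) (x : E p), ∑ i, C.pairing p x (e' i p) • e i p = x}

local notation "𝒬" => CourantAlgebroid.toModule C e e' hee

theorem tr_pair_apply {T : Sec n F E → Sec n F E} {p : M} {g : E p →ₗ[ℝ] E p}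
    (hT : ∀ u, T u p = g (u p)) :
    (𝒬).tr (fun x y => (𝒬).pair (T x) y) p = LinearMap.trace ℝ (E p) g := by
  rw [trace_eq_sum C, CourantModule.tr, fun_sum_apply]
  refine Eq.trans ?_ (sum_frame_coframe C hee (LinearMap.comp (C.pairing p) g)).symm
  refine Finset.sum_congr rfl fun i _ => ?_
  change C.pairing p (T (e i) p) _ = _
  rw [hT]
  rfl

variable (hee) in
-- The trace of the projection is the rank of `V_+`, so the excluded rank one is exactly what makes
-- the number invertible.
theorem tr_projPos_sub_one_ne_zero (G : GenPseudometric C) (p : M) :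
    ((𝒬).tr (fun x y => (𝒬).pair (CourantModule.projNeg (-G.toLin) x) y) - 1) p ≠ 0 := by
  have : FiniteDimensional ℝ (E p) := Module.Finite.of_basis (frame F E p)
  change (𝒬).tr (fun x y => (𝒬).pair (CourantModule.projNeg (-G.toLin) x) y) p - 1 ≠ 0
  rw [tr_pair_apply (g := (1 / 2 : ℝ) • (LinearMap.id + G.toFun p)) (fun u => by
    simp [CourantModule.projNeg_apply]), trace_half_id_add (G.involutive p), sub_ne_zero]
  exact_mod_cast G.rank_pos p

variable (hee) in
theorem tr_projNeg_sub_one_ne_zero (G : GenPseudometric C) (p : M) :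
    ((𝒬).tr (fun x y => (𝒬).pair (CourantModule.projNeg G.toLin x) y) - 1) p ≠ 0 := by
  have : FiniteDimensional ℝ (E p) := Module.Finite.of_basis (frame F E p)
  change (𝒬).tr (fun x y => (𝒬).pair (CourantModule.projNeg G.toLin x) y) p - 1 ≠ 0
  rw [tr_pair_apply (g := (1 / 2 : ℝ) • (LinearMap.id - G.toFun p)) (fun u => by
    simp [CourantModule.projNeg_apply]), trace_half_id_sub (G.involutive p), sub_ne_zero]
  exact_mod_cast G.rank_neg p

/-- Levi-Civita connections exist. -/
theorem exists_isLeviCivita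
    (hee : ∀ (p : M) (x : E p), ∑ i, C.pairing p x (e' i p) • e i p = x)
    (G : GenPseudometric C) (σ : HalfDensity n M) :
    ∃ D : Connection C, IsLeviCivita C G σ D := by
  obtain ⟨D, h1, h2, h3⟩ := CourantModule.Conn.exists_leviCivita (C.toModule e e' hee)
    G.isInvolution (invFun_mul _ (tr_projPos_sub_one_ne_zero hee G))
    (invFun_mul _ (tr_projNeg_sub_one_ne_zero hee G)) (C.divSec_add σ) (C.divSec_smul σ)
  obtain ⟨D', rfl⟩ := exists_toConn_eq D
  exact ⟨D', isLeviCivita_iff.mpr ⟨h1, h2, h3⟩⟩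

theorem isLeviCivita_choose
    (hee : ∀ (p : M) (x : E p), ∑ i, C.pairing p x (e' i p) • e i p = x)
    (G : GenPseudometric C) (σ : HalfDensity n M) :
    ∃ D : Connection C, IsLeviCivita C G σ D ∧ (∀ p, scalar C G σ p = D.scalar G p) ∧
      ∀ (p : M) (u v : E p), CourantFlow.ricci C G σ p u v = D.ricci G p u v := by
  have h := exists_isLeviCivita hee G σ
  exact ⟨h.choose, h.choose_spec, fun p => by rw [scalar, dif_pos h],
    fun p u v => by rw [CourantFlow.ricci, dif_pos h]⟩

/-- The evolution equation for the scalar curvature, on an interval with nonempty interior. -/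
theorem scalar_evolution
    (hee : ∀ (p : M) (x : E p), ∑ i, C.pairing p x (e' i p) • e i p = x)
    {J : Set ℝ} (hJ : UniqueDiffOn ℝ J) (hJc : J ⊆ closure (interior J))
    {G : ℝ → GenPseudometric C} {σ : ℝ → HalfDensity n M} (h : IsRicciFlow C J G σ)
    {t : ℝ} (ht : t ∈ J) (p : M) :
    HasDerivWithinAt (fun s => scalar C (G s) (σ s) p)
      (laplacian C (G t) (σ t) (scalar C (G t) (σ t)) p +
        normSq C (G t) p (CourantFlow.ricci C (G t) (σ t) p)) J t := by
  -- The connections are chosen separately for each `s`, with no regularity in `s`. Only `D t` is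
  -- differentiated; the others serve to identify `R s`.
  choose D hLC hscal hric using fun s => isLeviCivita_choose hee (G s) (σ s)
  have hlc := fun s => (isLeviCivita_iff (hee := hee)).mp (hLC s)
  let T := timeDeriv C (h := hee) hJ hJc ht
  let R : ℝ → C^∞⟮𝓡 n, M; ℝ⟯ := fun s => ((D s).toConn hee).scal (G s).toLin
  have hR : ∀ s, scalar C (G s) (σ s) = R s := fun s => by
    funext q
    rw [hscal, Connection.scalar_eq (hlc s).1]
  have hr : ∀ q, CourantFlow.ricci C (G t) (σ t) q = (D t).ricci (G t) q := fun q => by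
    funext u v
    exact hric t q u v
  have hG : ∀ u v, T.HasD (fun s => (C.toModule e e' hee).pair ((G s).toLin u) v)
      (-2 * ((D t).toConn hee).ric (G t).toLin u v) := fun u v => by
    refine ⟨h.smooth_G u v, fun q => ?_⟩
    have h1 := h.flow_G t ht q (u q) (v q)
    rw [hr, Connection.ricci_sections (hlc t).1] at h1
    refine (h1.congr_deriv ?_).congr (fun s _ => C.pairing_comm q _ _) (C.pairing_comm q _ _)
    rw [neg_mul, neg_mul]
    exact congrArg Neg.neg (two_mul_apply _ q).symm
  have hGd : ∀ u v, T.Diff (fun s => (C.toModule e e' hee).pair ((G s).toLin u) v) := fun u v => ⟨_, hG u v⟩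
  have hφ : T.HasD (fun s => (σ t).logRatio (σ s))
      (-(1 / 2 : ℝ) • ((D t).toConn hee).scal (G t).toLin) := by
    refine HalfDensity.hasTimeDeriv_logRatio h.smooth_σ fun q v => ?_
    have h1 := h.flow_σ t ht q v
    rwa [hR] at h1
  have hdiff : ∀ {r : ℝ → C^∞⟮𝓡 n, M; ℝ⟯} (_ : T.Diff r) (hr0 : ∀ s q, r s q ≠ 0),
      T.Diff (fun s => invFun (r s) (hr0 s)) := fun ⟨_, hr'⟩ hr0 => ⟨_, HasTimeDeriv.inv hr' hr0⟩
  have hpos := CourantModule.TimeDeriv.Diff.tr (CourantModule.TimeDeriv.diff_projNeg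
    (CourantModule.TimeDeriv.diff_neg hGd)) |>.sub (CourantModule.TimeDeriv.diff_const 1)
  have hneg := CourantModule.TimeDeriv.Diff.tr (CourantModule.TimeDeriv.diff_projNeg hGd) |>.sub
    (CourantModule.TimeDeriv.diff_const 1)
  have key := CourantModule.TimeDeriv.hasD_scal (T := T)
    (G := fun s => (G s).toLin) (hlc t).1 (C.isFlat_of_div (hlc t).2.2)
    (fun s => (G s).isInvolution) (hlc t).2.1 hG hφ (σ t).logRatio_self
    (hdiff hpos fun s => tr_projPos_sub_one_ne_zero hee (G s))
    (hdiff hneg fun s => tr_projNeg_sub_one_ne_zero hee (G s))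
    (fun s => invFun_mul _ _) (fun s => invFun_mul _ _) (R := R)
    -- Any torsion-free connection preserving `G s` whose divergence is `div_t + 2 dφ_s` has the
    -- same scalar curvature as the chosen `D s`.
    (fun s D' h1 h2 h3 => CourantModule.Conn.scal_unique h1 (hlc s).1 (G s).isInvolution h2
      (hlc s).2.1 fun u => by
        rw [h3, (hlc s).2.2, (hlc t).2.2]
        exact (C.divSec_logRatio (σ t) (σ s) u).symm)
  have h1 := key.2 p
  simp only [hR, hr]
  rw [laplacian_eq (hlc t).2.1 (hlc t).2.2, Connection.normSq_ricci (hlc t).1]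
  exact h1

theorem contMDiff_scalar
    (hee : ∀ (p : M) (x : E p), ∑ i, C.pairing p x (e' i p) • e i p = x)
    (G : GenPseudometric C) (σ : HalfDensity n M) :
    ContMDiff (𝓡 n) 𝓘(ℝ, ℝ) ∞ (scalar C G σ) := by
  obtain ⟨D, hLC, hscal, -⟩ := isLeviCivita_choose hee G σ
  have h := (isLeviCivita_iff (hee := hee)).mp hLC
  have : scalar C G σ = (D.toConn hee).scal G.toLin := by
    funext q
    rw [hscal, Connection.scalar_eq h.1]
  rw [this]
  exact ((D.toConn hee).scal G.toLin).contMDiff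

end Flow

end

end CourantFlow

theorem mainTheorem3 {n : ℕ} {M : Type*} [TopologicalSpace M]
    [ChartedSpace (EuclideanSpace ℝ (Fin n)) M] [IsManifold (𝓡 n) ∞ M]
    [CompactSpace M] [T2Space M]
    {F : Type*} [NormedAddCommGroup F] [NormedSpace ℝ F] [FiniteDimensional ℝ F]
    {E : M → Type*} [TopologicalSpace (TotalSpace F E)]
    [∀ p, AddCommGroup (E p)] [∀ p, Module ℝ (E p)] [∀ p, TopologicalSpace (E p)]
    [FiberBundle F E] [VectorBundle ℝ F E] [ContMDiffVectorBundle ∞ F E (𝓡 n)]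
    (C : CourantFlow.CourantAlgebroid n F E) (J : Set ℝ) (hJ : J.OrdConnected)
    (G : ℝ → CourantFlow.GenPseudometric C) (σ : ℝ → CourantFlow.HalfDensity n M) (h : CourantFlow.IsRicciFlow C J G σ) :
    ∀ t ∈ J, ContMDiff (𝓡 n) 𝓘(ℝ, ℝ) ∞ (CourantFlow.scalar C (G t) (σ t)) ∧
      ∀ p : M, HasDerivWithinAt (fun s => CourantFlow.scalar C (G s) (σ s) p)
        (CourantFlow.laplacian C (G t) (σ t) (CourantFlow.scalar C (G t) (σ t)) p +
          CourantFlow.normSq C (G t) p (CourantFlow.ricci C (G t) (σ t) p)) J t := by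
  intro t ht
  obtain ⟨N, e, e', hee⟩ := CourantFlow.exists_dual_frames C
  refine ⟨CourantFlow.contMDiff_scalar hee (G t) (σ t), fun p => ?_⟩
  rcases J.subsingleton_or_nontrivial with hs | hs
  -- On an interval with at most one point every value is a derivative within it.
  · exact HasFDerivWithinAt.of_subsingleton hs
  · obtain ⟨a, ha, b, hb, hab⟩ := hs.exists_lt
    -- Two distinct times give an open interval inside `J`. By convexity `J` then has unique
    -- derivatives and lies in the closure of its interior.
    have hi : (interior J).Nonempty :=
      (nonempty_Ioo.mpr hab).mono (interior_maximal
        (Ioo_subset_Icc_self.trans (hJ.out ha hb)) isOpen_Ioo)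
    refine CourantFlow.scalar_evolution hee (uniqueDiffOn_convex hJ.convex hi) ?_ h ht p
    rw [Convex.closure_interior_eq_closure_of_nonempty_interior (𝕜 := ℝ) hJ.convex hi]
    exact subset_closure
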